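/- Let $n>p\ge 1$ be integers. Let $f(x;\theta)$, $x\in\mathbb R^p$, $\theta\ge 0$, be probability densities on $\mathbb R^p$, continuously differentiable in $\theta\in[0,\infty)$ (one-sided at $\theta=0$), with $f(x;0)=(2\pi)^{-p/2}e^{-\|x\|^2/2}$, and let $$f_{a,B}(x;\theta)=|\det B|^{-1}f(B^{-1}(x-a);\theta),\qquad a\in\mathbb R^p,\ B\in GL(p).$$ Assume that (i) for some constants $p_0>0$ and $p_1,p_2\in\mathbb R$, $$\frac{\partial_\theta f(x;\theta)|_{\theta=0}}{f(x;0)}=p_0\|x\|^4+p_1\|x\|^2+p_2\qquad\text{for all }x\in\mathbb R^p;$$ (ii) for some $\epsilon>0$, $$\int_{GL(p)}\int_{\mathbb R^p} g(a,B;\epsilon)^n\exp\Big(-\frac n2\|a\|^2-\frac n2\mathrm{tr}(B'B)\Big)|\det B|^{n-p-1}\,da\,dB<\infty,$$ where $$g(a,B;\epsilon)=\sup_{\|z\|\le 1,\ 0\le\theta\le\epsilon}\frac{|\partial_\theta f(a+Bz;\theta)|}{f(a+Bz;0)} .$$ Let $x_1,\dots,x_n$ be i.i.d. from $f_{a,B}(\cdot;\theta)$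 with $(a,B)\in\mathbb R^p\times GL(p)$ unknown, and consider testing $H_0:\theta=0$ (multivariate normality) against $H_1:\theta>0$. Let $\bar x=\frac1n\sum_i x_i$, $S=\frac1n\sum_i(x_i-\bar x)(x_i-\bar x)'$, let $LT(p)$ be the group of lower triangular $p\times p$ matrices with positive diagonal, let $T\in LT(p)$ be the Cholesky root of $S$ ($S=TT'$; it exists almost surely), and let $z_i=T^{-1}(x_i-\bar x)=(z_{i1},\dots,z_{ip})'$. For $G=GL(p)$ or $G=LT(p)$, a (possibly randomized) test is invariant under $\mathbb R^p\times G$ if it is unchanged when $(x_1,\dots,x_n)$ is replaced by $(a+Bx_1,\dots,a+Bx_n)$, for all $a\in\mathbb R^p$ and $B\in G$. A locally best invariant (LBI) test of size $\alpha$ is an invariant test of size $\alpha$ such that for every invariant test of level $\alpha$ and every $(a,B)\in\mathbb R^p\times GL(p)$, the power of the former at $(a,B,\theta)$ is at least that of the latter for all sufficiently small $\theta>0$. Then the LBI test rejects for large values of $$\sum_{i=1}^n\|z_i\|^4\qquad\text{under } \mathbb R^p\times GL(p),$$ and for large values of $$(n+p+2)(n+p)\sum_{i=1}^n\|z_i\|^4-2(n+p+2)\sum_{i=1}^n\sum_{j,k=1}^p\max(j,k)z_{ij}^2z_{ik}^2-2(n+p)\sum_{i=1}^n\sum_{j,k=1}^p\min(j,k)z_{ij}^2z_{ik}^2+4\sum_{i=1}^n\Big(\sum_{j=1}^p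 j\,z_{ij}^2\Big)^2$$ under $\mathbb R^p\times LT(p)$. Precisely, writing $Q$ for the statistic: for every $k\in\mathbb R$ the rejection region $\{Q>k\}$ defines an LBI test (of size $\alpha=P_0(Q>k)$, the probability under $\theta=0$), and it is, up to Lebesgue-null sets, the only LBI test of size $\alpha$; and for every LBI test of any size there is a $k$ such that, almost everywhere, it rejects where $Q>k$ and accepts where $Q<k$. -/

import Mathlib

open MeasureTheory

namespace MultiNormalityTest

noncomputable section

/-- Column vectors in `ℝ^p` with the Euclidean norm. -/
abbrev Vec (p : ℕ) := EuclideanSpace ℝ (Fin p)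

/-- A sample `X = (x_1, …, x_n)` of `n` vectors in `ℝ^p`. -/
abbrev Sample (n p : ℕ) := Fin n → Vec p

/-- The product of a square matrix and a column vector. -/
def act {p : ℕ} (B : Matrix (Fin p) (Fin p) ℝ) (x : Vec p) : Vec p :=
  WithLp.toLp 2 (B.mulVec x.ofLp)

/-! ### The model -/

/-- The standing assumptions on the standard densities `f(x; θ)`, `θ ≥ 0`: they are probability
densities on `ℝ^p`, continuously differentiable in `θ` up to the boundary `θ = 0`, and `θ = 0` is the
standard normal density. -/
structure IsShapeFamily {p : ℕ} (f : Vec p → ℝ → ℝ) : Prop where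
  measurable : ∀ θ, 0 ≤ θ → Measurable fun x => f x θ
  nonneg : ∀ x θ, 0 ≤ θ → 0 ≤ f x θ
  lintegral_eq_one : ∀ θ, 0 ≤ θ → ∫⁻ x, ENNReal.ofReal (f x θ) = 1
  contDiffOn : ∀ x, ContDiffOn ℝ 1 (f x) (Set.Ici 0)
  normal : ∀ x, f x 0 = (2 * Real.pi) ^ (-(p : ℝ) / 2) * Real.exp (-‖x‖ ^ 2 / 2)

/-- The partial derivative `∂f(x; θ)/∂θ` for `θ ≥ 0` (one-sided at `θ = 0`). -/
def dtheta {p : ℕ} (f : Vec p → ℝ → ℝ) (x : Vec p) (θ : ℝ) : ℝ :=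
  derivWithin (f x) (Set.Ici 0) θ

/-- `g(a, B; ε)`, the supremum of `|∂f(a + B z; θ)/∂θ| / f(a + B z; 0)` over `‖z‖ ≤ 1`,
`0 ≤ θ ≤ ε`, as an extended nonnegative number. -/
def envelope {p : ℕ} (f : Vec p → ℝ → ℝ) (ε : ℝ) (a : Vec p) (B : Matrix (Fin p) (Fin p) ℝ) :
    ENNReal :=
  ⨆ z ∈ Metric.closedBall (0 : Vec p) 1, ⨆ θ ∈ Set.Icc (0 : ℝ) ε,
    ENNReal.ofReal (|dtheta f (a + act B z) θ| / f (a + act B z) 0)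

/-- The score at `θ = 0` is `p₀ ‖x‖⁴ + p₁ ‖x‖² + p₂` with `p₀ > 0`, and the envelope of the
derivatives is integrable (to the power `n`). -/
structure QuarticScoreCondition {p : ℕ} (n : ℕ) (f : Vec p → ℝ → ℝ) (p₀ p₁ p₂ : ℝ) : Prop where
  pos : 0 < p₀
  score : ∀ x, dtheta f x 0 / f x 0 = p₀ * ‖x‖ ^ 4 + p₁ * ‖x‖ ^ 2 + p₂
  integrable : ∃ ε > (0 : ℝ),
    ∫⁻ b in {b : Fin p → Fin p → ℝ | (Matrix.of b).det ≠ 0}, ∫⁻ a : Vec p,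
      envelope f ε a (Matrix.of b) ^ n *
        ENNReal.ofReal (Real.exp (-(n : ℝ) / 2 * ‖a‖ ^ 2
            - (n : ℝ) / 2 * ((Matrix.of b).transpose * Matrix.of b).trace)
          * |(Matrix.of b).det| ^ (n - p - 1)) < ⊤

/-- The density `f_{a,B}(x; θ) = |det B|⁻¹ f(B⁻¹ (x - a); θ)`. -/
def density {p : ℕ} (f : Vec p → ℝ → ℝ) (a : Vec p) (B : Matrix (Fin p) (Fin p) ℝ) (θ : ℝ)
    (x : Vec p) : ℝ :=
  |B.det|⁻¹ * f (act B⁻¹ (x - a)) θ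

/-- The law of an i.i.d. sample of size `n` from `f_{a,B}(·; θ)`. -/
def sampleLaw {p : ℕ} (n : ℕ) (f : Vec p → ℝ → ℝ) (a : Vec p) (B : Matrix (Fin p) (Fin p) ℝ)
    (θ : ℝ) : Measure (Sample n p) :=
  Measure.pi fun _ => volume.withDensity fun x => ENNReal.ofReal (density f a B θ x)

/-! ### Groups and invariant tests -/

/-- `GL(p)`. -/
def glSet (p : ℕ) : Set (Matrix (Fin p) (Fin p) ℝ) := {B | B.det ≠ 0}

/-- `LT(p)`: lower triangular matrices with positive diagonal elements. -/
def ltSet (p : ℕ) : Set (Matrix (Fin p) (Fin p) ℝ) :=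
  {L | (∀ i j, i < j → L i j = 0) ∧ ∀ i, 0 < L i i}

/-- A (possibly randomized) test: a measurable critical function, whose value at `X` is the
probability of rejecting. A rejection region is the case of an indicator function. -/
structure IsTest {n p : ℕ} (φ : Sample n p → ℝ) : Prop where
  measurable : Measurable φ
  nonneg : ∀ X, 0 ≤ φ X
  le_one : ∀ X, φ X ≤ 1

/-- Invariance under the action `x_i ↦ a + B x_i` of `ℝ^p × G`. -/
def IsInvariant {n p : ℕ} (G : Set (Matrix (Fin p) (Fin p) ℝ)) (φ : Sample n p → ℝ) : Prop :=
  ∀ a : Vec p, ∀ B ∈ G, ∀ X : Sample n p, φ (fun i => a + act B (X i)) = φ X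

/-- The probability of rejection under `f_{a,B}(·; θ)`. -/
def power {n p : ℕ} (f : Vec p → ℝ → ℝ) (φ : Sample n p → ℝ) (a : Vec p)
    (B : Matrix (Fin p) (Fin p) ℝ) (θ : ℝ) : ℝ :=
  ∫ X, φ X ∂(sampleLaw n f a B θ)

/-- `φ` is a locally best invariant test of size `α` of `θ = 0` against `θ > 0` under `ℝ^p × G`:
it is invariant, it has size `α`, and no invariant test of level `α` has larger power, at any
`(a, B)`, for all sufficiently small `θ > 0`. -/
structure IsLBI {n p : ℕ} (f : Vec p → ℝ → ℝ) (G : Set (Matrix (Fin p) (Fin p) ℝ)) (α : ℝ)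
    (φ : Sample n p → ℝ) : Prop where
  isTest : IsTest φ
  invariant : IsInvariant G φ
  size : ∀ a, ∀ B ∈ glSet p, power f φ a B 0 = α
  locally_best : ∀ ψ : Sample n p → ℝ, IsTest ψ → IsInvariant G ψ →
    (∀ a, ∀ B ∈ glSet p, power f ψ a B 0 ≤ α) →
    ∀ a, ∀ B ∈ glSet p, ∃ ε > (0 : ℝ), ∀ θ ∈ Set.Ioo 0 ε, power f ψ a B θ ≤ power f φ a B θ

/-- The LBI test rejects for large values of the statistic `T`: every region `{T > k}` is the
rejection region of an LBI test (of the size of the region), which is almost everywhere the only LBI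
test of that size; and every LBI test, of any size, rejects where `T > k` and accepts where `T < k`
for some `k`, almost everywhere. -/
structure LBIRejectsForLarge {n p : ℕ} (f : Vec p → ℝ → ℝ) (G : Set (Matrix (Fin p) (Fin p) ℝ))
    (T : Sample n p → ℝ) : Prop where
  region : ∀ k : ℝ, ∃ α : ℝ, IsLBI f G α ({X | k < T X}.indicator fun _ => (1 : ℝ)) ∧
    ∀ ψ, IsLBI f G α ψ → ψ =ᵐ[volume] {X | k < T X}.indicator fun _ => (1 : ℝ)
  necessary : ∀ (α : ℝ) (φ : Sample n p → ℝ), IsLBI f G α φ →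
    ∃ k : ℝ, ∀ᵐ X, (k < T X → φ X = 1) ∧ (T X < k → φ X = 0)

/-! ### Standardized observations -/

/-- `x̄`. -/
def sampleMean {n p : ℕ} (X : Sample n p) : Vec p := (n : ℝ)⁻¹ • ∑ i, X i

/-- `S = n⁻¹ ∑ (x_i - x̄)(x_i - x̄)'`. -/
def sampleCov {n p : ℕ} (X : Sample n p) : Matrix (Fin p) (Fin p) ℝ :=
  (n : ℝ)⁻¹ • ∑ i, Matrix.vecMulVec (X i - sampleMean X).ofLp (X i - sampleMean X).ofLp

open Classical in
/-- The Cholesky root of `S`: the `L ∈ LT(p)` with `L L' = S`. If there is none (that is, if `S` is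
not positive definite) it is `0`. -/
def choleskyRoot {p : ℕ} (S : Matrix (Fin p) (Fin p) ℝ) : Matrix (Fin p) (Fin p) ℝ :=
  if h : ∃ L ∈ ltSet p, L * L.transpose = S then h.choose else 0

/-- The Cholesky-standardized observation `z_i = L⁻¹ (x_i - x̄)`. -/
def standardized {n p : ℕ} (X : Sample n p) (i : Fin n) : Vec p :=
  act (choleskyRoot (sampleCov X))⁻¹ (X i - sampleMean X)

/-- `∑ ‖z_i‖⁴`. -/
def kurtosisStat {n p : ℕ} (X : Sample n p) : ℝ := ∑ i, ‖standardized X i‖ ^ 4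

/-- The weighted quartic statistic of the `z_{ij}`. Coordinates are numbered from `0` in `Fin p`, so
the `j`-th one is `j + 1` in the usual numbering. -/
def triangularStat {n p : ℕ} (X : Sample n p) : ℝ :=
  ((n : ℝ) + p + 2) * ((n : ℝ) + p) * ∑ i, ‖standardized X i‖ ^ 4
    - 2 * ((n : ℝ) + p + 2) * ∑ i, ∑ j : Fin p, ∑ k : Fin p,
        max ((j : ℝ) + 1) ((k : ℝ) + 1) * standardized X i j ^ 2 * standardized X i k ^ 2
    - 2 * ((n : ℝ) + p) * ∑ i, ∑ j : Fin p, ∑ k : Fin p,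
        min ((j : ℝ) + 1) ((k : ℝ) + 1) * standardized X i j ^ 2 * standardized X i k ^ 2
    + 4 * ∑ i, (∑ j : Fin p, ((j : ℝ) + 1) * standardized X i j ^ 2) ^ 2

end

end MultiNormalityTest

/-! The power slope at `θ = 0` of an invariant test `φ` is the standard normal expectation of `φ`
times the total score `∑ (p₀‖x_i‖⁴ + p₁‖x_i‖² + p₂)`. Since `φ` depends on the sample only through
invariants, the score may be replaced by its conditional expectation given them. The whole theorem
rests on showing that this replacement is a constant plus a positive multiple of the stated
statistic `T`; then the slope is `c₀ ∫ φ + c₁ ∫ φ T`, and among invariant tests of given size it is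
maximized exactly as in the Neyman–Pearson lemma (`lbiRejectsForLarge_of_integral_score`).

Conditional moments are computed without densities of maximal invariants. Arrange the sample as `p`
independent Gaussian vectors `Y_j` in `ℝ^n`, and let `V_j` be the span of the vector of ones and the
earlier `Y_k`. An `LT(p)`-invariant test, as a function of `Y_j` alone, is unchanged by positive
scalings and by shifts in `V_j`. Hence it does not see the projection on `V_j`, which stays normal,
nor the length of the residual, whose square stays chi-square; only the residual direction matters
(`lintegral_mul_inner_pow`). This gives the second and fourth moments of each entry as polynomials
in the `z_{ij}²`, and using the argument for two rows in turn gives mixed moments. Their sum is the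
triangular statistic up to constants, because `∑_i z_{ij}² = n` removes every linear term
(`integral_norm_pow_of_lt_invariant`).

A `GL(p)`-invariant test is also `LT(p)`-invariant, so the same moment formulas hold, and it is
invariant under rotations as well. Rotational symmetry fixes the moments of the entries up to a
common factor, and this turns the formulas into triangular linear systems for the weighted moments
of `z_{ij}²` and `z_{ij}² z_{il}²`. Solving them expresses `∫ φ ‖x_i‖⁴` through `∫ φ ‖z_i‖⁴`
(`integral_mul_sum_stdSq`).

Two analytic points remain. Differentiation under the integral needs only a Gaussian first moment of
the supremum of the relative `θ`-derivative, since the dominating function is a product of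
independent factors; that moment is extracted from the envelope hypothesis by restricting it to
matrices `B` near `2I` (`lintegral_scoreBound_shift_lt_top`,
`lintegral_stdGaussian_lt_top_of_shifted`). The alternatives range over all of `GL(p)` even for
`LT(p)`-invariant tests, but writing `B = LO` with `O` orthogonal absorbs `L` into the invariance,
and `O` changes neither the normal law nor the radial score, so the slope is the same at every `(a,
B)` (`tendsto_power_slope`). -/

open MeasureTheory ProbabilityTheory

namespace MultiNormalityTest

/-! ### Gaussian moments weighted by scale- and shift-invariant functions -/

section Gaussian

variable {E : Type*} [NormedAddCommGroup E] [InnerProductSpace ℝ E] [FiniteDimensional ℝ E]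
  [MeasurableSpace E] [BorelSpace E]

/-- The density of the standard normal distribution. -/
noncomputable def stdDensity (E : Type*) [NormedAddCommGroup E] [InnerProductSpace ℝ E] (x : E) : ℝ :=
  (2 * Real.pi) ^ (-(Module.finrank ℝ E : ℝ) / 2) * Real.exp (-‖x‖ ^ 2 / 2)

omit [FiniteDimensional ℝ E] [MeasurableSpace E] [BorelSpace E] in
lemma stdDensity_pos (x : E) : 0 < stdDensity E x := by
  unfold stdDensity; positivity

omit [FiniteDimensional ℝ E] [MeasurableSpace E] [BorelSpace E] in
lemma continuous_stdDensity : Continuous (stdDensity E) := by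
  unfold stdDensity; fun_prop

/-- This characteristic function identifies `stdGaussian` with the explicit density; its value at
`0` also yields integrability. -/
lemma integral_cexp_mul_stdDensity (t : E) :
    ∫ x, Complex.exp (inner ℝ x t * Complex.I) * (stdDensity E x : ℂ) =
      Complex.exp (-‖t‖ ^ 2 / 2) := by
  have h := GaussianFourier.integral_cexp_neg_mul_sq_norm_add (V := E) (b := 1 / 2)
    (by norm_num) Complex.I t
  have e : ∀ x : E, Complex.exp (inner ℝ x t * Complex.I) * (stdDensity E x : ℂ) =
      (((2 * Real.pi) ^ (-(Module.finrank ℝ E : ℝ) / 2) : ℝ) : ℂ) *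
        Complex.exp (-(1 / 2) * ‖x‖ ^ 2 + Complex.I * (inner ℝ t x : ℝ)) := by
    intro x
    rw [stdDensity, Complex.exp_add, real_inner_comm]
    push_cast
    rw [show -(1 / 2) * (‖x‖ : ℂ) ^ 2 = -(‖x‖ : ℂ) ^ 2 / 2 by ring,
      mul_comm Complex.I]
    ring
  simp_rw [e]
  rw [integral_const_mul, h]
  have hpi : (0 : ℝ) < 2 * Real.pi := by positivity
  have e2 : ((Real.pi : ℂ) / (1 / 2)) ^ ((Module.finrank ℝ E : ℂ) / 2) =
      (((2 * Real.pi) ^ ((Module.finrank ℝ E : ℝ) / 2) : ℝ) : ℂ) := by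
    rw [Complex.ofReal_cpow hpi.le]
    push_cast
    congr 1
    ring
  rw [e2, ← mul_assoc, ← Complex.ofReal_mul, ← Real.rpow_add hpi]
  rw [show -(Module.finrank ℝ E : ℝ) / 2 + (Module.finrank ℝ E : ℝ) / 2 = 0 by ring]
  simp only [Real.rpow_zero, Complex.ofReal_one, one_mul, Complex.I_sq]
  congr 1
  ring

lemma integrable_stdDensity : Integrable (stdDensity E) := by
  have h := integral_cexp_mul_stdDensity (0 : E)
  -- A non-integrable function has Bochner integral `0`, whereas the characteristic function at `0`
  -- equals `1`.
  by_contra hc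
  have : ∫ x, (stdDensity E x : ℂ) = 0 := by
    rw [integral_complex_ofReal, integral_undef hc]; simp
  simp only [inner_zero_right, Complex.ofReal_zero, zero_mul, Complex.exp_zero, one_mul] at h
  rw [this] at h
  simp at h

lemma stdGaussian_eq_withDensity :
    stdGaussian E = volume.withDensity fun x => ENNReal.ofReal (stdDensity E x) := by
  have : IsFiniteMeasure (volume.withDensity fun x : E => ENNReal.ofReal (stdDensity E x)) :=
    isFiniteMeasure_withDensity_ofReal integrable_stdDensity.2
  apply Measure.ext_of_charFun
  ext t
  rw [charFun_stdGaussian, charFun_apply, integral_withDensity_eq_integral_toReal_smul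
    (by have := continuous_stdDensity (E := E); fun_prop) (by simp)]
  rw [← integral_cexp_mul_stdDensity]
  congr 1
  ext x
  rw [ENNReal.toReal_ofReal (stdDensity_pos x).le, mul_comm]
  simp

/-- The scaling of the `U`-component by `t`. -/
noncomputable def scaleOn (U : Submodule ℝ E) (t : ℝ) : E →ₗ[ℝ] E :=
  LinearMap.id + (t - 1) • (U.starProjection : E →ₗ[ℝ] E)

omit [MeasurableSpace E] [BorelSpace E] in
lemma scaleOn_apply (U : Submodule ℝ E) (t : ℝ) (y : E) :
    scaleOn U t y = y + (t - 1) • U.starProjection y := rfl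

omit [MeasurableSpace E] [BorelSpace E] in
lemma starProjection_scaleOn (U : Submodule ℝ E) (t : ℝ) (y : E) :
    U.starProjection (scaleOn U t y) = t • U.starProjection y := by
  have : U.starProjection (U.starProjection y) = U.starProjection y :=
    U.starProjection_eq_self_iff.2 (U.starProjection_apply_mem y)
  rw [scaleOn_apply, map_add, map_smul, this]
  module

omit [MeasurableSpace E] [BorelSpace E] in
lemma det_scaleOn (U : Submodule ℝ E) (t : ℝ) :
    LinearMap.det (scaleOn U t) = t ^ Module.finrank ℝ U := by
  let e := U.prodEquivOfIsCompl Uᗮ U.isCompl_orthogonal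
  have : scaleOn U t = (e : _ →ₗ[ℝ] E) ∘ₗ
      ((t • LinearMap.id : U →ₗ[ℝ] U).prodMap (LinearMap.id : Uᗮ →ₗ[ℝ] Uᗮ)) ∘ₗ
      (e.symm : E →ₗ[ℝ] _) := by
    ext y
    obtain ⟨z, rfl⟩ := e.surjective y
    have h1 : U.starProjection (z.1 : E) = z.1 := U.starProjection_eq_self_iff.2 z.1.2
    have h2 : U.starProjection (z.2 : E) = 0 := by
      rw [Submodule.starProjection_apply_eq_zero_iff]; exact z.2.2
    simp only [scaleOn_apply, LinearMap.comp_apply, LinearEquiv.coe_coe,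
      LinearEquiv.symm_apply_apply, LinearMap.prodMap_apply]
    simp only [e, Submodule.coe_prodEquivOfIsCompl', map_add, h1, h2]
    simp
    module
  rw [this, LinearMap.det_conj, LinearMap.det_prodMap, LinearMap.det_smul]
  simp

omit [MeasurableSpace E] [BorelSpace E] in
lemma norm_sq_scaleOn (U : Submodule ℝ E) (t : ℝ) (y : E) :
    ‖scaleOn U t y‖ ^ 2 = ‖y‖ ^ 2 + (t ^ 2 - 1) * ‖U.starProjection y‖ ^ 2 := by
  have h : inner ℝ y (U.starProjection y) = ‖U.starProjection y‖ ^ 2 := by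
    rw [← real_inner_self_eq_norm_sq, U.inner_starProjection_left_eq_right,
      U.starProjection_eq_self_iff.2 (U.starProjection_apply_mem y)]
  rw [scaleOn_apply, norm_add_sq_real, real_inner_smul_right, h, norm_smul, mul_pow,
    Real.norm_eq_abs, sq_abs]
  ring

lemma lintegral_comp_scaleOn (U : Submodule ℝ E) {t : ℝ} (ht : 0 < t) {F : E → ENNReal}
    (hF : Measurable F) :
    ∫⁻ y, F y = ENNReal.ofReal (t ^ Module.finrank ℝ U) * ∫⁻ y, F (scaleOn U t y) := by
  have hd : LinearMap.det (scaleOn U t) ≠ 0 := by rw [det_scaleOn]; positivity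
  have hm : Measurable (scaleOn U t) :=
    (LinearMap.continuous_of_finiteDimensional _).measurable
  have h := Measure.map_linearMap_addHaar_eq_smul_addHaar (volume : Measure E) hd
  rw [← lintegral_map hF hm, h, lintegral_smul_measure, det_scaleOn, smul_eq_mul, ← mul_assoc,
    ← ENNReal.ofReal_mul (by positivity), abs_of_pos (by positivity), mul_inv_cancel₀ (by positivity)]
  simp

lemma lintegral_stdGaussian {F : E → ENNReal} (hF : Measurable F) :
    ∫⁻ y, F y ∂stdGaussian E = ∫⁻ y, ENNReal.ofReal (stdDensity E y) * F y := by
  rw [stdGaussian_eq_withDensity, lintegral_withDensity_eq_lintegral_mul _ _ hF]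
  · rfl
  · have := continuous_stdDensity (E := E); fun_prop

lemma measurable_norm_starProjection (U : Submodule ℝ E) :
    Measurable fun y => ‖U.starProjection y‖ :=
  (U.starProjection.continuous.norm).measurable

/-- Scaling the `U`-component by `t = (1 - 2s)^(-1/2)` absorbs the exponential weight into the
Gaussian density. The function `Ψ` does not notice the scaling, and the Jacobian `t ^ dim U` is the
chi-square moment generating function. -/
lemma lintegral_exp_norm_sq_starProjection (U : Submodule ℝ E) {Ψ : E → ENNReal}
    (hΨ : Measurable Ψ) (hinv : ∀ t : ℝ, 0 < t → ∀ y, Ψ (scaleOn U t y) = Ψ y)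
    {s : ℝ} (hs : s < 1 / 2) :
    ∫⁻ y, Ψ y * ENNReal.ofReal (Real.exp (s * ‖U.starProjection y‖ ^ 2)) ∂stdGaussian E =
      ENNReal.ofReal ((1 - 2 * s) ^ (-(Module.finrank ℝ U : ℝ) / 2)) *
        ∫⁻ y, Ψ y ∂stdGaussian E := by
  have hs' : 0 < 1 - 2 * s := by linarith
  have hm := measurable_norm_starProjection U
  set t : ℝ := (1 - 2 * s) ^ (-(1 : ℝ) / 2) with ht
  have ht0 : 0 < t := by positivity
  have ht2 : t ^ 2 * (1 - 2 * s) = 1 := by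
    rw [ht, ← Real.rpow_natCast, ← Real.rpow_mul hs'.le]
    norm_num
    rw [Real.rpow_neg_one, inv_mul_cancel₀ hs'.ne']
  have htm : t ^ Module.finrank ℝ U = (1 - 2 * s) ^ (-(Module.finrank ℝ U : ℝ) / 2) := by
    rw [ht, ← Real.rpow_natCast, ← Real.rpow_mul hs'.le]
    congr 1
    ring
  have hmd : Measurable fun y : E => ENNReal.ofReal (stdDensity E y) := by
    have := continuous_stdDensity (E := E); fun_prop
  rw [lintegral_stdGaussian (by fun_prop), lintegral_stdGaussian hΨ,
    lintegral_comp_scaleOn U ht0 (by fun_prop), htm]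
  congr 1
  apply lintegral_congr
  intro y
  rw [hinv t ht0, mul_comm (Ψ y), ← mul_assoc, ← ENNReal.ofReal_mul (stdDensity_pos _).le]
  congr 2
  rw [stdDensity, stdDensity, mul_assoc, ← Real.exp_add, norm_sq_scaleOn, starProjection_scaleOn,
    norm_smul, mul_pow, Real.norm_eq_abs, sq_abs]
  congr 2
  linear_combination (-‖U.starProjection y‖ ^ 2 / 2) * ht2

lemma iteratedDeriv_one_sub_two_mul_rpow (m : ℝ) (C : ℝ) :
    deriv (fun s : ℝ => (1 - 2 * s) ^ (-m / 2) * C) 0 = m * C ∧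
    iteratedDeriv 2 (fun s : ℝ => (1 - 2 * s) ^ (-m / 2) * C) 0 = m * (m + 2) * C := by
  have key : ∀ (c D : ℝ) (s : ℝ), s < 1 / 2 →
      HasDerivAt (fun s : ℝ => (1 - 2 * s) ^ c * D) ((1 - 2 * s) ^ (c - 1) * (-2 * c * D)) s := by
    intro c D s hs
    have h1 : HasDerivAt (fun s : ℝ => 1 - 2 * s) (-2) s := by
      have := ((hasDerivAt_id s).const_mul 2).const_sub 1
      simpa using this
    have := (h1.rpow_const (p := c) (Or.inl (by linarith))).mul_const D
    exact this.congr_deriv (by ring)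
  constructor
  · rw [(key _ _ 0 (by norm_num)).deriv]; simp; ring
  · rw [iteratedDeriv_succ, iteratedDeriv_one]
    have : deriv (fun s : ℝ => (1 - 2 * s) ^ (-m / 2) * C) =ᶠ[nhds 0]
        fun s => (1 - 2 * s) ^ (-m / 2 - 1) * (-2 * (-m / 2) * C) := by
      filter_upwards [Iio_mem_nhds (show (0 : ℝ) < 1 / 2 by norm_num)] with s hs
      exact (key _ _ s hs).deriv
    rw [this.deriv_eq, (key _ _ 0 (by norm_num)).deriv]
    simp
    ring

/-- Under the Gaussian law reweighted by `Ψ`, the squared length of the `U`-component has, up to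
total mass, the moment generating function of a chi-square variable with `dim U` degrees of freedom
near `0`. Its first two derivatives there give the moments. -/
lemma lintegral_norm_pow_starProjection (U : Submodule ℝ E) {Ψ : E → ENNReal}
    (hΨ : Measurable Ψ) (hfin : ∫⁻ y, Ψ y ∂stdGaussian E ≠ ⊤)
    (hinv : ∀ t : ℝ, 0 < t → ∀ y, Ψ (scaleOn U t y) = Ψ y) :
    ∫⁻ y, Ψ y * ENNReal.ofReal (‖U.starProjection y‖ ^ 2) ∂stdGaussian E =
      ENNReal.ofReal (Module.finrank ℝ U) * ∫⁻ y, Ψ y ∂stdGaussian E ∧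
    ∫⁻ y, Ψ y * ENNReal.ofReal (‖U.starProjection y‖ ^ 4) ∂stdGaussian E =
      ENNReal.ofReal (Module.finrank ℝ U * (Module.finrank ℝ U + 2)) *
        ∫⁻ y, Ψ y ∂stdGaussian E := by
  have hm := measurable_norm_starProjection U
  set ρ := (stdGaussian E).withDensity Ψ with hρ
  have : IsFiniteMeasure ρ := isFiniteMeasure_withDensity hfin
  have hρint : ∀ F : E → ENNReal, Measurable F →
      ∫⁻ y, F y ∂ρ = ∫⁻ y, Ψ y * F y ∂stdGaussian E := fun F hF => by
    rw [hρ, lintegral_withDensity_eq_lintegral_mul _ hΨ hF]; rfl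
  set X : E → ℝ := fun y => ‖U.starProjection y‖ ^ 2 with hX
  have hXm : Measurable X := hm.pow_const 2
  have hmass : ∫⁻ y, Ψ y ∂stdGaussian E = ENNReal.ofReal (ρ.real Set.univ) := by
    rw [Measure.real, ENNReal.ofReal_toReal (measure_ne_top _ _), hρ, withDensity_apply _ .univ]
    simp
  have hexp : ∀ s < (1 / 2 : ℝ), ∫⁻ y, ENNReal.ofReal (Real.exp (s * X y)) ∂ρ =
      ENNReal.ofReal ((1 - 2 * s) ^ (-(Module.finrank ℝ U : ℝ) / 2) * ρ.real Set.univ) := by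
    intro s hs
    have hs' : 0 < 1 - 2 * s := by linarith
    rw [hρint _ (by fun_prop), lintegral_exp_norm_sq_starProjection U hΨ hinv hs, hmass,
      ENNReal.ofReal_mul (by positivity)]
  have hset : Set.Iio (1 / 2 : ℝ) ⊆ integrableExpSet X ρ := by
    intro s hs
    refine ⟨by fun_prop, ?_⟩
    rw [hasFiniteIntegral_iff_ofReal (ae_of_all _ fun y => (Real.exp_pos _).le), hexp s hs]
    exact ENNReal.ofReal_lt_top
  have h0 : (0 : ℝ) ∈ interior (integrableExpSet X ρ) :=
    mem_interior.2 ⟨_, hset, isOpen_Iio, by norm_num⟩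
  have hmgf : mgf X ρ =ᶠ[nhds 0]
      fun s => (1 - 2 * s) ^ (-(Module.finrank ℝ U : ℝ) / 2) * ρ.real Set.univ := by
    filter_upwards [Iio_mem_nhds (show (0 : ℝ) < 1 / 2 by norm_num)] with s hs
    have hs' : 0 < 1 - 2 * s := by linarith [Set.mem_Iio.1 hs]
    rw [mgf, integral_eq_lintegral_of_nonneg_ae (ae_of_all _ fun y => (Real.exp_pos _).le)
      (by fun_prop), hexp s hs, ENNReal.toReal_ofReal (by positivity)]
  have hmom : ∀ k : ℕ, ∀ c : ℝ, 0 ≤ c → iteratedDeriv k (mgf X ρ) 0 = c * ρ.real Set.univ →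
      ∫⁻ y, Ψ y * ENNReal.ofReal (X y ^ k) ∂stdGaussian E =
      ENNReal.ofReal c * ∫⁻ y, Ψ y ∂stdGaussian E := by
    intro k c hc h
    rw [iteratedDeriv_mgf_zero h0] at h
    rw [hmass, ← ENNReal.ofReal_mul hc, ← h, ← hρint _ (by fun_prop)]
    rw [ofReal_integral_eq_lintegral_ofReal]
    · rfl
    · exact integrable_pow_of_mem_interior_integrableExpSet h0 k
    · exact ae_of_all _ fun y => by simp only [Pi.pow_apply, hX]; positivity
  constructor
  · have := hmom 1 (Module.finrank ℝ U) (by positivity) (by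
      rw [hmgf.iteratedDeriv_eq, iteratedDeriv_one]
      exact (iteratedDeriv_one_sub_two_mul_rpow _ _).1)
    simpa [hX] using this
  · have := hmom 2 (Module.finrank ℝ U * (Module.finrank ℝ U + 2)) (by positivity) (by
      rw [hmgf.iteratedDeriv_eq]
      exact (iteratedDeriv_one_sub_two_mul_rpow _ _).2)
    simpa [hX, ← pow_mul] using this

/-- On the line spanned by `w`, scaling is a particular shift along `w`, so the chi-square moments
apply with one degree of freedom. -/
lemma lintegral_inner_pow_of_shift_invariant (w : E) {Ψ : E → ENNReal}
    (hΨ : Measurable Ψ) (hfin : ∫⁻ y, Ψ y ∂stdGaussian E ≠ ⊤)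
    (hinv : ∀ (c : ℝ) (y : E), Ψ (y + c • w) = Ψ y) :
    ∫⁻ y, Ψ y * ENNReal.ofReal (inner ℝ w y ^ 2) ∂stdGaussian E =
      ENNReal.ofReal (‖w‖ ^ 2) * ∫⁻ y, Ψ y ∂stdGaussian E ∧
    ∫⁻ y, Ψ y * ENNReal.ofReal (inner ℝ w y ^ 4) ∂stdGaussian E =
      ENNReal.ofReal (3 * ‖w‖ ^ 4) * ∫⁻ y, Ψ y ∂stdGaussian E := by
  by_cases hw : w = 0
  · simp [hw]
  have hw' : ‖w‖ ≠ 0 := norm_ne_zero_iff.2 hw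
  have h := lintegral_norm_pow_starProjection (ℝ ∙ w) hΨ hfin (by
    intro t _ y
    rw [scaleOn_apply, Submodule.starProjection_singleton, smul_smul]
    exact hinv _ _)
  rw [finrank_span_singleton hw] at h
  have hn : ∀ y, inner ℝ w y ^ 2 = ‖w‖ ^ 2 * ‖(ℝ ∙ w).starProjection y‖ ^ 2 := by
    intro y
    rw [Submodule.starProjection_singleton, norm_smul, mul_pow, Real.norm_eq_abs, sq_abs]
    simp only [RCLike.ofReal_real_eq_id, id]
    field_simp
  have hn4 : ∀ y, inner ℝ w y ^ 4 = ‖w‖ ^ 4 * ‖(ℝ ∙ w).starProjection y‖ ^ 4 := by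
    intro y
    linear_combination (inner ℝ w y ^ 2 + ‖w‖ ^ 2 * ‖(ℝ ∙ w).starProjection y‖ ^ 2) * hn y
  have hm := measurable_norm_starProjection (ℝ ∙ w)
  constructor
  · simp_rw [hn, ENNReal.ofReal_mul (sq_nonneg ‖w‖), mul_left_comm (Ψ _)]
    rw [lintegral_const_mul _ (by fun_prop), h.1]
    simp
  · simp_rw [hn4, ENNReal.ofReal_mul (show 0 ≤ ‖w‖ ^ 4 by positivity), mul_left_comm (Ψ _)]
    rw [lintegral_const_mul _ (by fun_prop), h.2, ← mul_assoc, ← ENNReal.ofReal_mul (by positivity)]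
    norm_num
    ring_nf

/-- The squared `e`-coordinate of the direction of the component of `y` orthogonal to `V`. -/
noncomputable def dirSq (V : Submodule ℝ E) (e y : E) : ℝ :=
  inner ℝ (Vᗮ.starProjection y) e ^ 2 / ‖Vᗮ.starProjection y‖ ^ 2

omit [MeasurableSpace E] [BorelSpace E] in
lemma dirSq_nonneg (V : Submodule ℝ E) (e y : E) : 0 ≤ dirSq V e y := by
  unfold dirSq; positivity

omit [MeasurableSpace E] [BorelSpace E] in
lemma dirSq_le (V : Submodule ℝ E) (e y : E) : dirSq V e y ≤ ‖e‖ ^ 2 := by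
  unfold dirSq
  refine div_le_of_le_mul₀ (by positivity) (by positivity) ?_
  rw [← mul_pow, mul_comm, ← sq_abs]
  gcongr
  exact abs_real_inner_le_norm _ _

omit [MeasurableSpace E] [BorelSpace E] in
lemma inner_sq_eq_dirSq_mul (V : Submodule ℝ E) (e y : E) :
    inner ℝ (Vᗮ.starProjection y) e ^ 2 = dirSq V e y * ‖Vᗮ.starProjection y‖ ^ 2 := by
  unfold dirSq
  by_cases h : Vᗮ.starProjection y = 0
  · simp [h]
  · have : ‖Vᗮ.starProjection y‖ ≠ 0 := norm_ne_zero_iff.2 h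
    field_simp

lemma measurable_dirSq (V : Submodule ℝ E) (e : E) : Measurable (dirSq V e) := by
  unfold dirSq
  have h := Vᗮ.starProjection.continuous.measurable
  have h2 : Measurable fun y => inner ℝ (Vᗮ.starProjection y) e :=
    (Vᗮ.starProjection.continuous.inner continuous_const).measurable
  exact (h2.pow_const 2).div (h.norm.pow_const 2)

omit [MeasurableSpace E] [BorelSpace E] in
lemma dirSq_smul_add (V : Submodule ℝ E) (e y : E) {t : ℝ} (ht : 0 < t) {v : E} (hv : v ∈ V) :
    dirSq V e (t • y + v) = dirSq V e y := by
  have h0 : Vᗮ.starProjection v = 0 :=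
    (Submodule.starProjection_apply_eq_zero_iff Vᗮ).2 (by rwa [Submodule.orthogonal_orthogonal])
  have : Vᗮ.starProjection (t • y + v) = t • Vᗮ.starProjection y := by
    rw [map_add, map_smul, h0, add_zero]
  rw [dirSq, dirSq, this, inner_smul_left, norm_smul, mul_pow, mul_pow]
  simp only [conj_trivial, Real.norm_eq_abs, sq_abs]
  rw [mul_div_mul_left _ _ (by positivity)]

/-- Split `⟪y, e⟫` into `⟪w, y⟫` with `w` the projection of `e` on `V`, and a residual part `q`.
Shift invariance keeps `⟪w, y⟫` normal with variance `‖w‖²`, even after weighting by `q²`. Scale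
invariance keeps the squared residual length chi-square, while `dirSq`, the other factor of `q²`, is
itself invariant. -/
lemma lintegral_mul_inner_pow (V : Submodule ℝ E) (e : E) {Φ : E → ENNReal}
    (hΦ : Measurable Φ) (hfin : ∫⁻ y, Φ y ∂stdGaussian E ≠ ⊤)
    (hinv : ∀ t : ℝ, 0 < t → ∀ v ∈ V, ∀ y, Φ (t • y + v) = Φ y) :
    ∫⁻ y, Φ y * ENNReal.ofReal (inner ℝ y e ^ 2) ∂stdGaussian E =
      ∫⁻ y, Φ y * ENNReal.ofReal (‖V.starProjection e‖ ^ 2 +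
        Module.finrank ℝ Vᗮ * dirSq V e y) ∂stdGaussian E ∧
    ∫⁻ y, Φ y * ENNReal.ofReal (inner ℝ y e ^ 4) ∂stdGaussian E =
      ∫⁻ y, Φ y * ENNReal.ofReal (3 * (‖V.starProjection e‖ ^ 2) ^ 2 +
        6 * ‖V.starProjection e‖ ^ 2 * (Module.finrank ℝ Vᗮ * dirSq V e y) +
        Module.finrank ℝ Vᗮ * (Module.finrank ℝ Vᗮ + 2) * dirSq V e y ^ 2) ∂stdGaussian E := by
  set w := V.starProjection e with hw
  set m : ℝ := ((Module.finrank ℝ Vᗮ : ℕ) : ℝ) with hm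
  have hm0 : 0 ≤ m := by positivity
  have hwV : w ∈ V := V.starProjection_apply_mem e
  set q : E → ℝ := fun y => inner ℝ (Vᗮ.starProjection y) e with hq
  have hqm : Measurable q := (Vᗮ.starProjection.continuous.inner continuous_const).measurable
  have hdm := measurable_dirSq V e
  have hnm := measurable_norm_starProjection Vᗮ
  have hshift : ∀ v ∈ V, ∀ y, Φ (y + v) = Φ y := fun v hv y => by
    simpa using hinv 1 one_pos v hv y
  have hY : ∀ y, inner ℝ y e = inner ℝ w y + q y := by
    intro y
    have h : inner ℝ w y = inner ℝ (V.starProjection y) e := by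
      rw [hw, V.inner_starProjection_left_eq_right, real_inner_comm]
    simp only [hq]
    rw [h, ← inner_add_left, V.starProjection_add_starProjection_orthogonal]
  have hqshift : ∀ v ∈ V, ∀ y, q (y + v) = q y := by
    intro v hv y
    have h0 : Vᗮ.starProjection v = 0 :=
      (Submodule.starProjection_apply_eq_zero_iff Vᗮ).2 (by rwa [Submodule.orthogonal_orthogonal])
    rw [hq]
    simp only
    rw [map_add, h0, add_zero]
  have hscale : ∀ t : ℝ, 0 < t → ∀ y, ∃ v ∈ V, scaleOn Vᗮ t y = t • y + v := by
    intro t _ y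
    refine ⟨(1 - t) • V.starProjection y, V.smul_mem _ (V.starProjection_apply_mem y), ?_⟩
    rw [scaleOn_apply]
    nth_rewrite 1 3 [← V.starProjection_add_starProjection_orthogonal y]
    module
  -- the moments of the two components
  have hr : ∀ k : ℕ, ∫⁻ y, Φ y * ENNReal.ofReal (dirSq V e y ^ k) ∂stdGaussian E ≠ ⊤ := by
    intro k
    refine ne_top_of_le_ne_top (ENNReal.mul_ne_top hfin
      (ENNReal.ofReal_ne_top (r := (‖e‖ ^ 2) ^ k))) ?_
    rw [← lintegral_mul_const _ hΦ]
    gcongr with y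
    · exact dirSq_nonneg _ _ _
    · exact dirSq_le _ _ _
  have hinvr : ∀ k : ℕ, ∀ t : ℝ, 0 < t → ∀ y,
      Φ (scaleOn Vᗮ t y) * ENNReal.ofReal (dirSq V e (scaleOn Vᗮ t y) ^ k) =
      Φ y * ENNReal.ofReal (dirSq V e y ^ k) := by
    intro k t ht y
    obtain ⟨v, hv, h⟩ := hscale t ht y
    rw [h, hinv t ht v hv, dirSq_smul_add V e y ht hv]
  have hq2 : ∫⁻ y, Φ y * ENNReal.ofReal (q y ^ 2) ∂stdGaussian E =
      ENNReal.ofReal m * ∫⁻ y, Φ y * ENNReal.ofReal (dirSq V e y) ∂stdGaussian E := by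
    have := (lintegral_norm_pow_starProjection Vᗮ (Ψ := fun y => Φ y *
      ENNReal.ofReal (dirSq V e y ^ 1)) (by fun_prop) (hr 1) (hinvr 1)).1
    simp only [pow_one] at this
    rw [← hm] at this
    rw [← this]
    refine lintegral_congr fun y => ?_
    rw [mul_assoc, ← ENNReal.ofReal_mul (dirSq_nonneg _ _ _), hq, ← inner_sq_eq_dirSq_mul]
  have hq4 : ∫⁻ y, Φ y * ENNReal.ofReal (q y ^ 4) ∂stdGaussian E =
      ENNReal.ofReal (m * (m + 2)) *
        ∫⁻ y, Φ y * ENNReal.ofReal (dirSq V e y ^ 2) ∂stdGaussian E := by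
    have := (lintegral_norm_pow_starProjection Vᗮ (Ψ := fun y => Φ y *
      ENNReal.ofReal (dirSq V e y ^ 2)) (by fun_prop) (hr 2) (hinvr 2)).2
    rw [← hm] at this
    rw [← this]
    refine lintegral_congr fun y => ?_
    rw [mul_assoc, ← ENNReal.ofReal_mul (by have := dirSq_nonneg V e y; positivity)]
    congr 2
    have := inner_sq_eq_dirSq_mul V e y
    calc q y ^ 4 = (q y ^ 2) ^ 2 := by ring
      _ = _ := by rw [hq]; simp only; rw [inner_sq_eq_dirSq_mul]; ring
  have hq2fin : ∫⁻ y, Φ y * ENNReal.ofReal (q y ^ 2) ∂stdGaussian E ≠ ⊤ := by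
    rw [hq2]; exact ENNReal.mul_ne_top ENNReal.ofReal_ne_top (by simpa using hr 1)
  have hw1 := lintegral_inner_pow_of_shift_invariant w hΦ hfin
    fun c y => hshift _ (V.smul_mem c hwV) y
  have hw2 := (lintegral_inner_pow_of_shift_invariant w
    (Ψ := fun y => Φ y * ENNReal.ofReal (q y ^ 2)) (by fun_prop) hq2fin
    fun c y => by rw [hshift _ (V.smul_mem c hwV) y, hqshift _ (V.smul_mem c hwV) y]).1
  -- symmetrization
  have hrefl : ∀ k : ℕ, ∫⁻ y, Φ y * ENNReal.ofReal ((inner ℝ w y + q y) ^ (2 * k)) ∂stdGaussian E =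
      ∫⁻ y, Φ y * ENNReal.ofReal ((q y - inner ℝ w y) ^ (2 * k)) ∂stdGaussian E := by
    intro k
    conv_lhs => rw [← stdGaussian_map Vᗮ.reflection]
    rw [lintegral_map (by fun_prop) (LinearIsometryEquiv.continuous _).measurable]
    refine lintegral_congr fun y => ?_
    have h1 : Vᗮ.reflection y = y + (-2 : ℝ) • V.starProjection y := by
      rw [Submodule.reflection_apply, two_smul]
      nth_rewrite 3 4 [← V.starProjection_add_starProjection_orthogonal y]
      module
    have hV : (-2 : ℝ) • V.starProjection y ∈ V := V.smul_mem _ (V.starProjection_apply_mem y)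
    have h2 : inner ℝ w (y + (-2 : ℝ) • V.starProjection y) = - inner ℝ w y := by
      rw [inner_add_right, inner_smul_right, ← V.inner_starProjection_left_eq_right,
        V.starProjection_eq_self_iff.2 hwV]
      ring
    rw [h1, hshift _ hV, hqshift _ hV, h2]
    congr 3
    ring
  have hc : ∀ c : ℝ, 0 ≤ c → ∀ F : E → ℝ, (∀ y, 0 ≤ F y) → Measurable F →
      ENNReal.ofReal c * ∫⁻ y, Φ y * ENNReal.ofReal (F y) ∂stdGaussian E =
      ∫⁻ y, Φ y * ENNReal.ofReal (c * F y) ∂stdGaussian E := by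
    intro c hc F _ hFm
    rw [← lintegral_const_mul _ (by fun_prop)]
    refine lintegral_congr fun y => ?_
    rw [ENNReal.ofReal_mul hc]; ring
  have hsum : ∀ F G : E → ℝ, (∀ y, 0 ≤ F y) → (∀ y, 0 ≤ G y) → Measurable F → Measurable G →
      ∫⁻ y, Φ y * ENNReal.ofReal (F y) ∂stdGaussian E +
        ∫⁻ y, Φ y * ENNReal.ofReal (G y) ∂stdGaussian E =
      ∫⁻ y, Φ y * ENNReal.ofReal (F y + G y) ∂stdGaussian E := by
    intro F G hF hG hFm hGm
    rw [← lintegral_add_left (by fun_prop)]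
    refine lintegral_congr fun y => ?_
    rw [ENNReal.ofReal_add (hF y) (hG y)]; ring
  -- Odd cross terms are signed and cannot be integrated in `ENNReal`. Adding the integral to its
  -- reflected copy cancels them pointwise and doubles the even terms, so both identities are proved
  -- after multiplication by `2`.
  have two : ∀ {A B : ENNReal}, ENNReal.ofReal 2 * A = ENNReal.ofReal 2 * B → A = B := by
    intro A B h
    exact (ENNReal.mul_right_inj (by simp) (by simp)).1 h
  have hwm : Measurable fun y : E => inner ℝ w y := by fun_prop
  have hd0 := dirSq_nonneg V e
  have hone : ∫⁻ y, Φ y ∂stdGaussian E =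
      ∫⁻ y, Φ y * ENNReal.ofReal ((fun _ => 1) y) ∂stdGaussian E := by simp
  simp_rw [hY]
  constructor
  · apply two
    have h := hrefl 1
    simp only [mul_one] at h
    calc _ = ∫⁻ y, Φ y * ENNReal.ofReal ((inner ℝ w y + q y) ^ 2) ∂stdGaussian E +
          ∫⁻ y, Φ y * ENNReal.ofReal ((q y - inner ℝ w y) ^ 2) ∂stdGaussian E := by
            rw [← h, ENNReal.ofReal_ofNat, two_mul]
      _ = ENNReal.ofReal 2 * (∫⁻ y, Φ y * ENNReal.ofReal (inner ℝ w y ^ 2) ∂stdGaussian E +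
          ∫⁻ y, Φ y * ENNReal.ofReal (q y ^ 2) ∂stdGaussian E) := by
            rw [hsum _ _ (fun y => by positivity) (fun y => by positivity) (by fun_prop)
              (by fun_prop), hsum _ _ (fun y => by positivity) (fun y => by positivity)
              (by fun_prop) (by fun_prop), hc 2 (by norm_num) _ (fun y => by positivity)
              (by fun_prop)]
            refine lintegral_congr fun y => ?_
            congr 2
            ring
      _ = _ := by
            rw [hw1.1, hq2, hone, hc _ (by positivity) _ (fun y => by positivity) (by fun_prop),
              hc _ hm0 _ hd0 hdm, hsum _ _ (fun y => by positivity)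
              (fun y => mul_nonneg hm0 (hd0 y)) (by fun_prop) (by fun_prop)]
            simp only [mul_one]
  · apply two
    have h := hrefl 2
    norm_num at h
    calc _ = ∫⁻ y, Φ y * ENNReal.ofReal ((inner ℝ w y + q y) ^ 4) ∂stdGaussian E +
          ∫⁻ y, Φ y * ENNReal.ofReal ((q y - inner ℝ w y) ^ 4) ∂stdGaussian E := by
            rw [← h, ENNReal.ofReal_ofNat, two_mul]
      _ = ENNReal.ofReal 2 * (∫⁻ y, Φ y * ENNReal.ofReal (inner ℝ w y ^ 4) ∂stdGaussian E +
          ENNReal.ofReal 6 * ∫⁻ y, Φ y * ENNReal.ofReal (q y ^ 2) *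
            ENNReal.ofReal (inner ℝ w y ^ 2) ∂stdGaussian E +
          ∫⁻ y, Φ y * ENNReal.ofReal (q y ^ 4) ∂stdGaussian E) := by
            simp_rw [mul_assoc (Φ _), ← ENNReal.ofReal_mul (sq_nonneg (q _))]
            rw [hsum _ _ (fun y => by positivity) (fun y => by positivity) (by fun_prop)
              (by fun_prop), hc 6 (by norm_num) _ (fun y => by positivity)
              (by fun_prop), hsum _ _ (fun y => by positivity) (fun y => by positivity)
              (by fun_prop) (by fun_prop), hsum _ _ (fun y => by positivity)
              (fun y => by positivity) (by fun_prop) (by fun_prop), 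
              hc 2 (by norm_num) _ (fun y => by positivity) (by fun_prop)]
            refine lintegral_congr fun y => ?_
            congr 2
            ring
      _ = _ := by
            rw [hw1.2, hw2, hq2, hq4, hone, hc _ (by positivity) _ (fun y => by positivity)
              (by fun_prop), hc _ hm0 _ hd0 hdm,
              hc _ (by positivity) _ (fun y => mul_nonneg hm0 (hd0 y)) (by fun_prop),
              hc 6 (by positivity) _ (fun y => mul_nonneg (by positivity)
                (mul_nonneg hm0 (hd0 y))) (by fun_prop),
              hc (m * (m + 2)) (by positivity) _ (fun y => by positivity) (by fun_prop),
              hsum _ _ (fun y => by positivity)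
              (fun y => mul_nonneg (by norm_num) (mul_nonneg (by positivity)
                (mul_nonneg hm0 (hd0 y)))) (by fun_prop) (by fun_prop),
              hsum _ _ (fun y => add_nonneg (by positivity)
              (mul_nonneg (by norm_num) (mul_nonneg (by positivity)
                (mul_nonneg hm0 (hd0 y))))) (fun y => by positivity) (by fun_prop) (by fun_prop)]
            congr 1
            refine lintegral_congr fun y => ?_
            congr 2
            ring

end Gaussian

/-! ### Lower triangular matrices and uniqueness of the Cholesky root -/

section Matrices

variable {p : ℕ}

lemma act_apply (B : Matrix (Fin p) (Fin p) ℝ) (x : Vec p) (j : Fin p) :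
    act B x j = ∑ k, B j k * x k := rfl

lemma act_mul (A B : Matrix (Fin p) (Fin p) ℝ) (x : Vec p) : act (A * B) x = act A (act B x) := by
  simp [act, Matrix.mulVec_mulVec]

lemma act_one (x : Vec p) : act 1 x = x := by simp [act]

lemma act_zero_left (x : Vec p) : act 0 x = 0 := by simp [act]

lemma act_add (B : Matrix (Fin p) (Fin p) ℝ) (x y : Vec p) : act B (x + y) = act B x + act B y := by
  simp [act, Matrix.mulVec_add]

lemma act_sub (B : Matrix (Fin p) (Fin p) ℝ) (x y : Vec p) : act B (x - y) = act B x - act B y := by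
  simp [act, Matrix.mulVec_sub]

lemma act_smul (B : Matrix (Fin p) (Fin p) ℝ) (c : ℝ) (x : Vec p) : act B (c • x) = c • act B x := by
  simp [act, Matrix.mulVec_smul]

lemma act_sum {ι : Type*} (s : Finset ι) (B : Matrix (Fin p) (Fin p) ℝ) (x : ι → Vec p) :
    act B (∑ i ∈ s, x i) = ∑ i ∈ s, act B (x i) := by
  classical
  induction s using Finset.induction_on with
  | empty => simp [act]
  | insert a s ha ih => rw [Finset.sum_insert ha, Finset.sum_insert ha, act_add, ih]

lemma act_inv_act {B : Matrix (Fin p) (Fin p) ℝ} (hB : B ∈ glSet p) (x : Vec p) :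
    act B⁻¹ (act B x) = x := by
  rw [← act_mul, Matrix.nonsing_inv_mul _ (isUnit_iff_ne_zero.2 hB), act_one]

lemma act_act_inv {B : Matrix (Fin p) (Fin p) ℝ} (hB : B ∈ glSet p) (x : Vec p) :
    act B (act B⁻¹ x) = x := by
  rw [← act_mul, Matrix.mul_nonsing_inv _ (isUnit_iff_ne_zero.2 hB), act_one]

lemma lowerTriangular_of_mem_ltSet {L : Matrix (Fin p) (Fin p) ℝ} (hL : L ∈ ltSet p) :
    L.BlockTriangular OrderDual.toDual := fun i j h => hL.1 i j h

lemma det_pos_of_mem_ltSet {L : Matrix (Fin p) (Fin p) ℝ} (hL : L ∈ ltSet p) : 0 < L.det := by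
  rw [Matrix.det_of_isLowerTriangular L (lowerTriangular_of_mem_ltSet hL)]
  exact Finset.prod_pos fun i _ => hL.2 i

lemma ltSet_subset_glSet : ltSet p ⊆ glSet p := fun _ hL => (det_pos_of_mem_ltSet hL).ne'

lemma lowerTriangular_mul_diag {A B : Matrix (Fin p) (Fin p) ℝ}
    (hA : ∀ i j, i < j → A i j = 0) (hB : ∀ i j, i < j → B i j = 0) (i : Fin p) :
    (A * B) i i = A i i * B i i := by
  rw [Matrix.mul_apply]
  apply Finset.sum_eq_single i
  · intro k _ hk
    rcases lt_or_gt_of_ne hk with h | h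
    · rw [hB k i h, mul_zero]
    · rw [hA i k h, zero_mul]
  · simp

lemma mul_mem_ltSet {A B : Matrix (Fin p) (Fin p) ℝ} (hA : A ∈ ltSet p) (hB : B ∈ ltSet p) :
    A * B ∈ ltSet p := by
  refine ⟨fun i j h => ?_, fun i => ?_⟩
  · exact ((lowerTriangular_of_mem_ltSet hA).mul (lowerTriangular_of_mem_ltSet hB)) h
  · rw [lowerTriangular_mul_diag hA.1 hB.1]
    exact mul_pos (hA.2 i) (hB.2 i)

lemma inv_mem_ltSet {A : Matrix (Fin p) (Fin p) ℝ} (hA : A ∈ ltSet p) : A⁻¹ ∈ ltSet p := by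
  have hu := isUnit_iff_ne_zero.2 (det_pos_of_mem_ltSet hA).ne'
  have : Invertible A := Matrix.invertibleOfIsUnitDet _ hu
  have hlow : A⁻¹.BlockTriangular OrderDual.toDual :=
    Matrix.blockTriangular_inv_of_blockTriangular (lowerTriangular_of_mem_ltSet hA)
  refine ⟨fun i j h => hlow h, fun i => ?_⟩
  have h : (A * A⁻¹) i i = 1 := by rw [Matrix.mul_nonsing_inv _ hu, Matrix.one_apply_eq]
  rw [lowerTriangular_mul_diag hA.1 (fun i j h => hlow h)] at h
  by_contra hc
  push Not at hc
  nlinarith [hA.2 i]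

/-- The matrix `B⁻¹ A` is lower triangular and orthogonal, so its inverse is both lower and upper
triangular; it is then diagonal, with positive entries of square `1`. -/
lemma eq_of_mul_transpose_eq {A B : Matrix (Fin p) (Fin p) ℝ} (hA : A ∈ ltSet p) (hB : B ∈ ltSet p)
    (h : A * A.transpose = B * B.transpose) : A = B := by
  have hAu := isUnit_iff_ne_zero.2 (det_pos_of_mem_ltSet hA).ne'
  have hBu := isUnit_iff_ne_zero.2 (det_pos_of_mem_ltSet hB).ne'
  set D := B⁻¹ * A with hD
  have hDlt : D ∈ ltSet p := mul_mem_ltSet (inv_mem_ltSet hB) hA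
  have hDD : D * D.transpose = 1 := by
    rw [hD, Matrix.transpose_mul, Matrix.transpose_nonsing_inv]
    calc B⁻¹ * A * (A.transpose * B.transpose⁻¹) = B⁻¹ * (A * A.transpose) * B.transpose⁻¹ := by
          simp only [Matrix.mul_assoc]
      _ = (B⁻¹ * B) * (B.transpose * B.transpose⁻¹) := by rw [h]; simp only [Matrix.mul_assoc]
      _ = 1 := by
          rw [Matrix.nonsing_inv_mul _ hBu, Matrix.mul_nonsing_inv _ (by rwa [Matrix.det_transpose]),
            Matrix.mul_one]
  have hinv : D⁻¹ = D.transpose := Matrix.inv_eq_right_inv hDD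
  have hup : ∀ i j, i < j → D j i = 0 := by
    intro i j hij
    have := (inv_mem_ltSet hDlt).1 i j hij
    rwa [hinv] at this
  have hone : D = 1 := by
    ext i j
    rcases lt_trichotomy i j with hij | rfl | hij
    · rw [hDlt.1 i j hij, Matrix.one_apply_ne hij.ne]
    · have h1 : (D * D.transpose) i i = 1 := by rw [hDD, Matrix.one_apply_eq]
      rw [lowerTriangular_mul_diag (B := D.transpose) hDlt.1 (fun a b hab => hup a b hab)] at h1
      rw [Matrix.one_apply_eq]
      have := hDlt.2 i
      rw [Matrix.transpose_apply] at h1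
      nlinarith
    · rw [hup j i hij, Matrix.one_apply_ne hij.ne']
  calc A = B * (B⁻¹ * A) := by
        rw [← Matrix.mul_assoc, Matrix.mul_nonsing_inv _ hBu, Matrix.one_mul]
    _ = B := by rw [← hD, hone, Matrix.mul_one]

lemma choleskyRoot_eq {L S : Matrix (Fin p) (Fin p) ℝ} (hL : L ∈ ltSet p)
    (h : L * L.transpose = S) : choleskyRoot S = L := by
  have hex : ∃ L ∈ ltSet p, L * L.transpose = S := ⟨L, hL, h⟩
  rw [choleskyRoot, dif_pos hex]
  exact eq_of_mul_transpose_eq hex.choose_spec.1 hL (hex.choose_spec.2.trans h.symm)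

lemma choleskyRoot_eq_zero {S : Matrix (Fin p) (Fin p) ℝ}
    (h : ¬ ∃ L ∈ ltSet p, L * L.transpose = S) : choleskyRoot S = 0 := by
  rw [choleskyRoot, dif_neg h]

/-- Conjugation by `A` preserves existence of a root in both directions, so the default value `0`
occurs on both sides together. Invariance of the statistics therefore holds at every sample, not
just almost everywhere. -/
lemma choleskyRoot_conj {A : Matrix (Fin p) (Fin p) ℝ} (hA : A ∈ ltSet p)
    (S : Matrix (Fin p) (Fin p) ℝ) :
    choleskyRoot (A * S * A.transpose) = A * choleskyRoot S := by
  have hAu := isUnit_iff_ne_zero.2 (det_pos_of_mem_ltSet hA).ne'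
  by_cases h : ∃ L ∈ ltSet p, L * L.transpose = S
  · obtain ⟨L, hL, rfl⟩ := h
    rw [choleskyRoot_eq hL rfl]
    apply choleskyRoot_eq (mul_mem_ltSet hA hL)
    simp only [Matrix.transpose_mul, Matrix.mul_assoc]
  · rw [choleskyRoot_eq_zero h, Matrix.mul_zero]
    apply choleskyRoot_eq_zero
    rintro ⟨M, hM, hM2⟩
    refine h ⟨A⁻¹ * M, mul_mem_ltSet (inv_mem_ltSet hA) hM, ?_⟩
    rw [Matrix.transpose_mul, Matrix.transpose_nonsing_inv]
    calc A⁻¹ * M * (M.transpose * A.transpose⁻¹) = A⁻¹ * (M * M.transpose) * A.transpose⁻¹ := by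
          simp only [Matrix.mul_assoc]
      _ = (A⁻¹ * A) * S * (A.transpose * A.transpose⁻¹) := by
          rw [hM2]; simp only [Matrix.mul_assoc]
      _ = S := by
          rw [Matrix.nonsing_inv_mul _ hAu, Matrix.mul_nonsing_inv _ (by rwa [Matrix.det_transpose]),
            Matrix.mul_one, Matrix.one_mul]

end Matrices

/-! ### Cholesky factors from Gram–Schmidt -/

section GramSchmidt

variable {p : ℕ} {E : Type*} [NormedAddCommGroup E] [InnerProductSpace ℝ E]

open InnerProductSpace

lemma inner_gramSchmidtNormed_eq (f : Fin p → E) (j : Fin p) :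
    inner ℝ (gramSchmidtNormed ℝ f j) (f j) = ‖gramSchmidt ℝ f j‖ := by
  have h : inner ℝ (gramSchmidt ℝ f j) (f j) = ‖gramSchmidt ℝ f j‖ ^ 2 := by
    conv_lhs => rw [gramSchmidt_def'' ℝ f j]
    rw [inner_add_right, inner_sum, Finset.sum_eq_zero, add_zero, real_inner_self_eq_norm_sq]
    intro i hi
    rw [inner_smul_right, gramSchmidt_orthogonal ℝ f (Finset.mem_Iio.1 hi).ne', mul_zero]
  rw [gramSchmidtNormed, inner_smul_left, h]
  simp only [RCLike.ofReal_real_eq_id, id, map_inv₀, conj_trivial]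
  by_cases h0 : ‖gramSchmidt ℝ f j‖ = 0
  · simp [h0]
  · field_simp

lemma inner_gramSchmidtNormed_eq_zero (f : Fin p → E) {j k : Fin p} (h : j < k) :
    inner ℝ (gramSchmidtNormed ℝ f k) (f j) = 0 := by
  rw [gramSchmidtNormed, inner_smul_left, gramSchmidt_inv_triangular ℝ f h, mul_zero]

/-- The Cholesky factor of the Gram matrix. -/
noncomputable def gramFactor (f : Fin p → E) : Matrix (Fin p) (Fin p) ℝ :=
  Matrix.of fun j k => inner ℝ (gramSchmidtNormed ℝ f k) (f j)

lemma gramFactor_mem_ltSet {f : Fin p → E} (hf : LinearIndependent ℝ f) :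
    gramFactor f ∈ ltSet p := by
  refine ⟨fun j k h => inner_gramSchmidtNormed_eq_zero f h, fun j => ?_⟩
  rw [gramFactor, Matrix.of_apply, inner_gramSchmidtNormed_eq]
  exact norm_pos_iff.2 (gramSchmidt_ne_zero j hf)

lemma sum_gramFactor_smul {f : Fin p → E} (hf : LinearIndependent ℝ f) (j : Fin p) :
    ∑ k, gramFactor f j k • gramSchmidtNormed ℝ f k = f j := by
  have hmem : f j ∈ Submodule.span ℝ (Set.range (gramSchmidtNormed ℝ f)) := by
    rw [span_gramSchmidtNormed_range, span_gramSchmidt]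
    exact Submodule.subset_span ⟨j, rfl⟩
  have ho := gramSchmidtNormed_orthonormal hf
  obtain ⟨c, hc⟩ := (Submodule.mem_span_range_iff_exists_fun ℝ).1 hmem
  rw [← hc]
  refine Finset.sum_congr rfl fun k _ => ?_
  rw [gramFactor, Matrix.of_apply, ← hc, ho.inner_right_fintype]

lemma gramFactor_mul_transpose {f : Fin p → E} (hf : LinearIndependent ℝ f) :
    gramFactor f * (gramFactor f).transpose = Matrix.of fun j k => inner ℝ (f j) (f k) := by
  ext j l
  rw [Matrix.mul_apply, Matrix.of_apply]
  conv_rhs => rw [← sum_gramFactor_smul hf j, ← sum_gramFactor_smul hf l]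
  rw [(gramSchmidtNormed_orthonormal hf).inner_sum]
  simp

/-- Gram–Schmidt on the rows of `B`. Equivalently `B = LO` with `O` orthogonal, which is how a
general `B` in the model is later reduced to a rotation. -/
lemma exists_ltSet_mul_transpose_eq {B : Matrix (Fin p) (Fin p) ℝ} (hB : B ∈ glSet p) :
    ∃ L ∈ ltSet p, L * L.transpose = B * B.transpose := by
  let f : Fin p → EuclideanSpace ℝ (Fin p) := fun j => WithLp.toLp 2 (B j)
  have hf : LinearIndependent ℝ f := by
    have := Matrix.linearIndependent_rows_of_det_ne_zero hB
    exact this.map' (WithLp.linearEquiv 2 ℝ (Fin p → ℝ)).symm.toLinearMap (LinearEquiv.ker _)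
  refine ⟨gramFactor f, gramFactor_mem_ltSet hf, ?_⟩
  rw [gramFactor_mul_transpose hf]
  ext j k
  rw [Matrix.of_apply, Matrix.mul_apply, PiLp.inner_apply]
  exact Finset.sum_congr rfl fun i _ => by simp [f, mul_comm]

lemma measurable_gramSchmidt [MeasurableSpace E] [BorelSpace E] [SecondCountableTopology E]
    (j : Fin p) :
    Measurable fun f : Fin p → E => gramSchmidt ℝ f j := by
  induction j using WellFoundedLT.induction with
  | ind j ih =>
    have : (fun f : Fin p → E => gramSchmidt ℝ f j) = fun f => f j - ∑ i ∈ Finset.Iio j,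
        (inner ℝ (gramSchmidt ℝ f i) (f j) / ‖gramSchmidt ℝ f i‖ ^ 2) • gramSchmidt ℝ f i := by
      ext1 f
      have := gramSchmidt_def'' ℝ f j
      exact eq_sub_of_add_eq this.symm
    rw [this]
    refine (measurable_pi_apply j).sub (Finset.measurable_sum _ fun i hi => ?_)
    have := ih i (Finset.mem_Iio.1 hi)
    exact ((this.inner (measurable_pi_apply j)).div (this.norm.pow_const 2)).smul this

end GramSchmidt

/-! ### Affine equivariance and the standardized sample in coordinates -/

section Samples

variable {n p : ℕ}

open InnerProductSpace

lemma sampleMean_affine (hn : 0 < n) (a : Vec p) (B : Matrix (Fin p) (Fin p) ℝ) (X : Sample n p) :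
    sampleMean (fun i => a + act B (X i)) = a + act B (sampleMean X) := by
  have : (n : ℝ) ≠ 0 := by positivity
  rw [sampleMean, sampleMean, Finset.sum_add_distrib, smul_add, act_smul, act_sum]
  simp [← Nat.cast_smul_eq_nsmul ℝ, smul_smul, this]

lemma vecMulVec_act (B : Matrix (Fin p) (Fin p) ℝ) (x : Vec p) :
    Matrix.vecMulVec (act B x).ofLp (act B x).ofLp =
      B * Matrix.vecMulVec x.ofLp x.ofLp * B.transpose := by
  rw [Matrix.mul_vecMulVec, Matrix.vecMulVec_mul, Matrix.vecMul_transpose]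
  rfl

lemma sampleCov_affine (hn : 0 < n) (a : Vec p) (B : Matrix (Fin p) (Fin p) ℝ) (X : Sample n p) :
    sampleCov (fun i => a + act B (X i)) = B * sampleCov X * B.transpose := by
  rw [sampleCov, sampleCov, Matrix.mul_smul, Matrix.smul_mul, Matrix.mul_sum, Matrix.sum_mul,
    sampleMean_affine hn]
  congr 1
  refine Finset.sum_congr rfl fun i _ => ?_
  rw [add_sub_add_left_eq_sub, ← act_sub, vecMulVec_act]

lemma standardized_affine (hn : 0 < n) (a : Vec p) {L : Matrix (Fin p) (Fin p) ℝ} (hL : L ∈ ltSet p)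
    (X : Sample n p) (i : Fin n) :
    standardized (fun i => a + act L (X i)) i = standardized X i := by
  rw [standardized, standardized, sampleCov_affine hn, sampleMean_affine hn,
    add_sub_add_left_eq_sub, ← act_sub, choleskyRoot_conj hL, Matrix.mul_inv_rev, act_mul,
    act_inv_act (ltSet_subset_glSet hL)]

lemma norm_sq_act (B : Matrix (Fin p) (Fin p) ℝ) (x : Vec p) :
    ‖act B x‖ ^ 2 = x.ofLp ⬝ᵥ (B.transpose * B).mulVec x.ofLp := by
  rw [EuclideanSpace.real_norm_sq_eq, ← Matrix.mulVec_mulVec, Matrix.dotProduct_mulVec,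
    Matrix.vecMul_transpose, dotProduct]
  exact Finset.sum_congr rfl fun i _ => by rw [sq]; rfl

/-- The squared norm of `A⁻¹ x` is the quadratic form of `(A A')⁻¹`, so the choice of square root of
a covariance matrix is irrelevant for norms. -/
lemma norm_sq_act_inv_of_mul_transpose {A B : Matrix (Fin p) (Fin p) ℝ} (h : A * A.transpose = B * B.transpose) (x : Vec p) :
    ‖act A⁻¹ x‖ = ‖act B⁻¹ x‖ := by
  have : ‖act A⁻¹ x‖ ^ 2 = ‖act B⁻¹ x‖ ^ 2 := by
    rw [norm_sq_act, norm_sq_act, Matrix.transpose_nonsing_inv, Matrix.transpose_nonsing_inv,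
      ← Matrix.mul_inv_rev, ← Matrix.mul_inv_rev, h]
  exact (pow_left_inj₀ (norm_nonneg _) (norm_nonneg _) two_ne_zero).1 this

lemma norm_standardized_affine (hn : 0 < n) (a : Vec p) {B : Matrix (Fin p) (Fin p) ℝ}
    (hB : B ∈ glSet p) (X : Sample n p) (i : Fin n) :
    ‖standardized (fun i => a + act B (X i)) i‖ = ‖standardized X i‖ := by
  have hmul : ∀ {C D : Matrix (Fin p) (Fin p) ℝ}, C ∈ glSet p → D ∈ glSet p → C * D ∈ glSet p := by
    intro C D hC hD
    rw [glSet, Set.mem_ofPred_eq, Matrix.det_mul]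
    exact mul_ne_zero hC hD
  rw [standardized, standardized, sampleCov_affine hn, sampleMean_affine hn,
    add_sub_add_left_eq_sub, ← act_sub]
  set S := sampleCov X
  by_cases h : ∃ L ∈ ltSet p, L * L.transpose = S
  -- `B L` is a square root of the new covariance matrix but need not be triangular; its Cholesky
  -- root gives the same norms, and `(B L)⁻¹ B = L⁻¹`.
  · obtain ⟨L, hL, hLS⟩ := h
    have hBL := hmul hB (ltSet_subset_glSet hL)
    obtain ⟨M, hM, hMS⟩ := exists_ltSet_mul_transpose_eq hBL
    have hMS' : M * M.transpose = B * S * B.transpose := by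
      rw [hMS, ← hLS]; simp only [Matrix.transpose_mul, Matrix.mul_assoc]
    rw [choleskyRoot_eq hL hLS, choleskyRoot_eq hM hMS',
      norm_sq_act_inv_of_mul_transpose hMS, Matrix.mul_inv_rev, act_mul,
      act_inv_act hB]
  · have h' : ¬ ∃ L ∈ ltSet p, L * L.transpose = B * S * B.transpose := by
      rintro ⟨M, hM, hM2⟩
      have hBinv : B⁻¹ ∈ glSet p := by
        rw [glSet, Set.mem_ofPred_eq]
        exact (Matrix.isUnit_nonsing_inv_det _ (isUnit_iff_ne_zero.2 hB)).ne_zero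
      obtain ⟨L, hL, hLS⟩ := exists_ltSet_mul_transpose_eq
        (hmul hBinv (ltSet_subset_glSet hM))
      refine h ⟨L, hL, hLS.trans ?_⟩
      have hBu := isUnit_iff_ne_zero.2 hB
      rw [Matrix.transpose_mul, Matrix.transpose_nonsing_inv]
      calc B⁻¹ * M * (M.transpose * B.transpose⁻¹) = B⁻¹ * (M * M.transpose) * B.transpose⁻¹ := by
            simp only [Matrix.mul_assoc]
        _ = (B⁻¹ * B) * S * (B.transpose * B.transpose⁻¹) := by
            rw [hM2]; simp only [Matrix.mul_assoc]
        _ = S := by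
            rw [Matrix.nonsing_inv_mul _ hBu,
              Matrix.mul_nonsing_inv _ (by rwa [Matrix.det_transpose]), Matrix.mul_one,
              Matrix.one_mul]
    rw [choleskyRoot_eq_zero h, choleskyRoot_eq_zero h']
    simp [act_zero_left]

/-- The vector of ones. -/
def ones (n : ℕ) : EuclideanSpace ℝ (Fin n) := WithLp.toLp 2 fun _ => 1

/-- The sample with given coordinate vectors. -/
def ofRows (Y : Fin p → EuclideanSpace ℝ (Fin n)) : Sample n p :=
  fun i => WithLp.toLp 2 fun j => Y j i

/-- The centred coordinate vectors. -/
noncomputable def centerRows (Y : Fin p → EuclideanSpace ℝ (Fin n)) (j : Fin p) :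
    EuclideanSpace ℝ (Fin n) :=
  Y j - ((n : ℝ)⁻¹ * inner ℝ (ones n) (Y j)) • ones n

lemma inner_ones (y : EuclideanSpace ℝ (Fin n)) : inner ℝ (ones n) y = ∑ i, y i := by
  simp [ones, PiLp.inner_apply]

lemma inner_ones_ones : inner ℝ (ones n) (ones n) = n := by
  rw [inner_ones]; simp [ones]

lemma inner_ones_centerRows (hn : 0 < n) (Y : Fin p → EuclideanSpace ℝ (Fin n)) (j : Fin p) :
    inner ℝ (ones n) (centerRows Y j) = 0 := by
  have : (n : ℝ) ≠ 0 := by positivity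
  rw [centerRows, inner_sub_right, inner_smul_right, inner_ones_ones]
  field_simp
  ring

lemma ofRows_sub_sampleMean (Y : Fin p → EuclideanSpace ℝ (Fin n)) (i : Fin n) (j : Fin p) :
    (ofRows Y i - sampleMean (ofRows Y)) j = centerRows Y j i := by
  rw [centerRows, inner_ones]
  simp [sampleMean, ofRows, ones]

lemma sampleCov_ofRows (Y : Fin p → EuclideanSpace ℝ (Fin n)) :
    sampleCov (ofRows Y) =
      (n : ℝ)⁻¹ • Matrix.of fun j k => inner ℝ (centerRows Y j) (centerRows Y k) := by
  ext j k
  rw [sampleCov, Matrix.smul_apply, Matrix.smul_apply, Matrix.sum_apply, Matrix.of_apply,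
    PiLp.inner_apply]
  congr 1
  refine Finset.sum_congr rfl fun i _ => ?_
  rw [Matrix.vecMulVec_apply, ofRows_sub_sampleMean, ofRows_sub_sampleMean]
  simp [mul_comm]

/-- The Gram matrix of the centred rows is `n S`, so the Cholesky root is `gramFactor` divided by
`√n`, and inverting it performs Gram–Schmidt on those rows. -/
lemma standardized_ofRows (hn : 0 < n) {Y : Fin p → EuclideanSpace ℝ (Fin n)}
    (hY : LinearIndependent ℝ (centerRows Y)) (i : Fin n) (j : Fin p) :
    standardized (ofRows Y) i j = √n * gramSchmidtNormed ℝ (centerRows Y) j i := by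
  have hn' : (0 : ℝ) < n := by positivity
  have hs : 0 < √(n : ℝ) := Real.sqrt_pos.2 hn'
  set L := gramFactor (centerRows Y) with hL
  have hLlt := gramFactor_mem_ltSet hY
  have hT : (√(n : ℝ))⁻¹ • L ∈ ltSet p := by
    refine ⟨fun a b hab => ?_, fun a => ?_⟩
    · rw [Matrix.smul_apply, hL, hLlt.1 a b hab, smul_zero]
    · exact mul_pos (inv_pos.2 hs) (hLlt.2 a)
  have hroot : choleskyRoot (sampleCov (ofRows Y)) = (√(n : ℝ))⁻¹ • L := by
    apply choleskyRoot_eq hT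
    rw [sampleCov_ofRows, ← gramFactor_mul_transpose hY, Matrix.transpose_smul, Matrix.smul_mul,
      Matrix.mul_smul, smul_smul, ← mul_inv, Real.mul_self_sqrt hn'.le]
  have key : ofRows Y i - sampleMean (ofRows Y) = act ((√(n : ℝ))⁻¹ • L)
      (WithLp.toLp 2 fun j => √n * gramSchmidtNormed ℝ (centerRows Y) j i) := by
    ext k
    rw [ofRows_sub_sampleMean, act_apply]
    have := congrArg (fun v : EuclideanSpace ℝ (Fin n) => v i) (sum_gramFactor_smul hY k)
    simp only at this
    rw [← this, WithLp.ofLp_sum, Finset.sum_apply]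
    refine Finset.sum_congr rfl fun l _ => ?_
    simp only [PiLp.smul_apply, Matrix.smul_apply, smul_eq_mul]
    rw [hL]
    field_simp
  rw [standardized, hroot, key, act_inv_act (ltSet_subset_glSet hT)]

/-- A linear relation among the centred rows makes `S` singular, so there is no root in `LT(p)` and
the default `0` applies. -/
lemma standardized_ofRows_eq_zero {Y : Fin p → EuclideanSpace ℝ (Fin n)}
    (hY : ¬ LinearIndependent ℝ (centerRows Y)) (i : Fin n) :
    standardized (ofRows Y) i = 0 := by
  have : ¬ ∃ L ∈ ltSet p, L * L.transpose = sampleCov (ofRows Y) := by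
    rintro ⟨L, hL, hLS⟩
    apply hY
    rw [Fintype.linearIndependent_iff]
    intro g hg
    have h1 : (L * L.transpose).mulVec g = 0 := by
      rw [hLS, sampleCov_ofRows]
      ext j
      rw [Matrix.smul_mulVec, Pi.smul_apply, Matrix.mulVec, dotProduct]
      simp only [Matrix.of_apply, Pi.zero_apply]
      have : ∑ k, inner ℝ (centerRows Y j) (centerRows Y k) * g k = 0 := by
        rw [← inner_zero_right (𝕜 := ℝ) (centerRows Y j), ← hg, inner_sum]
        exact Finset.sum_congr rfl fun k _ => by rw [inner_smul_right, mul_comm]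
      rw [this, smul_zero]
    have hdet : (L * L.transpose).det ≠ 0 := by
      rw [Matrix.det_mul, Matrix.det_transpose]
      exact (mul_pos (det_pos_of_mem_ltSet hL) (det_pos_of_mem_ltSet hL)).ne'
    have := Matrix.eq_zero_of_mulVec_eq_zero hdet h1
    intro j
    rw [this]; rfl
  rw [standardized, choleskyRoot_eq_zero this]
  simp [act_zero_left]

end Samples

/-! ### The span of ones and earlier rows -/

section RowSpan

variable {n p : ℕ}

open InnerProductSpace

/-- The span of the vector of ones and the first coordinate vectors. -/
noncomputable def rowSpan (Y : Fin p → EuclideanSpace ℝ (Fin n)) (j : Fin p) :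
    Submodule ℝ (EuclideanSpace ℝ (Fin n)) :=
  Submodule.span ℝ (insert (ones n) (Y '' Set.Iio j))

/-- The subspace depends on earlier rows only; this allows row `j` to be integrated alone with the
subspace held fixed. -/
lemma rowSpan_update (Y : Fin p → EuclideanSpace ℝ (Fin n)) (j : Fin p)
    (y : EuclideanSpace ℝ (Fin n)) : rowSpan (Function.update Y j y) j = rowSpan Y j := by
  have : Function.update Y j y '' Set.Iio j = Y '' Set.Iio j := by
    apply Set.image_congr
    intro k hk
    rw [Function.update_of_ne (ne_of_lt hk)]
  rw [rowSpan, rowSpan, this]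

lemma ones_mem_rowSpan (Y : Fin p → EuclideanSpace ℝ (Fin n)) (j : Fin p) :
    ones n ∈ rowSpan Y j := Submodule.subset_span (Set.mem_insert _ _)

lemma centerRows_mem_rowSpan (Y : Fin p → EuclideanSpace ℝ (Fin n)) {k j : Fin p} (h : k < j) :
    centerRows Y k ∈ rowSpan Y j :=
  Submodule.sub_mem _ (Submodule.subset_span (Set.mem_insert_of_mem _ ⟨k, h, rfl⟩))
    (Submodule.smul_mem _ _ (ones_mem_rowSpan Y j))

lemma gramSchmidt_centerRows_mem_rowSpan (Y : Fin p → EuclideanSpace ℝ (Fin n)) {k j : Fin p}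
    (h : k < j) : gramSchmidt ℝ (centerRows Y) k ∈ rowSpan Y j := by
  have := gramSchmidt_mem_span ℝ (centerRows Y) (le_refl k)
  refine (Submodule.span_le.2 ?_) this
  rintro _ ⟨l, hl, rfl⟩
  exact centerRows_mem_rowSpan Y (lt_of_le_of_lt hl h)

lemma inner_ones_gramSchmidt (hn : 0 < n) (Y : Fin p → EuclideanSpace ℝ (Fin n)) (j : Fin p) :
    inner ℝ (ones n) (gramSchmidt ℝ (centerRows Y) j) = 0 := by
  have := gramSchmidt_mem_span ℝ (centerRows Y) (le_refl j)
  refine Submodule.span_induction ?_ (by simp) ?_ ?_ this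
  · rintro _ ⟨k, _, rfl⟩
    exact inner_ones_centerRows hn Y k
  · intro x y _ _ hx hy
    rw [inner_add_right, hx, hy, add_zero]
  · intro a x _ hx
    rw [inner_smul_right, hx, mul_zero]

lemma mem_orthogonal_rowSpan {Y : Fin p → EuclideanSpace ℝ (Fin n)} {j : Fin p}
    {w : EuclideanSpace ℝ (Fin n)} (h1 : inner ℝ (ones n) w = 0)
    (h2 : ∀ k < j, inner ℝ (centerRows Y k) w = 0) : w ∈ (rowSpan Y j)ᗮ := by
  rw [Submodule.mem_orthogonal]
  intro u hu
  refine Submodule.span_induction ?_ (by simp) ?_ ?_ hu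
  · rintro _ (rfl | ⟨k, hk, rfl⟩)
    · exact h1
    · have : Y k = centerRows Y k + ((n : ℝ)⁻¹ * inner ℝ (ones n) (Y k)) • ones n := by
        rw [centerRows]; abel
      rw [this, inner_add_left, inner_smul_left, h1, h2 k hk]
      simp
  · intro x y _ _ hx hy
    rw [inner_add_left, hx, hy, add_zero]
  · intro a x _ hx
    rw [inner_smul_left, hx, mul_zero]

lemma starProjection_orthogonal_rowSpan (hn : 0 < n) (Y : Fin p → EuclideanSpace ℝ (Fin n))
    (j : Fin p) :
    (rowSpan Y j)ᗮ.starProjection (Y j) = gramSchmidt ℝ (centerRows Y) j := by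
  apply Submodule.eq_starProjection_of_mem_orthogonal
  · refine mem_orthogonal_rowSpan (inner_ones_gramSchmidt hn Y j) fun k hk => ?_
    rw [real_inner_comm]
    exact gramSchmidt_inv_triangular ℝ _ hk
  · rw [Submodule.orthogonal_orthogonal, gramSchmidt_def]
    have : ∀ z, Y j - (centerRows Y j - z) =
        ((n : ℝ)⁻¹ * inner ℝ (ones n) (Y j)) • ones n + z := by
      intro z; rw [centerRows]; abel
    rw [this]
    refine Submodule.add_mem _ (Submodule.smul_mem _ _ (ones_mem_rowSpan Y j))
      (Submodule.sum_mem _ fun k hk => ?_)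
    rw [Submodule.starProjection_singleton]
    exact Submodule.smul_mem _ _
      (gramSchmidt_centerRows_mem_rowSpan Y (Finset.mem_Iio.1 hk))

lemma dirSq_rowSpan (hn : 0 < n) (Y : Fin p → EuclideanSpace ℝ (Fin n)) (j : Fin p)
    (e : EuclideanSpace ℝ (Fin n)) :
    dirSq (rowSpan Y j) e (Y j) = inner ℝ (gramSchmidtNormed ℝ (centerRows Y) j) e ^ 2 := by
  rw [dirSq, starProjection_orthogonal_rowSpan hn, gramSchmidtNormed, inner_smul_left]
  simp [mul_pow, div_eq_inv_mul]

/-- The normalized vector of ones and the earlier Gram–Schmidt vectors form an orthonormal basis of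
the subspace. For a unit coordinate vector `e` the right side depends on `stdSq` only, so the
conditional variance is a function of the invariants. -/
lemma norm_sq_starProjection_rowSpan (hn : 0 < n) {Y : Fin p → EuclideanSpace ℝ (Fin n)}
    (hY : LinearIndependent ℝ (centerRows Y)) (j : Fin p) (e : EuclideanSpace ℝ (Fin n)) :
    ‖(rowSpan Y j).starProjection e‖ ^ 2 = inner ℝ (ones n) e ^ 2 / n +
      ∑ k ∈ Finset.Iio j, inner ℝ (gramSchmidtNormed ℝ (centerRows Y) k) e ^ 2 := by
  have hn' : (n : ℝ) ≠ 0 := by positivity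
  set g := gramSchmidtNormed ℝ (centerRows Y) with hg
  have ho : Orthonormal ℝ g := gramSchmidtNormed_orthonormal hY
  have h1 : ∀ k, inner ℝ (ones n) (g k) = 0 := fun k => by
    rw [hg, gramSchmidtNormed, inner_smul_right, inner_ones_gramSchmidt hn, mul_zero]
  have hw : (rowSpan Y j).starProjection e = (inner ℝ (ones n) e / n) • ones n +
      ∑ k ∈ Finset.Iio j, inner ℝ (g k) e • g k := by
    apply Submodule.eq_starProjection_of_mem_orthogonal
    · refine Submodule.add_mem _ (Submodule.smul_mem _ _ (ones_mem_rowSpan Y j))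
        (Submodule.sum_mem _ fun k hk => Submodule.smul_mem _ _ ?_)
      rw [hg, gramSchmidtNormed]
      exact Submodule.smul_mem _ _ (gramSchmidt_centerRows_mem_rowSpan Y (Finset.mem_Iio.1 hk))
    · set w := e - ((inner ℝ (ones n) e / n) • ones n +
        ∑ k ∈ Finset.Iio j, inner ℝ (g k) e • g k) with hw
      have hgw : ∀ k < j, inner ℝ (g k) w = 0 := by
        intro k hk
        rw [hw, inner_sub_right, inner_add_right, inner_smul_right,
          real_inner_comm (ones n) (g k), h1 k, inner_sum]
        simp only [inner_smul_right, orthonormal_iff_ite.1 ho]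
        rw [Finset.sum_eq_single k]
        · simp [real_inner_comm]
        · intro b _ hb; simp [hb.symm]
        · intro h; exact absurd (Finset.mem_Iio.2 hk) h
      refine mem_orthogonal_rowSpan ?_ fun k hk => ?_
      · rw [hw, inner_sub_right, inner_add_right, inner_smul_right, inner_ones_ones, inner_sum,
          Finset.sum_eq_zero]
        · field_simp; ring
        · intro k _; rw [inner_smul_right, h1, mul_zero]
      · rw [← sum_gramFactor_smul hY k, sum_inner]
        refine Finset.sum_eq_zero fun l _ => ?_
        rw [inner_smul_left]
        rcases lt_or_ge l j with h | h
        · rw [hgw l h, mul_zero]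
        · rw [(gramFactor_mem_ltSet hY).1 k l (lt_of_lt_of_le hk h)]; simp
  have h3 : ‖(rowSpan Y j).starProjection e‖ ^ 2 = inner ℝ ((rowSpan Y j).starProjection e) e := by
    rw [← real_inner_self_eq_norm_sq, Submodule.inner_starProjection_left_eq_right,
      Submodule.starProjection_eq_self_iff.2 (Submodule.starProjection_apply_mem _ _),
      real_inner_comm]
  rw [h3, hw, inner_add_left, inner_smul_left, sum_inner]
  congr 1
  · simp; ring
  · refine Finset.sum_congr rfl fun k _ => ?_
    rw [inner_smul_left]; simp; ring

lemma linearIndependent_ones_rows (hn : 0 < n) {Y : Fin p → EuclideanSpace ℝ (Fin n)}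
    (hY : LinearIndependent ℝ (centerRows Y)) :
    LinearIndependent ℝ fun o : Option (Fin p) => o.casesOn' (ones n) Y := by
  have hn' : (n : ℝ) ≠ 0 := by positivity
  rw [Fintype.linearIndependent_iff]
  intro c hc
  rw [Fintype.sum_option] at hc
  simp only [Option.casesOn'_none, Option.casesOn'_some] at hc
  -- This is the coefficient of the vector of ones once each row is written as its centred part plus
  -- its mean.
  set β := c none + ∑ k, c (some k) * ((n : ℝ)⁻¹ * inner ℝ (ones n) (Y k)) with hβ
  have h : β • ones n + ∑ k, c (some k) • centerRows Y k = 0 := by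
    rw [← hc]
    simp only [centerRows, smul_sub, Finset.sum_sub_distrib, smul_smul, ← Finset.sum_smul]
    rw [hβ]
    module
  have hβ0 : β = 0 := by
    have := congrArg (inner ℝ (ones n)) h
    rw [inner_add_right, inner_smul_right, inner_ones_ones, inner_sum, Finset.sum_eq_zero,
      inner_zero_right] at this
    · simpa [hn'] using this
    · intro k _; rw [inner_smul_right, inner_ones_centerRows hn, mul_zero]
  rw [hβ0, zero_smul, zero_add] at h
  have hck := Fintype.linearIndependent_iff.1 hY (fun k => c (some k)) h
  have hnone : c none = 0 := by
    rw [hβ] at hβ0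
    simpa [hck] using hβ0
  rintro (_ | k)
  · exact hnone
  · exact hck k

lemma rowSpan_eq_span_range (Y : Fin p → EuclideanSpace ℝ (Fin n)) (j : Fin p) :
    rowSpan Y j = Submodule.span ℝ (Set.range ((fun o : Option (Fin p) => o.casesOn' (ones n) Y) ∘
      Option.map (Subtype.val : Finset.Iio j → Fin p))) := by
  rw [rowSpan]
  congr 1
  ext x
  constructor
  · rintro (rfl | ⟨k, hk, rfl⟩)
    · exact ⟨none, rfl⟩
    · exact ⟨some ⟨k, Finset.mem_Iio.2 hk⟩, rfl⟩
  · rintro ⟨(_ | ⟨k, hk⟩), rfl⟩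
    · exact Set.mem_insert _ _
    · exact Set.mem_insert_of_mem _ ⟨k, Finset.mem_Iio.1 hk, rfl⟩

lemma finrank_orthogonal_rowSpan (hn : 0 < n) {Y : Fin p → EuclideanSpace ℝ (Fin n)}
    (hY : LinearIndependent ℝ (centerRows Y)) (j : Fin p) :
    (Module.finrank ℝ (rowSpan Y j)ᗮ : ℝ) = n - (j + 1) := by
  have h1 : Module.finrank ℝ (rowSpan Y j) = j + 1 := by
    rw [rowSpan_eq_span_range, finrank_span_eq_card]
    · rw [Fintype.card_option, Fintype.card_coe, Fin.card_Iio]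
    · exact (linearIndependent_ones_rows hn hY).comp _
        (Option.map_injective Subtype.val_injective)
  have h2 := Submodule.finrank_add_finrank_orthogonal (rowSpan Y j)
  rw [h1, finrank_euclideanSpace_fin] at h2
  have : ((j : ℝ) + 1) + (Module.finrank ℝ (rowSpan Y j)ᗮ : ℝ) = n := by exact_mod_cast h2
  linarith

lemma rowSpan_ne_top (hpn : p < n) (Y : Fin p → EuclideanSpace ℝ (Fin n)) (j : Fin p) :
    rowSpan Y j ≠ ⊤ := by
  intro h
  have h1 : Module.finrank ℝ (rowSpan Y j) ≤ j + 1 := by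
    rw [rowSpan_eq_span_range]
    refine (finrank_range_le_card _).trans ?_
    rw [Fintype.card_option, Fintype.card_coe, Fin.card_Iio]
  rw [h, finrank_top, finrank_euclideanSpace_fin] at h1
  omega

lemma linearIndependent_of_gramSchmidt_ne_zero {E : Type*} [NormedAddCommGroup E]
    [InnerProductSpace ℝ E] {f : Fin p → E} (h : ∀ j, gramSchmidt ℝ f j ≠ 0) :
    LinearIndependent ℝ f := by
  have h1 : LinearIndependent ℝ (gramSchmidt ℝ f) :=
    linearIndependent_of_ne_zero_of_inner_eq_zero h (gramSchmidt_pairwise_orthogonal ℝ f)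
  rw [linearIndependent_iff_card_eq_finrank_span] at h1 ⊢
  rw [h1, Set.finrank, Set.finrank, span_gramSchmidt]

/-- Invariance under the substitutions of the `j`-th row that are made by lower triangular affine
maps. -/
def IsRowInvariant {α : Type*} (j : Fin p) (Φ : (Fin p → EuclideanSpace ℝ (Fin n)) → α) : Prop :=
  ∀ Y, ∀ t : ℝ, 0 < t → ∀ v ∈ rowSpan Y j, Φ (Function.update Y j (t • Y j + v)) = Φ Y

/-- Links invariance of a test under `LT(p)` to invariance in a single row: multiples of earlier
rows come from the triangular matrix, multiples of the vector of ones from the translation. -/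
lemma exists_affine_ofRows_update (Y : Fin p → EuclideanSpace ℝ (Fin n)) (j : Fin p) {t : ℝ}
    (ht : 0 < t) {v : EuclideanSpace ℝ (Fin n)} (hv : v ∈ rowSpan Y j) :
    ∃ a : Vec p, ∃ L ∈ ltSet p, ofRows (Function.update Y j (t • Y j + v)) =
      fun i => a + act L (ofRows Y i) := by
  obtain ⟨α, z, hz, rfl⟩ := Submodule.mem_span_insert.1 hv
  rw [← Finset.coe_Iio, Submodule.mem_span_image_finset_iff_exists_fun] at hz
  obtain ⟨c, rfl⟩ := hz
  let d : Fin p → ℝ := fun k => if h : k ∈ Finset.Iio j then c ⟨k, h⟩ else 0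
  have hd : ∀ i : Fin n, ∑ k, d k * Y k i = (∑ k, c k • Y k.1) i := by
    intro i
    rw [WithLp.ofLp_sum, Finset.sum_apply, ← Finset.sum_subset (Finset.subset_univ (Finset.Iio j)),
      ← Finset.sum_coe_sort]
    · refine Finset.sum_congr rfl fun k _ => ?_
      simp only [d]
      rw [dif_pos k.2]
      simp
    · intro k _ hk
      simp only [d]
      rw [dif_neg hk, zero_mul]
  -- The matrix is the identity outside row `j`; that row has `t` on the diagonal and the
  -- coefficients `d`, which vanish from index `j` on, to its left.
  refine ⟨EuclideanSpace.single j α, Matrix.of fun r s =>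
    (if r = s then (if r = j then t else 1) else 0) + if r = j then d s else 0, ⟨?_, ?_⟩, ?_⟩
  · intro r s hrs
    rw [Matrix.of_apply, if_neg hrs.ne, zero_add]
    split_ifs with h
    · simp only [d]
      rw [dif_neg]
      rw [Finset.mem_Iio]
      exact not_lt.2 (h ▸ hrs.le)
    · rfl
  · intro r
    rw [Matrix.of_apply, if_pos rfl]
    split_ifs with h
    · have : d r = 0 := by
        simp only [d]
        rw [dif_neg]
        simp [h]
      rw [this, add_zero]; exact ht
    · norm_num
  · ext i r
    rw [PiLp.add_apply, act_apply]
    simp only [Matrix.of_apply, add_mul, Finset.sum_add_distrib, ite_mul, zero_mul,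
      Finset.sum_ite_eq, Finset.mem_univ, if_true]
    by_cases h : r = j
    · subst h
      have h2 := hd i
      simp only [ofRows, Function.update_self, PiLp.add_apply, PiLp.smul_apply, smul_eq_mul,
        PiLp.single_apply, if_true, ← h2, ones]
      ring
    · simp [ofRows, h]

lemma isRowInvariant_of_lt {α : Type*} {φ : Sample n p → α}
    (hφ : ∀ a : Vec p, ∀ L ∈ ltSet p, ∀ X : Sample n p, φ (fun i => a + act L (X i)) = φ X)
    (j : Fin p) : IsRowInvariant j fun Y => φ (ofRows Y) := by
  intro Y t ht v hv
  obtain ⟨a, L, hL, h⟩ := exists_affine_ofRows_update Y j ht hv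
  simp only
  rw [h, hφ a L hL]

end RowSpan

/-! ### Resampling one coordinate of a product measure -/

section Resample

variable {ι : Type*} [Fintype ι] [DecidableEq ι] {α : ι → Type*} [∀ i, MeasurableSpace (α i)]

/-- Replacing one coordinate by an independent copy keeps a product law. It serves as conditioning
on all the other coordinates, without splitting the index set. -/
lemma measurePreserving_update (μ : ∀ i, Measure (α i)) [∀ i, IsProbabilityMeasure (μ i)] (j : ι) :
    MeasurePreserving (fun z : (∀ i, α i) × α j => Function.update z.1 j z.2)
      ((Measure.pi μ).prod (μ j)) (Measure.pi μ) := by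
  have hm : Measurable fun z : (∀ i, α i) × α j => Function.update z.1 j z.2 := by
    rw [measurable_pi_iff]
    intro i
    by_cases h : i = j
    · subst h; simpa using measurable_snd
    · simp only [Function.update_of_ne h]
      exact (measurable_pi_apply i).comp measurable_fst
  refine ⟨hm, (Measure.pi_eq fun s hs => ?_).symm⟩
  rw [Measure.map_apply hm (.univ_pi hs)]
  have : (fun z : (∀ i, α i) × α j => Function.update z.1 j z.2) ⁻¹' Set.univ.pi s =
      (Set.univ.pi (Function.update s j Set.univ)) ×ˢ s j := by
    ext ⟨x, y⟩
    simp only [Set.mem_preimage, Set.mem_univ_pi, Set.mem_prod]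
    constructor
    · intro h
      refine ⟨fun i => ?_, by simpa using h j⟩
      by_cases hi : i = j
      · subst hi; simp
      · simpa [Function.update_of_ne hi] using h i
    · rintro ⟨h1, h2⟩ i
      by_cases hi : i = j
      · subst hi; simpa using h2
      · simpa [Function.update_of_ne hi] using h1 i
  rw [this, Measure.prod_prod, Measure.pi_pi, ← Finset.prod_erase_mul _ _ (Finset.mem_univ j),
    ← Finset.prod_erase_mul Finset.univ (fun i => μ i (s i)) (Finset.mem_univ j)]
  simp only [Function.update_self, measure_univ, mul_one]
  congr 1
  refine Finset.prod_congr rfl fun i hi => ?_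
  rw [Function.update_of_ne (Finset.ne_of_mem_erase hi)]

lemma lintegral_pi_eq_lintegral_update (μ : ∀ i, Measure (α i)) [∀ i, IsProbabilityMeasure (μ i)]
    (j : ι) {F : (∀ i, α i) → ENNReal} (hF : Measurable F) :
    ∫⁻ x, F x ∂Measure.pi μ = ∫⁻ x, ∫⁻ y, F (Function.update x j y) ∂μ j ∂Measure.pi μ := by
  have h := measurePreserving_update μ j
  rw [← h.lintegral_comp hF, lintegral_prod]
  exact (hF.comp h.measurable).aemeasurable

lemma ae_pi_update (μ : ∀ i, Measure (α i)) [∀ i, IsProbabilityMeasure (μ i)]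
    (j : ι) {P : (∀ i, α i) → Prop} (h : ∀ᵐ x ∂Measure.pi μ, P x) :
    ∀ᵐ x ∂Measure.pi μ, ∀ᵐ y ∂μ j, P (Function.update x j y) :=
  Measure.ae_ae_of_ae_prod ((measurePreserving_update μ j).quasiMeasurePreserving.ae h)

end Resample

/-! ### Conditional moments in one row -/

section RowLaw

variable {n p : ℕ}

open InnerProductSpace

/-- The law of the coordinate vectors of a standard normal sample. -/
noncomputable def rowLaw (n p : ℕ) : Measure (Fin p → EuclideanSpace ℝ (Fin n)) :=
  Measure.pi fun _ => stdGaussian (EuclideanSpace ℝ (Fin n))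

lemma measurable_centerRows : Measurable (centerRows : (Fin p → EuclideanSpace ℝ (Fin n)) → _) := by
  rw [measurable_pi_iff]
  intro j
  have h := measurable_pi_apply (X := fun _ : Fin p => EuclideanSpace ℝ (Fin n)) j
  exact h.sub (((measurable_const.inner h).const_mul _).smul_const _)

lemma linearIndependent_iff_gramSchmidt {E : Type*} [NormedAddCommGroup E]
    [InnerProductSpace ℝ E] {f : Fin p → E} :
    LinearIndependent ℝ f ↔ ∀ j, gramSchmidt ℝ f j ≠ 0 :=
  ⟨fun h j => gramSchmidt_ne_zero j h, linearIndependent_of_gramSchmidt_ne_zero⟩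

lemma measurableSet_linearIndependent_centerRows :
    MeasurableSet {Y : Fin p → EuclideanSpace ℝ (Fin n) | LinearIndependent ℝ (centerRows Y)} := by
  have h : {Y : Fin p → EuclideanSpace ℝ (Fin n) | LinearIndependent ℝ (centerRows Y)} =
      ⋂ j, {Y | gramSchmidt ℝ (centerRows Y) j ≠ 0} := by
    ext Y
    rw [Set.mem_iInter]
    exact linearIndependent_iff_gramSchmidt
  rw [h]
  refine MeasurableSet.iInter fun j => ?_
  have : Measurable fun Y : Fin p → EuclideanSpace ℝ (Fin n) => gramSchmidt ℝ (centerRows Y) j :=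
    (measurable_gramSchmidt j).comp measurable_centerRows
  exact this (measurableSet_singleton 0).compl

lemma stdGaussian_submodule {E : Type*} [NormedAddCommGroup E] [InnerProductSpace ℝ E]
    [FiniteDimensional ℝ E] [MeasurableSpace E] [BorelSpace E] {V : Submodule ℝ E} (hV : V ≠ ⊤) :
    stdGaussian E V = 0 := by
  rw [stdGaussian_eq_withDensity]
  exact withDensity_absolutelyContinuous _ _ (Measure.addHaar_submodule _ V hV)

/-- With the other rows fixed, the `j`-th Gram–Schmidt vector vanishes only if `Y j` lies in
`rowSpan Y j`. This is a proper subspace because `p < n`, hence Gaussian-null. -/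
lemma ae_linearIndependent_centerRows (hpn : p < n) :
    ∀ᵐ Y ∂rowLaw n p, LinearIndependent ℝ (centerRows Y) := by
  have hn : 0 < n := by omega
  simp_rw [linearIndependent_iff_gramSchmidt]
  rw [ae_all_iff]
  intro j
  have hm : Measurable fun Y : Fin p → EuclideanSpace ℝ (Fin n) => gramSchmidt ℝ (centerRows Y) j :=
    (measurable_gramSchmidt j).comp measurable_centerRows
  have hs : MeasurableSet {Y : Fin p → EuclideanSpace ℝ (Fin n) |
    gramSchmidt ℝ (centerRows Y) j = 0} := hm (measurableSet_singleton 0)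
  rw [ae_iff]
  simp only [ne_eq, not_not]
  rw [← lintegral_indicator_one hs, rowLaw, lintegral_pi_eq_lintegral_update _ j
    (measurable_one.indicator hs)]
  rw [lintegral_eq_zero_iff']
  swap
  · refine Measurable.aemeasurable ?_
    exact Measurable.lintegral_prod_right' (f := fun z : (Fin p → EuclideanSpace ℝ (Fin n)) ×
      EuclideanSpace ℝ (Fin n) => Set.indicator _ 1 (Function.update z.1 j z.2))
      ((measurable_one.indicator hs).comp (measurePreserving_update
        (fun _ : Fin p => stdGaussian (EuclideanSpace ℝ (Fin n))) j).measurable)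
  refine ae_of_all _ fun Y => ?_
  have h0 := stdGaussian_submodule (rowSpan_ne_top hpn Y j)
  simp only [Pi.zero_apply]
  refine lintegral_eq_zero_of_ae_eq_zero ?_
  filter_upwards [measure_eq_zero_iff_ae_notMem.1 h0] with y hy
  simp only [Pi.zero_apply, Set.indicator_apply_eq_zero]
  intro h
  exfalso
  apply hy
  have h1 := starProjection_orthogonal_rowSpan hn (Function.update Y j y) j
  rw [rowSpan_update, Function.update_self] at h1
  have h2 : (rowSpan Y j)ᗮ.starProjection y = 0 := h1.trans h
  rwa [Submodule.starProjection_apply_eq_zero_iff, Submodule.orthogonal_orthogonal] at h2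

/-- The squared standardized observation, scaled by `n⁻¹`. -/
noncomputable def stdSq (X : Sample n p) (i : Fin n) (j : Fin p) : ℝ := standardized X i j ^ 2 / n

lemma stdSq_nonneg (X : Sample n p) (i : Fin n) (j : Fin p) : 0 ≤ stdSq X i j := by
  unfold stdSq; positivity

lemma stdSq_ofRows (hn : 0 < n) {Y : Fin p → EuclideanSpace ℝ (Fin n)}
    (hY : LinearIndependent ℝ (centerRows Y)) (i : Fin n) (j : Fin p) :
    stdSq (ofRows Y) i j = gramSchmidtNormed ℝ (centerRows Y) j i ^ 2 := by
  have : (0 : ℝ) < n := by positivity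
  rw [stdSq, standardized_ofRows hn hY, mul_pow, Real.sq_sqrt this.le]
  field_simp

lemma sum_stdSq_ofRows (hn : 0 < n) {Y : Fin p → EuclideanSpace ℝ (Fin n)}
    (hY : LinearIndependent ℝ (centerRows Y)) (j : Fin p) :
    ∑ i, stdSq (ofRows Y) i j = 1 := by
  simp_rw [stdSq_ofRows hn hY]
  rw [← EuclideanSpace.real_norm_sq_eq, (gramSchmidtNormed_orthonormal hY).1 j, one_pow]

/-- The sample has coordinate vectors. -/
def toRows (X : Sample n p) : Fin p → EuclideanSpace ℝ (Fin n) := fun j => WithLp.toLp 2 fun i => X i j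

lemma ofRows_toRows (X : Sample n p) : ofRows (toRows X) = X := rfl

lemma toRows_ofRows (Y : Fin p → EuclideanSpace ℝ (Fin n)) : toRows (ofRows Y) = Y := rfl

lemma measurable_toRows : Measurable (toRows : Sample n p → _) := by
  unfold toRows
  fun_prop

lemma measurable_ofRows : Measurable (ofRows : (Fin p → EuclideanSpace ℝ (Fin n)) → Sample n p) := by
  unfold ofRows
  fun_prop

lemma stdSq_le_one (hn : 0 < n) (X : Sample n p) (i : Fin n) (j : Fin p) : stdSq X i j ≤ 1 := by
  rw [← ofRows_toRows X]
  by_cases h : LinearIndependent ℝ (centerRows (toRows X))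
  · rw [← sum_stdSq_ofRows hn h j]
    exact Finset.single_le_sum (f := fun i => stdSq (ofRows (toRows X)) i j)
      (fun i _ => stdSq_nonneg _ i j) (Finset.mem_univ i)
  · rw [stdSq, standardized_ofRows_eq_zero h]
    simp

/-- The Cholesky root is defined by choice, so measurability goes through the explicit Gram–Schmidt
formula on the regular samples and the value `0` elsewhere. -/
lemma measurable_standardized (hn : 0 < n) (i : Fin n) :
    Measurable fun X : Sample n p => standardized X i := by
  classical
  have hs : MeasurableSet {X : Sample n p | LinearIndependent ℝ (centerRows (toRows X))} :=
    measurable_toRows measurableSet_linearIndependent_centerRows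
  have hg : Measurable fun X : Sample n p => (WithLp.toLp 2 fun j =>
      √n * gramSchmidtNormed ℝ (centerRows (toRows X)) j i : Vec p) := by
    have : ∀ j, Measurable fun X : Sample n p => gramSchmidt ℝ (centerRows (toRows X)) j := fun j =>
      (measurable_gramSchmidt j).comp (measurable_centerRows.comp measurable_toRows)
    have h2 : ∀ j, Measurable fun X : Sample n p =>
        gramSchmidtNormed ℝ (centerRows (toRows X)) j := fun j => by
      simp only [gramSchmidtNormed]
      exact ((this j).norm.inv).smul (this j)
    have h3 : ∀ j, Measurable fun X : Sample n p =>
        gramSchmidtNormed ℝ (centerRows (toRows X)) j i := fun j => by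
      have h : Measurable fun y : EuclideanSpace ℝ (Fin n) => y i := by fun_prop
      exact h.comp (h2 j)
    fun_prop
  have : (fun X : Sample n p => standardized X i) =
      Set.indicator {X : Sample n p | LinearIndependent ℝ (centerRows (toRows X))} fun X =>
        (WithLp.toLp 2 fun j => √n * gramSchmidtNormed ℝ (centerRows (toRows X)) j i : Vec p) := by
    ext1 X
    by_cases h : LinearIndependent ℝ (centerRows (toRows X))
    · rw [Set.indicator_of_mem h]
      ext j
      exact standardized_ofRows hn h i j
    · rw [Set.indicator_of_notMem h]
      exact standardized_ofRows_eq_zero h i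
  rw [this]
  exact hg.indicator hs

lemma measurable_stdSq (hn : 0 < n) (i : Fin n) (j : Fin p) :
    Measurable fun X : Sample n p => stdSq X i j := by
  have h : Measurable fun y : Vec p => y j := by fun_prop
  exact ((h.comp (measurable_standardized hn i)).pow_const 2).div_const _

/-- The squared length of the projection of the `i`-th unit vector on the span of the vector of ones
and the first coordinate vectors. -/
noncomputable def leverage (X : Sample n p) (i : Fin n) (j : Fin p) : ℝ :=
  (n : ℝ)⁻¹ + ∑ k ∈ Finset.Iio j, stdSq X i k

lemma leverage_nonneg (X : Sample n p) (i : Fin n) (j : Fin p) : 0 ≤ leverage X i j :=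
  add_nonneg (by positivity) (Finset.sum_nonneg fun k _ => stdSq_nonneg X i k)

lemma measurable_leverage (hn : 0 < n) (i : Fin n) (j : Fin p) :
    Measurable fun X : Sample n p => leverage X i j :=
  measurable_const.add (Finset.measurable_sum _ fun k _ => measurable_stdSq hn i k)

/-- The residual degrees of freedom. -/
noncomputable def resDim (n : ℕ) {p : ℕ} (j : Fin p) : ℝ := n - (j + 1)

lemma resDim_pos (hpn : p < n) (j : Fin p) : 0 < resDim n j := by
  have h1 : (j : ℕ) + 1 < n := by omega
  have : ((j : ℕ) : ℝ) + 1 < n := by exact_mod_cast h1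
  rw [resDim]; linarith

/-- The conditional second moment of an observation, given the invariants. -/
noncomputable def moment2 (X : Sample n p) (i : Fin n) (j : Fin p) : ℝ :=
  leverage X i j + resDim n j * stdSq X i j

/-- The conditional fourth moment of an observation, given the invariants. -/
noncomputable def moment4 (X : Sample n p) (i : Fin n) (j : Fin p) : ℝ :=
  3 * leverage X i j ^ 2 + 6 * leverage X i j * (resDim n j * stdSq X i j) +
    resDim n j * (resDim n j + 2) * stdSq X i j ^ 2

/-- Resample row `j` with the others fixed and apply `lintegral_mul_inner_pow` to `V = rowSpan Y j`
and the `i`-th unit vector. For almost every new row, its geometric quantities are `leverage`,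
`resDim` and `stdSq` of the full sample (`hval`). -/
lemma lintegral_rowLaw_mul_pow (hpn : p < n) (i : Fin n) (j : Fin p)
    {Φ : (Fin p → EuclideanSpace ℝ (Fin n)) → ENNReal} (hΦ : Measurable Φ)
    (hfin : ∫⁻ Y, Φ Y ∂rowLaw n p ≠ ⊤) (hinv : IsRowInvariant j Φ) :
    ∫⁻ Y, Φ Y * ENNReal.ofReal (Y j i ^ 2) ∂rowLaw n p =
      ∫⁻ Y, Φ Y * ENNReal.ofReal (moment2 (ofRows Y) i j) ∂rowLaw n p ∧
    ∫⁻ Y, Φ Y * ENNReal.ofReal (Y j i ^ 4) ∂rowLaw n p =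
      ∫⁻ Y, Φ Y * ENNReal.ofReal (moment4 (ofRows Y) i j) ∂rowLaw n p := by
  have hn : 0 < n := by omega
  have hY : Measurable fun Y : Fin p → EuclideanSpace ℝ (Fin n) => Y j i := by fun_prop
  have hb : Measurable fun Y : Fin p → EuclideanSpace ℝ (Fin n) => stdSq (ofRows Y) i j :=
    (measurable_stdSq hn i j).comp measurable_ofRows
  have hl : Measurable fun Y : Fin p → EuclideanSpace ℝ (Fin n) => leverage (ofRows Y) i j :=
    (measurable_leverage hn i j).comp measurable_ofRows
  have hm2 : Measurable fun Y : Fin p → EuclideanSpace ℝ (Fin n) => moment2 (ofRows Y) i j := by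
    unfold moment2; fun_prop
  have hm4 : Measurable fun Y : Fin p → EuclideanSpace ℝ (Fin n) => moment4 (ofRows Y) i j := by
    unfold moment4; fun_prop
  set e : EuclideanSpace ℝ (Fin n) := EuclideanSpace.single i 1 with he
  have hie : ∀ y : EuclideanSpace ℝ (Fin n), inner ℝ y e = y i := fun y => by
    rw [he, EuclideanSpace.inner_single_right]; simp
  have hfin' : ∀ᵐ Y ∂rowLaw n p, ∫⁻ y, Φ (Function.update Y j y)
      ∂stdGaussian (EuclideanSpace ℝ (Fin n)) < ⊤ := by
    rw [rowLaw, lintegral_pi_eq_lintegral_update _ j hΦ] at hfin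
    refine ae_lt_top ?_ hfin
    exact Measurable.lintegral_prod_right' (f := fun z : (Fin p → EuclideanSpace ℝ (Fin n)) ×
      EuclideanSpace ℝ (Fin n) => Φ (Function.update z.1 j z.2))
      (hΦ.comp (measurePreserving_update
        (fun _ : Fin p => stdGaussian (EuclideanSpace ℝ (Fin n))) j).measurable)
  have hreg := ae_pi_update (fun _ : Fin p => stdGaussian (EuclideanSpace ℝ (Fin n))) j
    (ae_linearIndependent_centerRows hpn)
  have hval : ∀ Y : Fin p → EuclideanSpace ℝ (Fin n), ∀ y : EuclideanSpace ℝ (Fin n),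
      LinearIndependent ℝ (centerRows (Function.update Y j y)) →
      leverage (ofRows (Function.update Y j y)) i j = ‖(rowSpan Y j).starProjection e‖ ^ 2 ∧
      resDim n j = Module.finrank ℝ (rowSpan Y j)ᗮ ∧
      stdSq (ofRows (Function.update Y j y)) i j = dirSq (rowSpan Y j) e y := by
    intro Y y hy
    refine ⟨?_, ?_, ?_⟩
    · rw [← rowSpan_update Y j y, norm_sq_starProjection_rowSpan hn hy, leverage, hie]
      congr 1
      · simp [ones]
      · exact Finset.sum_congr rfl fun k _ => by rw [stdSq_ofRows hn hy, hie]
    · rw [← rowSpan_update Y j y, finrank_orthogonal_rowSpan hn hy, resDim]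
    · rw [stdSq_ofRows hn hy, ← rowSpan_update Y j y]
      have := dirSq_rowSpan hn (Function.update Y j y) j e
      rw [Function.update_self] at this
      rw [this, hie]
  have hΦu : ∀ Y, Measurable fun y => Φ (Function.update Y j y) := fun Y =>
    hΦ.comp (measurable_update Y)
  have hinvu : ∀ Y, ∀ t : ℝ, 0 < t → ∀ v ∈ rowSpan Y j, ∀ y,
      Φ (Function.update Y j (t • y + v)) = Φ (Function.update Y j y) := by
    intro Y t ht v hv y
    have := hinv (Function.update Y j y) t ht v (by rwa [rowSpan_update])
    rwa [Function.update_self, Function.update_idem] at this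
  have aux : ∀ (F G : (Fin p → EuclideanSpace ℝ (Fin n)) → ENNReal), Measurable F → Measurable G →
      (∀ᵐ Y ∂rowLaw n p, ∫⁻ y, F (Function.update Y j y) ∂stdGaussian (EuclideanSpace ℝ (Fin n)) =
        ∫⁻ y, G (Function.update Y j y) ∂stdGaussian (EuclideanSpace ℝ (Fin n))) →
      ∫⁻ Y, F Y ∂rowLaw n p = ∫⁻ Y, G Y ∂rowLaw n p := by
    intro F G hF hG h
    rw [rowLaw, lintegral_pi_eq_lintegral_update _ j hF, lintegral_pi_eq_lintegral_update _ j hG]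
    exact lintegral_congr_ae h
  constructor
  · refine aux _ _ (by fun_prop) (by fun_prop) ?_
    filter_upwards [hfin', hreg] with Y h1 h2
    have h := (lintegral_mul_inner_pow (rowSpan Y j) e (hΦu Y) h1.ne (hinvu Y)).1
    simp only [Function.update_self]
    simp_rw [hie] at h
    rw [h]
    refine lintegral_congr_ae ?_
    filter_upwards [h2] with y hy
    obtain ⟨ha, hb, hc⟩ := hval Y y hy
    rw [moment2, ha, hb, hc]
  · refine aux _ _ (by fun_prop) (by fun_prop) ?_
    filter_upwards [hfin', hreg] with Y h1 h2
    have h := (lintegral_mul_inner_pow (rowSpan Y j) e (hΦu Y) h1.ne (hinvu Y)).2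
    simp only [Function.update_self]
    simp_rw [hie] at h
    rw [h]
    refine lintegral_congr_ae ?_
    filter_upwards [h2] with y hy
    obtain ⟨ha, hb, hc⟩ := hval Y y hy
    rw [moment4, ha, hb, hc]

end RowLaw

/-! ### Conditional moments under the standard normal sample law -/

section StdLaw

variable {n p : ℕ}

/-- The law of a standard normal sample. -/
noncomputable def stdLaw (n p : ℕ) : Measure (Sample n p) :=
  Measure.pi fun _ => stdGaussian (Vec p)

instance : IsProbabilityMeasure (stdLaw n p) := by unfold stdLaw; infer_instance

lemma map_swap_pi (ι κ : Type) [Fintype ι] [Fintype κ] (g : Measure ℝ) [IsProbabilityMeasure g] :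
    (Measure.pi fun _ : ι => Measure.pi fun _ : κ => g).map (fun x k i => x i k) =
      Measure.pi fun _ : κ => Measure.pi fun _ : ι => g := by
  have h : ∀ (ι κ : Type) [Fintype ι] [Fintype κ],
      (Measure.pi fun _ : ι => Measure.pi fun _ : κ => g) =
        (Measure.pi fun _ : ι × κ => g).map (MeasurableEquiv.curry ι κ ℝ) := by
    intro ι κ _ _
    have := Measure.infinitePi_map_curry (fun (_ : ι) (_ : κ) => g)
    simp only [Measure.infinitePi_eq_pi] at this
    exact this.symm
  have h2 := (measurePreserving_piCongrLeft (fun _ : κ × ι => g) (Equiv.prodComm ι κ)).map_eq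
  rw [h ι κ, h κ ι, ← h2, Measure.map_map (by fun_prop) (by fun_prop),
    Measure.map_map (by fun_prop) (by fun_prop)]
  congr 1

/-- All `n p` entries are independent standard normal, so grouping them by coordinate or by
observation gives the same law. -/
lemma map_ofRows_rowLaw : (rowLaw n p).map ofRows = stdLaw n p := by
  have h : ∀ m k : ℕ, (Measure.pi fun _ : Fin m => stdGaussian (EuclideanSpace ℝ (Fin k))) =
      (Measure.pi fun _ : Fin m => Measure.pi fun _ : Fin k => gaussianReal 0 1).map
        fun x i => WithLp.toLp 2 (x i) := by
    intro m k
    rw [← map_pi_eq_stdGaussian]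
    have hm : AEMeasurable (WithLp.toLp 2 : (Fin k → ℝ) → EuclideanSpace ℝ (Fin k))
      (Measure.pi fun _ => gaussianReal 0 1) := by fun_prop
    have : SigmaFinite (Measure.map (WithLp.toLp 2 : (Fin k → ℝ) → EuclideanSpace ℝ (Fin k))
      (Measure.pi fun _ => gaussianReal 0 1)) := by
      rw [map_pi_eq_stdGaussian]; infer_instance
    exact (Measure.pi_map_pi fun _ => hm).symm
  rw [rowLaw, stdLaw, h, h, ← map_swap_pi (Fin p) (Fin n), Measure.map_map measurable_ofRows (by fun_prop),
    Measure.map_map (by fun_prop) (by fun_prop)]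
  rfl

lemma lintegral_stdLaw {F : Sample n p → ENNReal} (hF : Measurable F) :
    ∫⁻ X, F X ∂stdLaw n p = ∫⁻ Y, F (ofRows Y) ∂rowLaw n p := by
  rw [← map_ofRows_rowLaw, lintegral_map hF measurable_ofRows]

lemma ae_stdLaw {P : Sample n p → Prop}
    (h : ∀ᵐ Y ∂rowLaw n p, P (ofRows Y)) : ∀ᵐ X ∂stdLaw n p, P X := by
  rw [← map_ofRows_rowLaw]
  have he : MeasurableEmbedding (ofRows : (Fin p → EuclideanSpace ℝ (Fin n)) → Sample n p) :=
    MeasurableEquiv.measurableEmbedding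
    { toFun := ofRows, invFun := toRows, left_inv := toRows_ofRows, right_inv := ofRows_toRows,
      measurable_toFun := measurable_ofRows, measurable_invFun := measurable_toRows }
  exact he.ae_map_iff.2 h

lemma ae_regular (hpn : p < n) :
    ∀ᵐ X ∂stdLaw n p, LinearIndependent ℝ (centerRows (toRows X)) :=
  ae_stdLaw (ae_linearIndependent_centerRows hpn)

lemma moment2_nonneg (hpn : p < n) (X : Sample n p) (i : Fin n) (j : Fin p) :
    0 ≤ moment2 X i j :=
  add_nonneg (leverage_nonneg X i j) (mul_nonneg (resDim_pos hpn j).le (stdSq_nonneg X i j))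

lemma moment4_nonneg (hpn : p < n) (X : Sample n p) (i : Fin n) (j : Fin p) :
    0 ≤ moment4 X i j := by
  have h1 := leverage_nonneg X i j
  have h2 := (resDim_pos hpn j).le
  have h3 := stdSq_nonneg X i j
  unfold moment4
  positivity

lemma leverage_le (hpn : p < n) (X : Sample n p) (i : Fin n) (j : Fin p) : leverage X i j ≤ n := by
  have hn : 0 < n := by omega
  have h1 : ∑ k ∈ Finset.Iio j, stdSq X i k ≤ ∑ k ∈ Finset.Iio j, 1 :=
    Finset.sum_le_sum fun k _ => stdSq_le_one hn X i k
  have h2 : (n : ℝ)⁻¹ ≤ 1 := inv_le_one_of_one_le₀ (by exact_mod_cast hn)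
  have h3 : ((j : ℕ) : ℝ) + 1 ≤ n := by
    have : (j : ℕ) + 1 ≤ n := by omega
    exact_mod_cast this
  rw [leverage]
  simp only [Finset.sum_const, Fin.card_Iio, nsmul_eq_mul, mul_one] at h1
  linarith

lemma moment2_le (hpn : p < n) (X : Sample n p) (i : Fin n) (j : Fin p) :
    moment2 X i j ≤ 2 * n := by
  have h1 := leverage_le hpn X i j
  have h2 := stdSq_le_one (by omega) X i j
  have h3 := resDim_pos hpn j
  have h4 : resDim n j ≤ n := by rw [resDim]; have : (0 : ℝ) ≤ (j : ℕ) := by positivity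
                                 linarith
  rw [moment2]
  nlinarith [stdSq_nonneg X i j]

lemma moment4_le (hpn : p < n) (X : Sample n p) (i : Fin n) (j : Fin p) :
    moment4 X i j ≤ 3 * n ^ 2 + 6 * n * n + n * (n + 2) := by
  have h1 := leverage_le hpn X i j
  have h0 := leverage_nonneg X i j
  have h2 := stdSq_le_one (by omega) X i j
  have h2' := stdSq_nonneg X i j
  have h3 := (resDim_pos hpn j).le
  have h4 : resDim n j ≤ n := by rw [resDim]; have : (0 : ℝ) ≤ (j : ℕ) := by positivity
                                 linarith
  have h5 : resDim n j * stdSq X i j ≤ n := by nlinarith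
  have h6 : stdSq X i j ^ 2 ≤ 1 := by nlinarith
  have h7 : resDim n j * (resDim n j + 2) ≤ n * (n + 2) := by gcongr
  have h8 : resDim n j * (resDim n j + 2) * stdSq X i j ^ 2 ≤ n * (n + 2) :=
    (mul_le_of_le_one_right (by positivity) h6).trans h7
  have h9 : 6 * leverage X i j * (resDim n j * stdSq X i j) ≤ 6 * n * n := by gcongr
  have h10 : 3 * leverage X i j ^ 2 ≤ 3 * n ^ 2 := by gcongr
  rw [moment4]
  linarith

lemma measurable_moment2 (hn : 0 < n) (i : Fin n) (j : Fin p) :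
    Measurable fun X : Sample n p => moment2 X i j := by
  have h1 := measurable_leverage hn i j
  have h2 := measurable_stdSq hn i j
  unfold moment2; fun_prop

lemma measurable_moment4 (hn : 0 < n) (i : Fin n) (j : Fin p) :
    Measurable fun X : Sample n p => moment4 X i j := by
  have h1 := measurable_leverage hn i j
  have h2 := measurable_stdSq hn i j
  unfold moment4; fun_prop

lemma stdSq_affine (hn : 0 < n) (a : Vec p) {L : Matrix (Fin p) (Fin p) ℝ} (hL : L ∈ ltSet p)
    (X : Sample n p) (i : Fin n) (j : Fin p) :
    stdSq (fun i => a + act L (X i)) i j = stdSq X i j := by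
  rw [stdSq, standardized_affine hn a hL, stdSq]

lemma moment2_affine (hn : 0 < n) (a : Vec p) {L : Matrix (Fin p) (Fin p) ℝ} (hL : L ∈ ltSet p)
    (X : Sample n p) (i : Fin n) (j : Fin p) :
    moment2 (fun i => a + act L (X i)) i j = moment2 X i j := by
  simp only [moment2, leverage, stdSq_affine hn a hL]

lemma lintegral_mul_ne_top {α : Type*} [MeasurableSpace α] {μ : Measure α} {φ : α → ENNReal}
    (hφ : Measurable φ) (hfin : ∫⁻ x, φ x ∂μ ≠ ⊤) {F : α → ℝ} {C : ℝ} (hF : ∀ x, F x ≤ C) :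
    ∫⁻ x, φ x * ENNReal.ofReal (F x) ∂μ ≠ ⊤ := by
  refine ne_top_of_le_ne_top (ENNReal.mul_ne_top hfin (ENNReal.ofReal_ne_top (r := C))) ?_
  rw [← lintegral_mul_const _ hφ]
  gcongr with x
  exact hF x

section LowerTriangular

variable {φ : Sample n p → ENNReal} (hpn : p < n) (hφ : Measurable φ)
  (hfin : ∫⁻ X, φ X ∂stdLaw n p ≠ ⊤)
  (hinv : ∀ a : Vec p, ∀ L ∈ ltSet p, ∀ X : Sample n p, φ (fun i => a + act L (X i)) = φ X)
include hpn hφ hfin hinv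

lemma lintegral_stdLaw_mul_sq (i : Fin n) (j : Fin p) :
    ∫⁻ X, φ X * ENNReal.ofReal (X i j ^ 2) ∂stdLaw n p =
      ∫⁻ X, φ X * ENNReal.ofReal (moment2 X i j) ∂stdLaw n p := by
  have hm := measurable_moment2 (n := n) (by omega) i j
  rw [lintegral_stdLaw (by fun_prop), lintegral_stdLaw (by fun_prop)]
  rw [lintegral_stdLaw hφ] at hfin
  exact (lintegral_rowLaw_mul_pow hpn i j (hφ.comp measurable_ofRows) hfin
    (isRowInvariant_of_lt hinv j)).1

lemma lintegral_stdLaw_mul_pow_four (i : Fin n) (j : Fin p) :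
    ∫⁻ X, φ X * ENNReal.ofReal (X i j ^ 4) ∂stdLaw n p =
      ∫⁻ X, φ X * ENNReal.ofReal (moment4 X i j) ∂stdLaw n p := by
  have hm := measurable_moment4 (n := n) (by omega) i j
  rw [lintegral_stdLaw (by fun_prop), lintegral_stdLaw (by fun_prop)]
  rw [lintegral_stdLaw hφ] at hfin
  exact (lintegral_rowLaw_mul_pow hpn i j (hφ.comp measurable_ofRows) hfin
    (isRowInvariant_of_lt hinv j)).2

/-- The one-row result is used twice. The weight `φ · X_{il}²` is invariant in row `j` because row
`l` is untouched, which replaces `X_{ij}²` by `moment2`; that is `LT(p)`-invariant, so it can join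
the weight when row `l` is treated. -/
lemma lintegral_stdLaw_mul_sq_mul_sq (i : Fin n) {j l : Fin p} (hjl : j ≠ l) :
    ∫⁻ X, φ X * ENNReal.ofReal (X i j ^ 2 * X i l ^ 2) ∂stdLaw n p =
      ∫⁻ X, φ X * ENNReal.ofReal (moment2 X i j * moment2 X i l) ∂stdLaw n p := by
  have hn : 0 < n := by omega
  have hmj := measurable_moment2 (n := n) hn i j
  have hml := measurable_moment2 (n := n) hn i l
  have h1 : ∫⁻ X, φ X * ENNReal.ofReal (X i l ^ 2) ∂stdLaw n p ≠ ⊤ := by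
    rw [lintegral_stdLaw_mul_sq hpn hφ hfin hinv]
    exact lintegral_mul_ne_top hφ hfin fun X => moment2_le hpn X i l
  have h2 : ∫⁻ X, φ X * ENNReal.ofReal (moment2 X i j) ∂stdLaw n p ≠ ⊤ :=
    lintegral_mul_ne_top hφ hfin fun X => moment2_le hpn X i j
  have step1 : ∫⁻ X, φ X * ENNReal.ofReal (X i l ^ 2) * ENNReal.ofReal (X i j ^ 2) ∂stdLaw n p =
      ∫⁻ X, φ X * ENNReal.ofReal (X i l ^ 2) * ENNReal.ofReal (moment2 X i j) ∂stdLaw n p := by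
    rw [lintegral_stdLaw (by fun_prop), lintegral_stdLaw (by fun_prop)]
    have hm : Measurable fun X : Sample n p => φ X * ENNReal.ofReal (X i l ^ 2) := by fun_prop
    rw [lintegral_stdLaw hm] at h1
    refine (lintegral_rowLaw_mul_pow hpn i j (Φ := fun Y => φ (ofRows Y) *
      ENNReal.ofReal (ofRows Y i l ^ 2)) ?_ h1 ?_).1
    · exact hm.comp measurable_ofRows
    · intro Y t ht v hv
      have h := isRowInvariant_of_lt hinv j Y t ht v hv
      simp only at h ⊢
      rw [h]
      congr 3
      simp [ofRows, Function.update_of_ne hjl.symm]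
  have step2 := lintegral_stdLaw_mul_sq (φ := fun X => φ X * ENNReal.ofReal (moment2 X i j)) hpn
    (by fun_prop) h2 (fun a L hL X => by rw [hinv a L hL, moment2_affine hn a hL]) i l
  calc _ = ∫⁻ X, φ X * ENNReal.ofReal (X i l ^ 2) * ENNReal.ofReal (X i j ^ 2) ∂stdLaw n p := by
        refine lintegral_congr fun X => ?_
        rw [ENNReal.ofReal_mul (sq_nonneg _)]; ring
    _ = ∫⁻ X, φ X * ENNReal.ofReal (moment2 X i j) * ENNReal.ofReal (X i l ^ 2) ∂stdLaw n p := by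
        rw [step1]
        refine lintegral_congr fun X => ?_
        ring
    _ = _ := by
        rw [step2]
        refine lintegral_congr fun X => ?_
        rw [ENNReal.ofReal_mul (moment2_nonneg hpn X i j)]; ring

end LowerTriangular

lemma integrable_of_bounded {φ : Sample n p → ℝ} (hφ : Measurable φ) {C : ℝ}
    (h : ∀ X, |φ X| ≤ C) : Integrable φ (stdLaw n p) :=
  Integrable.of_bound hφ.aestronglyMeasurable C (ae_of_all _ h)

/-- Passes to Bochner integrals: integrability of the unbounded `φ F` is inherited from the bounded
replacement `φ G`. -/
lemma integral_eq_and_integrable_of_lintegral {α : Type*} [MeasurableSpace α] {μ : Measure α}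
    {φ F G : α → ℝ} (hφ : Measurable φ) (hφ0 : ∀ x, 0 ≤ φ x) (hF : Measurable F) (hF0 : ∀ x, 0 ≤ F x)
    (hG : Measurable G) (hG0 : ∀ x, 0 ≤ G x) (hint : Integrable (fun x => φ x * G x) μ)
    (h : ∫⁻ x, ENNReal.ofReal (φ x) * ENNReal.ofReal (F x) ∂μ =
      ∫⁻ x, ENNReal.ofReal (φ x) * ENNReal.ofReal (G x) ∂μ) :
    Integrable (fun x => φ x * F x) μ ∧ ∫ x, φ x * F x ∂μ = ∫ x, φ x * G x ∂μ := by
  simp_rw [← ENNReal.ofReal_mul (hφ0 _)] at h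
  have hF' : ∀ x, 0 ≤ φ x * F x := fun x => mul_nonneg (hφ0 x) (hF0 x)
  have hG' : ∀ x, 0 ≤ φ x * G x := fun x => mul_nonneg (hφ0 x) (hG0 x)
  constructor
  · refine ⟨(hφ.mul hF).aestronglyMeasurable, ?_⟩
    rw [hasFiniteIntegral_iff_ofReal (ae_of_all _ hF'), h,
      ← hasFiniteIntegral_iff_ofReal (ae_of_all _ hG')]
    exact hint.2
  · rw [integral_eq_lintegral_of_nonneg_ae (ae_of_all _ hF') (hφ.mul hF).aestronglyMeasurable,
      integral_eq_lintegral_of_nonneg_ae (ae_of_all _ hG') (hφ.mul hG).aestronglyMeasurable, h]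

section LowerTriangularReal

variable {φ : Sample n p → ℝ} (hpn : p < n) (hφ : IsTest φ) (hinv : IsInvariant (ltSet p) φ)
include hpn hφ hinv

lemma integral_stdLaw_mul (i : Fin n) (j l : Fin p) :
    (Integrable (fun X => φ X * X i j ^ 2) (stdLaw n p) ∧
      ∫ X, φ X * X i j ^ 2 ∂stdLaw n p = ∫ X, φ X * moment2 X i j ∂stdLaw n p) ∧
    (Integrable (fun X => φ X * X i j ^ 4) (stdLaw n p) ∧
      ∫ X, φ X * X i j ^ 4 ∂stdLaw n p = ∫ X, φ X * moment4 X i j ∂stdLaw n p) ∧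
    (j ≠ l → Integrable (fun X => φ X * (X i j ^ 2 * X i l ^ 2)) (stdLaw n p) ∧
      ∫ X, φ X * (X i j ^ 2 * X i l ^ 2) ∂stdLaw n p =
        ∫ X, φ X * (moment2 X i j * moment2 X i l) ∂stdLaw n p) := by
  have hn : 0 < n := by omega
  have hφm := hφ.measurable
  have hmj := measurable_moment2 (n := n) hn i j
  have hml := measurable_moment2 (n := n) hn i l
  have hm4 := measurable_moment4 (n := n) hn i j
  have hint : ∀ {G : Sample n p → ℝ}, Measurable G → (∀ X, 0 ≤ G X) → ∀ C, (∀ X, G X ≤ C) →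
      Integrable (fun X => φ X * G X) (stdLaw n p) := by
    intro G hG hG0 C hC
    refine integrable_of_bounded (hφm.mul hG) (C := C) fun X => ?_
    rw [abs_of_nonneg (mul_nonneg (hφ.nonneg X) (hG0 X))]
    calc φ X * G X ≤ 1 * G X := by gcongr; exacts [hG0 X, hφ.le_one X]
      _ ≤ C := by rw [one_mul]; exact hC X
  have hfin : ∫⁻ X, ENNReal.ofReal (φ X) ∂stdLaw n p ≠ ⊤ := by
    have h := hint (G := fun _ => 1) measurable_const (fun _ => zero_le_one) 1 (fun _ => le_rfl)
    simp only [mul_one] at h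
    have := (hasFiniteIntegral_iff_ofReal (ae_of_all _ hφ.nonneg)).1 h.2
    exact this.ne
  have hinv' : ∀ a : Vec p, ∀ L ∈ ltSet p, ∀ X : Sample n p,
      ENNReal.ofReal (φ (fun i => a + act L (X i))) = ENNReal.ofReal (φ X) := fun a L hL X => by
    rw [hinv a L hL]
  refine ⟨?_, ?_, fun hjl => ?_⟩
  · exact integral_eq_and_integrable_of_lintegral hφm hφ.nonneg (by fun_prop)
      (fun X => by positivity) hmj (fun X => moment2_nonneg hpn X i j)
      (hint hmj (fun X => moment2_nonneg hpn X i j) _ fun X => moment2_le hpn X i j)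
      (lintegral_stdLaw_mul_sq hpn (by fun_prop) hfin hinv' i j)
  · exact integral_eq_and_integrable_of_lintegral hφm hφ.nonneg (by fun_prop)
      (fun X => by positivity) hm4 (fun X => moment4_nonneg hpn X i j)
      (hint hm4 (fun X => moment4_nonneg hpn X i j) _ fun X => moment4_le hpn X i j)
      (lintegral_stdLaw_mul_pow_four hpn (by fun_prop) hfin hinv' i j)
  · have h0 : ∀ X, 0 ≤ moment2 X i j * moment2 X i l := fun X =>
      mul_nonneg (moment2_nonneg hpn X i j) (moment2_nonneg hpn X i l)
    exact integral_eq_and_integrable_of_lintegral hφm hφ.nonneg (by fun_prop)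
      (fun X => by positivity) (hmj.mul hml) h0
      (hint (hmj.mul hml) h0 ((2 * n) * (2 * n)) fun X => by
        have := moment2_nonneg hpn X i j
        have := moment2_nonneg hpn X i l
        have := moment2_le hpn X i j
        have := moment2_le hpn X i l
        gcongr)
      (lintegral_stdLaw_mul_sq_mul_sq hpn (by fun_prop) hfin hinv' i hjl)

end LowerTriangularReal

end StdLaw

/-! ### Summation identities and triangular linear systems -/

section Algebra

variable {p : ℕ}

lemma sum_Iio_eq_sum_range (b : ℕ → ℝ) (j : Fin p) :
    ∑ k ∈ Finset.Iio j, b k = ∑ k ∈ Finset.range j, b k := by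
  have h : (Finset.Iio j).map Fin.valEmbedding = Finset.range j := by
    rw [Fin.map_valEmbedding_Iio]; ext; simp
  rw [← h, Finset.sum_map]
  rfl

lemma exists_nat_extension (c : Fin p → ℝ) : ∃ b : ℕ → ℝ, ∀ k : Fin p, b k = c k :=
  ⟨fun k => if h : k < p then c ⟨k, h⟩ else 0, fun k => by simp⟩

/-- With indices from `0`, the term `c k` occurs in the `p - (k + 1)` later partial sums and once
more with weight `N - (k + 1)`. -/
lemma sum_partial_sums (c : Fin p → ℝ) (N : ℝ) :
    ∑ j, (∑ k ∈ Finset.Iio j, c k + (N - (j + 1)) * c j) =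
      ∑ k : Fin p, (N + p - 2 * (k + 1)) * c k := by
  obtain ⟨b, hb⟩ := exists_nat_extension c
  simp_rw [← hb, sum_Iio_eq_sum_range b]
  rw [Fin.sum_univ_eq_sum_range (fun j => ∑ k ∈ Finset.range j, b k + (N - (j + 1)) * b j),
    Fin.sum_univ_eq_sum_range (fun k => (N + p - 2 * (k + 1)) * b k)]
  have key : ∀ q : ℕ, ∑ j ∈ Finset.range q, (∑ k ∈ Finset.range j, b k + (N - (j + 1)) * b j) =
      ∑ k ∈ Finset.range q, (N + q - 2 * (k + 1)) * b k := by
    intro q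
    induction q with
    | zero => simp
    | succ q ih =>
      rw [Finset.sum_range_succ, ih, Finset.sum_range_succ]
      have : ∑ k ∈ Finset.range q, (N + (q + 1 : ℕ) - 2 * (k + 1)) * b k =
          ∑ k ∈ Finset.range q, (N + q - 2 * (k + 1)) * b k + ∑ k ∈ Finset.range q, b k := by
        rw [← Finset.sum_add_distrib]
        refine Finset.sum_congr rfl fun k _ => ?_
        push_cast; ring
      rw [this]
      push_cast
      ring
  exact key p

/-- Induction on the number of terms: adding row `q` raises every old coefficient by `1`, which
accounts for the squared partial sum, and in the new row and column the maximum is always `q + 1`.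
-/
lemma sum_partial_sums_sq (c : Fin p → ℝ) (N : ℝ) :
    ∑ j, ((∑ k ∈ Finset.Iio j, c k) ^ 2 + 2 * (∑ k ∈ Finset.Iio j, c k) * ((N - (j + 1)) * c j) +
      (N - (j + 1)) * c j ^ 2) =
      ∑ k : Fin p, ∑ l : Fin p, (N + p - 2 * max ((k : ℝ) + 1) ((l : ℝ) + 1)) * (c k * c l) := by
  obtain ⟨b, hb⟩ := exists_nat_extension c
  simp_rw [← hb, sum_Iio_eq_sum_range b]
  rw [Fin.sum_univ_eq_sum_range (fun j => (∑ k ∈ Finset.range j, b k) ^ 2 +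
    2 * (∑ k ∈ Finset.range j, b k) * ((N - (j + 1)) * b j) + (N - (j + 1)) * b j ^ 2)]
  have h2 : ∀ k : Fin p, ∑ l : Fin p, (N + p - 2 * max ((k : ℝ) + 1) ((l : ℝ) + 1)) * (b k * b l) =
      ∑ l ∈ Finset.range p, (N + p - 2 * max ((k : ℝ) + 1) ((l : ℝ) + 1)) * (b k * b l) := fun k =>
    Fin.sum_univ_eq_sum_range
      (fun l => (N + p - 2 * max ((k : ℝ) + 1) ((l : ℝ) + 1)) * (b k * b l)) p
  simp_rw [h2]
  rw [Fin.sum_univ_eq_sum_range (fun k => ∑ l ∈ Finset.range p,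
    (N + p - 2 * max ((k : ℝ) + 1) ((l : ℝ) + 1)) * (b k * b l))]
  have key : ∀ q : ℕ, ∑ j ∈ Finset.range q, ((∑ k ∈ Finset.range j, b k) ^ 2 +
      2 * (∑ k ∈ Finset.range j, b k) * ((N - (j + 1)) * b j) + (N - (j + 1)) * b j ^ 2) =
      ∑ k ∈ Finset.range q, ∑ l ∈ Finset.range q,
        (N + q - 2 * max ((k : ℝ) + 1) ((l : ℝ) + 1)) * (b k * b l) := by
    intro q
    induction q with
    | zero => simp
    | succ q ih =>
      rw [Finset.sum_range_succ, ih, Finset.sum_range_succ]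
      simp_rw [Finset.sum_range_succ _ q]
      rw [Finset.sum_add_distrib]
      have hmax : ∀ k ∈ Finset.range q, max ((k : ℝ) + 1) ((q : ℝ) + 1) = q + 1 := by
        intro k hk
        apply max_eq_right
        have : (k : ℝ) ≤ q := by exact_mod_cast (Finset.mem_range.1 hk).le
        linarith
      have e1 : ∑ k ∈ Finset.range q, ∑ l ∈ Finset.range q,
          (N + (q + 1 : ℕ) - 2 * max ((k : ℝ) + 1) ((l : ℝ) + 1)) * (b k * b l) =
          ∑ k ∈ Finset.range q, ∑ l ∈ Finset.range q,
          (N + q - 2 * max ((k : ℝ) + 1) ((l : ℝ) + 1)) * (b k * b l) +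
          (∑ k ∈ Finset.range q, b k) ^ 2 := by
        rw [sq, Finset.sum_mul_sum, ← Finset.sum_add_distrib]
        refine Finset.sum_congr rfl fun k _ => ?_
        rw [← Finset.sum_add_distrib]
        refine Finset.sum_congr rfl fun l _ => ?_
        push_cast; ring
      have e2 : ∑ k ∈ Finset.range q, (N + (q + 1 : ℕ) - 2 * max ((k : ℝ) + 1) ((q : ℝ) + 1)) *
          (b k * b q) = (∑ k ∈ Finset.range q, b k) * ((N - (q + 1)) * b q) := by
        rw [Finset.sum_mul]
        refine Finset.sum_congr rfl fun k hk => ?_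
        rw [hmax k hk]; push_cast; ring
      have e3 : ∑ l ∈ Finset.range q, (N + (q + 1 : ℕ) - 2 * max ((q : ℝ) + 1) ((l : ℝ) + 1)) *
          (b q * b l) = (∑ k ∈ Finset.range q, b k) * ((N - (q + 1)) * b q) := by
        rw [Finset.sum_mul]
        refine Finset.sum_congr rfl fun k hk => ?_
        rw [max_comm, hmax k hk]; push_cast; ring
      rw [e1, e2, e3, max_self]
      push_cast
      ring
  exact key p

/-- The quartic form of the locally best test for lower triangular matrices. -/
noncomputable def triangularForm (N : ℝ) (c : Fin p → ℝ) : ℝ :=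
  (N + p + 2) * (N + p) * (∑ k, c k) ^ 2 -
    2 * (N + p + 2) * ∑ j : Fin p, ∑ k : Fin p, max ((j : ℝ) + 1) ((k : ℝ) + 1) * (c j * c k) -
    2 * (N + p) * ∑ j : Fin p, ∑ k : Fin p, min ((j : ℝ) + 1) ((k : ℝ) + 1) * (c j * c k) +
    4 * (∑ j : Fin p, ((j : ℝ) + 1) * c j) ^ 2

/-- Expand the square and use `max + min = j + k`, so that the two double sums add up to `2 (∑ c) (∑
j c_j)`. -/
lemma triangularForm_eq (N : ℝ) (c : Fin p → ℝ) :
    triangularForm N c = (∑ k : Fin p, (N + p - 2 * (k + 1)) * c k) ^ 2 +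
      2 * ∑ k : Fin p, ∑ l : Fin p,
        (N + p - 2 * max ((k : ℝ) + 1) ((l : ℝ) + 1)) * (c k * c l) := by
  set σ := ∑ k, c k with hσ
  set τ := ∑ j : Fin p, ((j : ℝ) + 1) * c j with hτ
  set Mx := ∑ j : Fin p, ∑ k : Fin p, max ((j : ℝ) + 1) ((k : ℝ) + 1) * (c j * c k) with hMx
  set Mn := ∑ j : Fin p, ∑ k : Fin p, min ((j : ℝ) + 1) ((k : ℝ) + 1) * (c j * c k) with hMn
  have h1 : ∑ k : Fin p, (N + p - 2 * ((k : ℝ) + 1)) * c k = (N + p) * σ - 2 * τ := by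
    rw [hσ, hτ, Finset.mul_sum, Finset.mul_sum, ← Finset.sum_sub_distrib]
    exact Finset.sum_congr rfl fun k _ => by ring
  have h2 : ∑ k : Fin p, ∑ l : Fin p, (N + p - 2 * max ((k : ℝ) + 1) ((l : ℝ) + 1)) * (c k * c l) =
      (N + p) * σ ^ 2 - 2 * Mx := by
    rw [hσ, sq, Finset.sum_mul_sum, hMx, Finset.mul_sum, Finset.mul_sum, ← Finset.sum_sub_distrib]
    refine Finset.sum_congr rfl fun k _ => ?_
    rw [Finset.mul_sum, Finset.mul_sum, ← Finset.sum_sub_distrib]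
    exact Finset.sum_congr rfl fun l _ => by ring
  have h3 : Mx + Mn = 2 * (σ * τ) := by
    have hst : σ * τ = ∑ k : Fin p, ∑ l : Fin p, ((l : ℝ) + 1) * (c k * c l) := by
      rw [hσ, hτ, Finset.sum_mul_sum]
      exact Finset.sum_congr rfl fun k _ => Finset.sum_congr rfl fun l _ => by ring
    have hst' : σ * τ = ∑ k : Fin p, ∑ l : Fin p, ((k : ℝ) + 1) * (c k * c l) := by
      rw [hst, Finset.sum_comm]
      exact Finset.sum_congr rfl fun k _ => Finset.sum_congr rfl fun l _ => by ring
    rw [two_mul]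
    nth_rewrite 1 [hst']
    rw [hst, hMx, hMn, ← Finset.sum_add_distrib, ← Finset.sum_add_distrib]
    refine Finset.sum_congr rfl fun k _ => ?_
    rw [← Finset.sum_add_distrib, ← Finset.sum_add_distrib]
    refine Finset.sum_congr rfl fun l _ => ?_
    rw [← add_mul, ← add_mul, max_add_min]
  rw [triangularForm, h1, h2, ← hσ, ← hτ, ← hMx, ← hMn]
  linear_combination (2 * (N + p)) * (-h3)

lemma sum_sum_ite (u w : Fin p → ℝ) :
    ∑ j, ∑ l, (if j = l then w j else u j * u l) = (∑ j, u j) ^ 2 + ∑ j, (w j - u j ^ 2) := by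
  rw [sq, Finset.sum_mul_sum, ← Finset.sum_add_distrib]
  refine Finset.sum_congr rfl fun j _ => ?_
  have : ∀ l, (if j = l then w j else u j * u l) =
      u j * u l + if j = l then w j - u j ^ 2 else 0 := by
    intro l
    split_ifs with h
    · subst h; ring
    · ring
  simp_rw [this, Finset.sum_add_distrib]
  simp

/-- The system is triangular with nonzero diagonal `N - (j + 1)`, so its solution is unique; a
constant `β` solves it since `j + (N - (j + 1)) = N - 1`. -/
lemma eq_div_of_partial_sums {N D : ℝ} (hN : (p : ℝ) < N) {β : Fin p → ℝ}
    (h : ∀ j, ∑ k ∈ Finset.Iio j, β k + (N - (j + 1)) * β j = D) (j : Fin p) :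
    β j = D / (N - 1) := by
  induction j using WellFoundedLT.induction with
  | ind j ih =>
    have hj : ((j : ℕ) : ℝ) + 1 ≤ p := by
      have : (j : ℕ) + 1 ≤ p := j.2
      exact_mod_cast this
    have hj0 : (0 : ℝ) ≤ (j : ℕ) := by positivity
    have h1 := h j
    rw [Finset.sum_congr rfl fun k hk => ih k (Finset.mem_Iio.1 hk), Finset.sum_const,
      Fin.card_Iio, nsmul_eq_mul] at h1
    have hN1 : N - 1 ≠ 0 := by linarith
    have hNj : N - (j + 1) ≠ 0 := by linarith
    rw [eq_div_iff hN1]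
    apply mul_left_cancel₀ hNj
    field_simp at h1
    linear_combination h1

lemma sum_diag_const {s t : Finset (Fin p)} (hst : s ⊆ t) (A : ℝ) :
    ∑ k ∈ s, ∑ l ∈ t, A * (1 + 2 * (if k = l then 1 else 0)) = A * (s.card * (t.card + 2)) := by
  have : ∀ k ∈ s, ∑ l ∈ t, A * (1 + 2 * (if k = l then (1 : ℝ) else 0)) = A * (t.card + 2) := by
    intro k hk
    rw [← Finset.mul_sum, Finset.sum_add_distrib, ← Finset.mul_sum, Finset.sum_ite_eq,
      if_pos (hst hk)]
    simp
  rw [Finset.sum_congr rfl this, Finset.sum_const, nsmul_eq_mul]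
  ring

/-- Again a triangular system, solved column by column: within column `j` first the entries above
the diagonal, then the diagonal one. The pattern `A (1 + 2δ)` gives `A (N - 1)(N + 1)` on the left
of each off-diagonal equation and three times that on the diagonal, which fixes `A`. -/
lemma eq_of_quartic_partial_sums {N M : ℝ} (hN : (p : ℝ) < N) {a : Fin p → Fin p → ℝ}
    (hsymm : ∀ j l, a j l = a l j)
    (h1 : ∀ l j, l < j → ∑ k ∈ Finset.Iio l, ∑ k' ∈ Finset.Iio j, a k k' +
      (N - (j + 1)) * ∑ k ∈ Finset.Iio l, a k j + (N - (l + 1)) * ∑ k ∈ Finset.Iio j, a l k +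
      (N - (l + 1)) * (N - (j + 1)) * a l j = M)
    (h2 : ∀ j, 3 * ∑ k ∈ Finset.Iio j, ∑ k' ∈ Finset.Iio j, a k k' +
      6 * (N - (j + 1)) * ∑ k ∈ Finset.Iio j, a k j +
      (N - (j + 1)) * (N - (j + 1) + 2) * a j j = 3 * M) (j l : Fin p) :
    a j l = M / (N ^ 2 - 1) * (1 + 2 * (if j = l then 1 else 0)) := by
  have hidx : ∀ j : Fin p, ((j : ℕ) : ℝ) + 1 ≤ p := fun j => by
    have : (j : ℕ) + 1 ≤ p := j.2
    exact_mod_cast this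
  have hpos : ∀ j : Fin p, 0 < N - ((j : ℝ) + 1) := fun j => by linarith [hidx j]
  set A := M / (N ^ 2 - 1) with hA
  have hM : M = A * (N ^ 2 - 1) := by
    have hj0 : (0 : ℝ) ≤ (j : ℕ) := by positivity
    have : N ^ 2 - 1 ≠ 0 := by nlinarith [hidx j]
    rw [hA]; field_simp
  suffices H : ∀ j : Fin p, ∀ l ≤ j, a l j = A * (1 + 2 * (if l = j then 1 else 0)) by
    rcases le_total j l with h | h
    · exact H l j h
    · rw [hsymm, H j l h]
      simp only [eq_comm]
  intro j
  induction j using WellFoundedLT.induction with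
  | ind j ih =>
    have hknown : ∀ k < j, ∀ k' < j, a k k' = A * (1 + 2 * (if k = k' then 1 else 0)) := by
      intro k hk k' hk'
      rcases le_total k k' with h | h
      · exact ih k' hk' k h
      · rw [hsymm, ih k hk k' h]
        simp only [eq_comm]
    have hblock : ∀ l ≤ j, ∑ k ∈ Finset.Iio l, ∑ k' ∈ Finset.Iio j, a k k' =
        A * (l * (j + 2)) := by
      intro l hl
      rw [Finset.sum_congr rfl fun k hk => Finset.sum_congr rfl fun k' hk' =>
        hknown k (lt_of_lt_of_le (Finset.mem_Iio.1 hk) hl) k' (Finset.mem_Iio.1 hk'),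
        sum_diag_const (Finset.Iio_subset_Iio hl)]
      simp
    have hoff : ∀ l, l < j → a l j = A := by
      intro l
      induction l using WellFoundedLT.induction with
      | ind l ihl =>
        intro hl
        have e := h1 l j hl
        have hs : ∑ k ∈ Finset.Iio l, a k j = l * A := by
          rw [Finset.sum_congr rfl fun k hk =>
            ihl k (Finset.mem_Iio.1 hk) ((Finset.mem_Iio.1 hk).trans hl)]
          simp
        have hs2 : ∑ k ∈ Finset.Iio j, a l k = A * (j + 2) := by
          have := sum_diag_const (s := {l}) (t := Finset.Iio j) (by simpa using hl) A
          rw [Finset.sum_singleton] at this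
          rw [Finset.sum_congr rfl fun k hk => hknown l hl k (Finset.mem_Iio.1 hk), this]
          simp
        rw [hblock l hl.le, hs, hs2, hM] at e
        apply mul_left_cancel₀ (mul_pos (hpos l) (hpos j)).ne'
        linear_combination e
    intro l hl
    rcases hl.lt_or_eq with h | h
    · rw [hoff l h, if_neg h.ne]; ring
    · subst h
      have e := h2 l
      have hs : ∑ k ∈ Finset.Iio l, a k l = l * A := by
        rw [Finset.sum_congr rfl fun k hk => hoff k (Finset.mem_Iio.1 hk)]
        simp
      rw [hblock l le_rfl, hs, hM] at e
      rw [if_pos rfl]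
      have hp2 : 0 < N - ((l : ℝ) + 1) + 2 := by linarith [hpos l]
      apply mul_left_cancel₀ (mul_pos (hpos l) hp2).ne'
      linear_combination e

end Algebra

/-! ### The projected score for `LT(p)` -/

section LowerTriangularMoments

variable {n p : ℕ}

lemma norm_sq_standardized (hn : 0 < n) (X : Sample n p) (i : Fin n) :
    ‖standardized X i‖ ^ 2 = n * ∑ j, stdSq X i j := by
  have : (n : ℝ) ≠ 0 := by positivity
  rw [EuclideanSpace.real_norm_sq_eq, Finset.mul_sum]
  refine Finset.sum_congr rfl fun j _ => ?_
  rw [stdSq]; field_simp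

lemma kurtosisStat_eq (hn : 0 < n) (X : Sample n p) :
    kurtosisStat X = n ^ 2 * ∑ i, (∑ j, stdSq X i j) ^ 2 := by
  rw [kurtosisStat, Finset.mul_sum]
  refine Finset.sum_congr rfl fun i _ => ?_
  rw [← mul_pow, ← norm_sq_standardized hn]
  ring

lemma triangularStat_eq (hn : 0 < n) (X : Sample n p) :
    triangularStat X = n ^ 2 * ∑ i, triangularForm n (stdSq X i) := by
  have hn' : (n : ℝ) ≠ 0 := by positivity
  have hz : ∀ i j, standardized X i j ^ 2 = n * stdSq X i j := by
    intro i j; rw [stdSq]; field_simp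
  have h1 : ∀ i, ‖standardized X i‖ ^ 4 = n ^ 2 * (∑ j, stdSq X i j) ^ 2 := by
    intro i
    rw [← mul_pow, ← norm_sq_standardized hn]
    ring
  have h2 : ∀ (w : Fin p → Fin p → ℝ) i, ∑ j, ∑ k, w j k * standardized X i j ^ 2 *
      standardized X i k ^ 2 = n ^ 2 * ∑ j, ∑ k, w j k * (stdSq X i j * stdSq X i k) := by
    intro w i
    rw [Finset.mul_sum]
    refine Finset.sum_congr rfl fun j _ => ?_
    rw [Finset.mul_sum]
    refine Finset.sum_congr rfl fun k _ => ?_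
    rw [hz, hz]; ring
  have h3 : ∀ i, ∑ j : Fin p, ((j : ℝ) + 1) * standardized X i j ^ 2 =
      n * ∑ j : Fin p, ((j : ℝ) + 1) * stdSq X i j := by
    intro i
    rw [Finset.mul_sum]
    refine Finset.sum_congr rfl fun j _ => ?_
    rw [hz]; ring
  rw [triangularStat]
  simp_rw [h1, h2 (fun j k => max ((j : ℝ) + 1) ((k : ℝ) + 1)),
    h2 (fun j k => min ((j : ℝ) + 1) ((k : ℝ) + 1)), h3]
  simp only [triangularForm, mul_pow, Finset.sum_add_distrib, Finset.sum_sub_distrib,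
    ← Finset.mul_sum]
  ring

/-- The trace of the matrix of the residual degrees of freedom. -/
noncomputable def traceConst (n p : ℕ) : ℝ := ∑ k : Fin p, ((n : ℝ) + p - 2 * (k + 1))

lemma sum_moment2 (X : Sample n p) (i : Fin n) :
    ∑ j, moment2 X i j = p / n + ∑ k : Fin p, ((n : ℝ) + p - 2 * (k + 1)) * stdSq X i k := by
  rw [← sum_partial_sums]
  simp only [moment2, leverage, resDim, add_assoc]
  rw [Finset.sum_add_distrib]
  simp
  ring

lemma sum_sum_moments (X : Sample n p) (i : Fin n) :
    ∑ j, ∑ l, (if j = l then moment4 X i j else moment2 X i j * moment2 X i l) =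
      ((p : ℝ) ^ 2 + 2 * p) / n ^ 2 +
      (2 * p + 4) / n * ∑ k : Fin p, ((n : ℝ) + p - 2 * (k + 1)) * stdSq X i k +
      triangularForm n (stdSq X i) := by
  rw [sum_sum_ite, sum_moment2, triangularForm_eq, ← sum_partial_sums_sq]
  -- The excess `moment4 - moment2²` is `2 (leverage² + 2 · leverage · resDim · stdSq + resDim ·
  -- stdSq²)`. Splitting `1/n` off `leverage` leaves the linear and quadratic partial-sum
  -- expressions already evaluated.
  have : ∀ j, moment4 X i j - moment2 X i j ^ 2 = 2 / (n : ℝ) ^ 2 +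
      4 / n * (∑ k ∈ Finset.Iio j, stdSq X i k + (n - (j + 1)) * stdSq X i j) +
      2 * ((∑ k ∈ Finset.Iio j, stdSq X i k) ^ 2 +
      2 * (∑ k ∈ Finset.Iio j, stdSq X i k) * ((n - (j + 1)) * stdSq X i j) +
      (n - (j + 1)) * stdSq X i j ^ 2) := by
    intro j
    rw [moment4, moment2, leverage, resDim]
    ring
  simp_rw [this]
  rw [Finset.sum_add_distrib, Finset.sum_add_distrib, ← Finset.mul_sum, ← Finset.mul_sum,
    sum_partial_sums]
  simp
  ring

lemma sum_weighted_stdSq (hn : 0 < n) {X : Sample n p}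
    (hX : LinearIndependent ℝ (centerRows (toRows X))) (w : Fin p → ℝ) :
    ∑ i, ∑ k, w k * stdSq X i k = ∑ k, w k := by
  rw [Finset.sum_comm]
  refine Finset.sum_congr rfl fun k _ => ?_
  have := sum_stdSq_ofRows hn hX k
  rw [ofRows_toRows] at this
  rw [← Finset.mul_sum, this, mul_one]

lemma norm_pow_four_eq (x : Vec p) : ‖x‖ ^ 4 = ∑ j, ∑ l, x j ^ 2 * x l ^ 2 := by
  rw [← Finset.sum_mul_sum, ← EuclideanSpace.real_norm_sq_eq]
  ring

/-- Replace all second and fourth order monomials by their conditional moments and sum. Since `∑_i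
stdSq X i k = 1` on regular samples, the linear terms become constants: `‖x‖²` contributes no
statistic at all, and `‖x‖⁴` only the triangular one. -/
lemma integral_norm_pow_of_lt_invariant (hpn : p < n) {φ : Sample n p → ℝ} (hφ : IsTest φ)
    (hinv : IsInvariant (ltSet p) φ) :
    (Integrable (fun X => φ X * ∑ i, ‖X i‖ ^ 2) (stdLaw n p) ∧
      ∫ X, φ X * ∑ i, ‖X i‖ ^ 2 ∂stdLaw n p = (p + traceConst n p) * ∫ X, φ X ∂stdLaw n p) ∧
    (Integrable (fun X => φ X * ∑ i, ‖X i‖ ^ 4) (stdLaw n p) ∧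
      ∫ X, φ X * ∑ i, ‖X i‖ ^ 4 ∂stdLaw n p =
        ∫ X, φ X * ((((p : ℝ) ^ 2 + 2 * p) / n + (2 * p + 4) / n * traceConst n p) +
          (n ^ 2 : ℝ)⁻¹ * triangularStat X) ∂stdLaw n p) := by
  have hn : 0 < n := by omega
  have hn' : (n : ℝ) ≠ 0 := by positivity
  have H := integral_stdLaw_mul hpn hφ hinv
  have hm2 := measurable_moment2 (n := n) (p := p) hn
  have hm4 := measurable_moment4 (n := n) (p := p) hn
  have hφm := hφ.measurable
  have hbd : ∀ {G : Sample n p → ℝ}, Measurable G → (∀ X, 0 ≤ G X) → ∀ C, (∀ X, G X ≤ C) →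
      Integrable (fun X => φ X * G X) (stdLaw n p) := by
    intro G hG hG0 C hC
    refine integrable_of_bounded (hφm.mul hG) (C := C) fun X => ?_
    rw [abs_of_nonneg (mul_nonneg (hφ.nonneg X) (hG0 X))]
    calc φ X * G X ≤ 1 * G X := by gcongr; exacts [hG0 X, hφ.le_one X]
      _ ≤ C := by rw [one_mul]; exact hC X
  constructor
  · have e : ∀ X : Sample n p, φ X * ∑ i, ‖X i‖ ^ 2 = ∑ i, ∑ j, φ X * X i j ^ 2 := by
      intro X
      simp_rw [EuclideanSpace.real_norm_sq_eq, Finset.mul_sum]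
    simp_rw [e]
    have hint : ∀ i ∈ Finset.univ, Integrable (fun X : Sample n p => ∑ j, φ X * X i j ^ 2)
      (stdLaw n p) := fun i _ => integrable_finsetSum _ fun j _ => (H i j j).1.1
    refine ⟨integrable_finsetSum _ hint, ?_⟩
    rw [integral_finsetSum _ hint, ← integral_const_mul]
    have e2 : ∀ i, ∫ X, ∑ j, φ X * X i j ^ 2 ∂stdLaw n p =
        ∫ X, ∑ j, φ X * moment2 X i j ∂stdLaw n p := by
      intro i
      rw [integral_finsetSum _ fun j _ => (H i j j).1.1, integral_finsetSum _ fun j _ =>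
        hbd (hm2 i j) (fun X => moment2_nonneg hpn X i j) _ fun X => moment2_le hpn X i j]
      exact Finset.sum_congr rfl fun j _ => (H i j j).1.2
    simp_rw [e2]
    rw [← integral_finsetSum _ fun i _ => integrable_finsetSum _ fun j _ =>
        hbd (hm2 i j) (fun X => moment2_nonneg hpn X i j) _ fun X => moment2_le hpn X i j]
    refine integral_congr_ae ?_
    filter_upwards [ae_regular hpn] with X hX
    simp_rw [← Finset.mul_sum, sum_moment2]
    rw [Finset.sum_add_distrib, sum_weighted_stdSq hn hX, traceConst]
    simp
    field_simp
  · have e : ∀ X : Sample n p, φ X * ∑ i, ‖X i‖ ^ 4 =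
        ∑ i, ∑ j, ∑ l, φ X * (X i j ^ 2 * X i l ^ 2) := by
      intro X
      simp_rw [norm_pow_four_eq, Finset.mul_sum]
    have hH : ∀ i (j l : Fin p), Integrable (fun X => φ X * (X i j ^ 2 * X i l ^ 2)) (stdLaw n p) ∧
        ∫ X, φ X * (X i j ^ 2 * X i l ^ 2) ∂stdLaw n p = ∫ X, φ X *
          (if j = l then moment4 X i j else moment2 X i j * moment2 X i l) ∂stdLaw n p := by
      intro i j l
      by_cases h : j = l
      · subst h
        simp only [if_true, ← pow_add]
        exact (H i j j).2.1
      · simp only [if_neg h]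
        exact (H i j l).2.2 h
    have hG : ∀ i (j l : Fin p), Integrable (fun X => φ X *
          (if j = l then moment4 X i j else moment2 X i j * moment2 X i l)) (stdLaw n p) := by
      intro i j l
      split_ifs
      · exact hbd (hm4 i j) (fun X => moment4_nonneg hpn X i j) _ fun X => moment4_le hpn X i j
      · refine hbd ((hm2 i j).mul (hm2 i l)) (fun X => mul_nonneg (moment2_nonneg hpn X i j)
          (moment2_nonneg hpn X i l)) ((2 * n) * (2 * n)) fun X => ?_
        have := moment2_nonneg hpn X i j
        have := moment2_nonneg hpn X i l
        have := moment2_le hpn X i j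
        have := moment2_le hpn X i l
        gcongr
    simp_rw [e]
    have hint : ∀ i ∈ Finset.univ, Integrable (fun X : Sample n p =>
      ∑ j, ∑ l, φ X * (X i j ^ 2 * X i l ^ 2)) (stdLaw n p) := fun i _ =>
      integrable_finsetSum _ fun j _ => integrable_finsetSum _ fun l _ => (hH i j l).1
    refine ⟨integrable_finsetSum _ hint, ?_⟩
    rw [integral_finsetSum _ hint]
    have e2 : ∀ i, ∫ X, ∑ j, ∑ l, φ X * (X i j ^ 2 * X i l ^ 2) ∂stdLaw n p =
        ∫ X, ∑ j, ∑ l, φ X * (if j = l then moment4 X i j else moment2 X i j * moment2 X i l)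
          ∂stdLaw n p := by
      intro i
      rw [integral_finsetSum _ fun j _ => integrable_finsetSum _ fun l _ => (hH i j l).1,
        integral_finsetSum _ fun j _ => integrable_finsetSum _ fun l _ => hG i j l]
      refine Finset.sum_congr rfl fun j _ => ?_
      rw [integral_finsetSum _ fun l _ => (hH i j l).1, integral_finsetSum _ fun l _ => hG i j l]
      exact Finset.sum_congr rfl fun l _ => (hH i j l).2
    simp_rw [e2]
    rw [← integral_finsetSum _ fun i _ => integrable_finsetSum _ fun j _ =>
      integrable_finsetSum _ fun l _ => hG i j l]
    refine integral_congr_ae ?_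
    filter_upwards [ae_regular hpn] with X hX
    simp_rw [← Finset.mul_sum, sum_sum_moments]
    rw [Finset.sum_add_distrib, Finset.sum_add_distrib, ← Finset.mul_sum,
      sum_weighted_stdSq hn hX, ← traceConst, triangularStat_eq hn]
    simp only [Finset.sum_const, Finset.card_univ, Fintype.card_fin, nsmul_eq_mul]
    field_simp

end LowerTriangularMoments

/-! ### Rotational symmetry -/

section Orthogonal

variable {n p : ℕ}

lemma measurePreserving_isometry (R : Vec p ≃ₗᵢ[ℝ] Vec p) :
    MeasurePreserving (fun (X : Sample n p) i => R (X i)) (stdLaw n p) (stdLaw n p) :=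
  measurePreserving_pi (f := fun _ => R) _ _ fun _ => ⟨R.continuous.measurable, stdGaussian_map R⟩

lemma exists_matrix_of_isometry (R : Vec p ≃ₗᵢ[ℝ] Vec p) :
    ∃ O ∈ glSet p, ∀ x, act O x = R x := by
  let O := Matrix.toEuclideanLin.symm (R.toLinearEquiv : Vec p →ₗ[ℝ] Vec p)
  have hO : ∀ x, act O x = R x := by
    intro x
    have : Matrix.toEuclideanLin O x = R x := by
      simp only [O, LinearEquiv.apply_symm_apply]; rfl
    rw [← this]; rfl
  refine ⟨O, ?_, hO⟩
  intro hdet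
  obtain ⟨v, hv, hv0⟩ := Matrix.exists_mulVec_eq_zero_iff.2 hdet
  have h1 := hO (WithLp.toLp 2 v)
  have h2 : act O (WithLp.toLp 2 v) = 0 := by rw [act, hv0]; rfl
  rw [h2] at h1
  have h3 : (WithLp.toLp 2 v : Vec p) = 0 := by
    rw [← R.map_eq_zero_iff]; exact h1.symm
  exact hv (by simpa using h3)

lemma exists_isometry_of_matrix {O : Matrix (Fin p) (Fin p) ℝ} (hO : O * O.transpose = 1) :
    ∃ R : Vec p ≃ₗᵢ[ℝ] Vec p, ∀ x, R x = act O x := by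
  have hO' : O.transpose * O = 1 := mul_eq_one_comm.1 hO
  let L : Vec p →ₗᵢ[ℝ] Vec p :=
    { toLinearMap := Matrix.toEuclideanLin O
      norm_map' := fun x => by
        have h : ‖act O x‖ ^ 2 = ‖x‖ ^ 2 := by
          rw [norm_sq_act, hO', Matrix.one_mulVec, EuclideanSpace.real_norm_sq_eq, dotProduct]
          exact Finset.sum_congr rfl fun i _ => (sq _).symm
        exact (pow_left_inj₀ (norm_nonneg _) (norm_nonneg _) two_ne_zero).1 h }
  exact ⟨L.toLinearIsometryEquiv rfl, fun x => rfl⟩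

/-- A rotation of all observations preserves both the normal law and a `GL(p)`-invariant `φ`. -/
lemma integral_comp_isometry {φ : Sample n p → ℝ} (hinv : IsInvariant (glSet p) φ)
    (R : Vec p ≃ₗᵢ[ℝ] Vec p) (F : Sample n p → ℝ) :
    ∫ X, φ X * F (fun i => R (X i)) ∂stdLaw n p = ∫ X, φ X * F X ∂stdLaw n p := by
  obtain ⟨O, hO, h⟩ := exists_matrix_of_isometry R
  have he : MeasurableEmbedding (fun (X : Sample n p) i => R (X i)) :=
    (MeasurableEquiv.piCongrRight fun _ : Fin n => R.toMeasurableEquiv).measurableEmbedding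
  rw [← (measurePreserving_isometry R).integral_comp he fun X => φ X * F X]
  refine integral_congr_ae (ae_of_all _ fun X => ?_)
  simp only
  have : φ (fun i => R (X i)) = φ X := by
    rw [← hinv 0 O hO X]
    simp only [zero_add, h]
  rw [this]

lemma reflection_apply_coord (w x : Vec p) (k : Fin p) :
    ((ℝ ∙ w)ᗮ.reflection x) k = x k - 2 * (inner ℝ w x / ‖w‖ ^ 2) * w k := by
  rw [Submodule.reflection_orthogonal_apply, Submodule.reflection_singleton_apply]
  simp
  ring

lemma exists_isometry_swap {j l : Fin p} (hjl : j ≠ l) :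
    ∃ R : Vec p ≃ₗᵢ[ℝ] Vec p, ∀ x, R x j = x l := by
  -- Reflection in the hyperplane orthogonal to `e_j - e_l` exchanges the two coordinates.
  set w : Vec p := EuclideanSpace.single j 1 - EuclideanSpace.single l 1 with hw
  refine ⟨(ℝ ∙ w)ᗮ.reflection, fun x => ?_⟩
  have h1 : ∀ y, inner ℝ w y = y j - y l := fun y => by
    rw [hw, inner_sub_left, EuclideanSpace.inner_single_left, EuclideanSpace.inner_single_left]
    simp
  have hwj : w j = 1 := by simp [hw, hjl]
  have hwl : w l = -1 := by simp [hw, hjl.symm]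
  rw [reflection_apply_coord, ← real_inner_self_eq_norm_sq, h1, h1, hwj, hwl]
  ring

lemma exists_isometry_mul {j l : Fin p} (hjl : j ≠ l) :
    ∃ R : Vec p ≃ₗᵢ[ℝ] Vec p, ∀ x, R x j * R x l = (x j ^ 2 - x l ^ 2) / 2 := by
  obtain ⟨s, hs0, hs⟩ : ∃ s : ℝ, 1 - s ≠ 0 ∧ s ^ 2 = 1 / 2 := by
    refine ⟨√(1 / 2), ?_, Real.sq_sqrt (by norm_num)⟩
    intro h
    have h1 : √(1 / 2 : ℝ) = 1 := by linarith
    have h2 := Real.sq_sqrt (show (0 : ℝ) ≤ 1 / 2 by norm_num)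
    rw [h1] at h2
    norm_num at h2
  -- With `s = 1/√2`, this reflection sends `(x_j, x_l)` to `s (x_j + x_l, x_j - x_l)`; its mirror
  -- direction is `e_j` minus the image of `e_j`.
  set w : Vec p := (1 - s) • EuclideanSpace.single j 1 - s • EuclideanSpace.single l 1 with hw
  refine ⟨(ℝ ∙ w)ᗮ.reflection, fun x => ?_⟩
  have h1 : ∀ y, inner ℝ w y = (1 - s) * y j - s * y l := fun y => by
    rw [hw, inner_sub_left, inner_smul_left, inner_smul_left, EuclideanSpace.inner_single_left,
      EuclideanSpace.inner_single_left]
    simp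
  have hwj : w j = 1 - s := by simp [hw, hjl]
  have hwl : w l = -s := by simp [hw, hjl.symm]
  have hn : ‖w‖ ^ 2 = 2 * (1 - s) := by
    rw [← real_inner_self_eq_norm_sq, h1, hwj, hwl]
    linear_combination 2 * hs
  have hj : x j - 2 * (inner ℝ w x / ‖w‖ ^ 2) * w j = s * (x j + x l) := by
    rw [hn, h1, hwj]; field_simp; ring
  have hl : x l - 2 * (inner ℝ w x / ‖w‖ ^ 2) * w l = s * (x j - x l) := by
    rw [hn, h1, hwl]; field_simp
    linear_combination (-2 * x l) * hs
  rw [reflection_apply_coord, reflection_apply_coord, hj, hl]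
  linear_combination (x j ^ 2 - x l ^ 2) * hs

end Orthogonal

/-! ### The projected score for `GL(p)` -/

section GeneralLinear

variable {n p : ℕ}

lemma invariant_lt_of_gl {φ : Sample n p → ℝ} (h : IsInvariant (glSet p) φ) :
    IsInvariant (ltSet p) φ := fun a L hL X => h a L (ltSet_subset_glSet hL) X

/-- The `LT(p)` formulas express the moments of the entries through `β_k = ∫ φ b_k` and `a_{kl} = ∫
φ b_k b_l` with `b = stdSq X i`. Rotational symmetry makes the moments of the entries independent of
the coordinates, which yields triangular systems with a constant `β` and `a_{kl}` proportional to `1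
+ 2δ_{kl}`. Both sides are then multiples of `p² + 2p`. -/
lemma integral_mul_sum_stdSq (hpn : p < n) (hp : 0 < p) {φ : Sample n p → ℝ} (hφ : IsTest φ)
    (hinv : IsInvariant (glSet p) φ) (i : Fin n) :
    ∫ X, φ X * ‖X i‖ ^ 4 ∂stdLaw n p =
      ((n : ℝ) ^ 2 - 1) * ∫ X, φ X * (∑ k, stdSq X i k) ^ 2 ∂stdLaw n p +
      ((p : ℝ) ^ 2 + 2 * p) * ((∫ X, φ X ∂stdLaw n p) / n ^ 2 +
        2 * ((n : ℝ) - 1) / n * ∫ X, φ X * stdSq X i ⟨0, hp⟩ ∂stdLaw n p) := by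
  have hn : 0 < n := by omega
  have hn' : (n : ℝ) ≠ 0 := by positivity
  have hpn' : (p : ℝ) < n := by exact_mod_cast hpn
  have hp1 : (1 : ℝ) ≤ p := by exact_mod_cast hp
  have H := fun j l => integral_stdLaw_mul hpn hφ (invariant_lt_of_gl hinv) i j l
  have hφm := hφ.measurable
  set T : Finset (Fin p) → Sample n p → ℝ := fun s X => ∑ k ∈ s, stdSq X i k with hT
  have hTm : ∀ s, Measurable (T s) := fun s => Finset.measurable_sum _ fun k _ =>
    measurable_stdSq hn i k
  have hT0 : ∀ s X, 0 ≤ T s X := fun s X => Finset.sum_nonneg fun k _ => stdSq_nonneg X i k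
  have hTp : ∀ s X, T s X ≤ p := fun s X => by
    calc T s X ≤ ∑ k ∈ s, (1 : ℝ) := Finset.sum_le_sum fun k _ => stdSq_le_one hn X i k
      _ ≤ ∑ k : Fin p, (1 : ℝ) := Finset.sum_le_sum_of_subset_of_nonneg (Finset.subset_univ _)
          fun _ _ _ => zero_le_one
      _ = p := by simp
  have hbd : ∀ {G : Sample n p → ℝ}, Measurable G → (∀ X, 0 ≤ G X) → ∀ C, (∀ X, G X ≤ C) →
      Integrable (fun X => φ X * G X) (stdLaw n p) := by
    intro G hG hG0 C hC
    refine integrable_of_bounded (hφm.mul hG) (C := C) fun X => ?_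
    rw [abs_of_nonneg (mul_nonneg (hφ.nonneg X) (hG0 X))]
    calc φ X * G X ≤ 1 * G X := by gcongr; exacts [hG0 X, hφ.le_one X]
      _ ≤ C := by rw [one_mul]; exact hC X
  have hI1 : Integrable (fun X => φ X * (fun _ => (1 : ℝ)) X) (stdLaw n p) :=
    hbd measurable_const (fun _ => zero_le_one) 1 fun _ => le_rfl
  have hIT : ∀ s, Integrable (fun X => φ X * T s X) (stdLaw n p) := fun s =>
    hbd (hTm s) (hT0 s) p (hTp s)
  have hITT : ∀ s t, Integrable (fun X => φ X * (T s X * T t X)) (stdLaw n p) := fun s t =>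
    hbd ((hTm s).mul (hTm t)) (fun X => mul_nonneg (hT0 s X) (hT0 t X)) (p * p) fun X => by
      have := hT0 s X; have := hT0 t X; have := hTp s X; have := hTp t X
      gcongr
  set e := ∫ X, φ X ∂stdLaw n p with he
  set β : Fin p → ℝ := fun k => ∫ X, φ X * stdSq X i k ∂stdLaw n p with hβ
  set a : Fin p → Fin p → ℝ := fun k l => ∫ X, φ X * (stdSq X i k * stdSq X i l) ∂stdLaw n p with ha
  have hT1 : ∀ k X, T {k} X = stdSq X i k := fun k X => by simp [hT]
  have hET : ∀ s, ∫ X, φ X * T s X ∂stdLaw n p = ∑ k ∈ s, β k := by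
    intro s
    simp only [hT, Finset.mul_sum]
    rw [integral_finsetSum]
    intro k _
    simpa only [hT1] using hIT {k}
  have hETT : ∀ s t, ∫ X, φ X * (T s X * T t X) ∂stdLaw n p = ∑ k ∈ s, ∑ l ∈ t, a k l := by
    intro s t
    have hkl : ∀ k l, Integrable (fun X => φ X * (stdSq X i k * stdSq X i l)) (stdLaw n p) :=
      fun k l => by simpa only [hT1] using hITT {k} {l}
    have e1 : ∀ X, φ X * (T s X * T t X) =
        ∑ k ∈ s, ∑ l ∈ t, φ X * (stdSq X i k * stdSq X i l) := fun X => by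
      simp_rw [hT, Finset.sum_mul_sum, Finset.mul_sum]
    simp_rw [e1]
    rw [integral_finsetSum _ fun k _ => integrable_finsetSum _ fun l _ => hkl k l]
    exact Finset.sum_congr rfl fun k _ => integral_finsetSum _ fun l _ => hkl k l
  have hlin : ∀ (m : ℕ) (c : Fin m → ℝ) (F : Fin m → Sample n p → ℝ),
      (∀ r, Integrable (fun X => φ X * F r X) (stdLaw n p)) →
      ∫ X, φ X * ∑ r, c r * F r X ∂stdLaw n p = ∑ r, c r * ∫ X, φ X * F r X ∂stdLaw n p := by
    intro m c F hF
    simp_rw [Finset.mul_sum, mul_left_comm (φ _)]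
    rw [integral_finsetSum _ fun r _ => (hF r).const_mul _]
    simp_rw [integral_const_mul]
  have hE2 : ∀ j, ∫ X, φ X * moment2 X i j ∂stdLaw n p =
      e / n + (∑ k ∈ Finset.Iio j, β k + resDim n j * β j) := by
    intro j
    have h := hlin 3 ![(n : ℝ)⁻¹, 1, resDim n j] ![fun _ => 1, T (Finset.Iio j), T {j}] (by
      intro r; fin_cases r
      · exact hI1
      · exact hIT _
      · exact hIT {j})
    simp only [Fin.sum_univ_three, Matrix.cons_val_zero, Matrix.cons_val_one, Matrix.cons_val,
      hET, mul_one, Finset.sum_singleton] at h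
    rw [← he] at h
    have e1 : ∀ X, moment2 X i j = (n : ℝ)⁻¹ + 1 * T (Finset.Iio j) X + resDim n j * T {j} X := by
      intro X; rw [hT1, moment2, leverage, one_mul]
    simp_rw [e1]
    rw [h]
    ring
  have hE22 : ∀ l j, ∫ X, φ X * (moment2 X i l * moment2 X i j) ∂stdLaw n p =
      e / n ^ 2 + ((∑ k ∈ Finset.Iio l, β k + resDim n l * β l) +
        (∑ k ∈ Finset.Iio j, β k + resDim n j * β j)) / n +
      (∑ k ∈ Finset.Iio l, ∑ k' ∈ Finset.Iio j, a k k' +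
      resDim n j * ∑ k ∈ Finset.Iio l, a k j + resDim n l * ∑ k ∈ Finset.Iio j, a l k +
      resDim n l * resDim n j * a l j) := by
    intro l j
    have h := hlin 9 ![((n : ℝ) ^ 2)⁻¹, (n : ℝ)⁻¹, (n : ℝ)⁻¹ * resDim n l, (n : ℝ)⁻¹,
        (n : ℝ)⁻¹ * resDim n j, 1, resDim n j, resDim n l, resDim n l * resDim n j]
      ![fun _ => 1, T (Finset.Iio l), T {l}, T (Finset.Iio j), T {j},
        fun X => T (Finset.Iio l) X * T (Finset.Iio j) X, fun X => T (Finset.Iio l) X * T {j} X,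
        fun X => T {l} X * T (Finset.Iio j) X, fun X => T {l} X * T {j} X] (by
      intro r; fin_cases r
      · exact hI1
      · exact hIT _
      · exact hIT {l}
      · exact hIT (Finset.Iio j)
      · exact hIT {j}
      · exact hITT (Finset.Iio l) (Finset.Iio j)
      · exact hITT (Finset.Iio l) {j}
      · exact hITT {l} (Finset.Iio j)
      · exact hITT {l} {j})
    simp only [Fin.sum_univ_succ, Fin.sum_univ_zero, Matrix.cons_val_zero, Matrix.cons_val_succ,
      hET, hETT, mul_one, Finset.sum_singleton, add_zero] at h
    rw [← he] at h
    have e1 : ∀ X, moment2 X i l * moment2 X i j = ((n : ℝ) ^ 2)⁻¹ + ((n : ℝ)⁻¹ * T (Finset.Iio l) X +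
        ((n : ℝ)⁻¹ * resDim n l * T {l} X + ((n : ℝ)⁻¹ * T (Finset.Iio j) X +
        ((n : ℝ)⁻¹ * resDim n j * T {j} X + (1 * (T (Finset.Iio l) X * T (Finset.Iio j) X) +
        (resDim n j * (T (Finset.Iio l) X * T {j} X) + (resDim n l * (T {l} X * T (Finset.Iio j) X) +
        resDim n l * resDim n j * (T {l} X * T {j} X)))))))) := fun X => by
      rw [moment2, moment2, leverage, leverage, ← hT1 l X, ← hT1 j X]
      simp only [hT]
      ring
    simp_rw [e1]
    rw [h]
    ring
  have hE4 : ∀ j, ∫ X, φ X * moment4 X i j ∂stdLaw n p =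
      3 * e / n ^ 2 + 6 * (∑ k ∈ Finset.Iio j, β k + resDim n j * β j) / n +
      (3 * ∑ k ∈ Finset.Iio j, ∑ k' ∈ Finset.Iio j, a k k' +
      6 * resDim n j * ∑ k ∈ Finset.Iio j, a k j + resDim n j * (resDim n j + 2) * a j j) := by
    intro j
    have h := hlin 6 ![3 * ((n : ℝ) ^ 2)⁻¹, 6 * (n : ℝ)⁻¹, 6 * (n : ℝ)⁻¹ * resDim n j, 3,
        6 * resDim n j, resDim n j * (resDim n j + 2)]
      ![fun _ => 1, T (Finset.Iio j), T {j},
        fun X => T (Finset.Iio j) X * T (Finset.Iio j) X, fun X => T (Finset.Iio j) X * T {j} X,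
        fun X => T {j} X * T {j} X] (by
      intro r; fin_cases r
      · exact hI1
      · exact hIT _
      · exact hIT {j}
      · exact hITT (Finset.Iio j) (Finset.Iio j)
      · exact hITT (Finset.Iio j) {j}
      · exact hITT {j} {j})
    simp only [Fin.sum_univ_succ, Fin.sum_univ_zero, Matrix.cons_val_zero, Matrix.cons_val_succ,
      hET, hETT, mul_one, Finset.sum_singleton, add_zero] at h
    rw [← he] at h
    have e1 : ∀ X, moment4 X i j = 3 * ((n : ℝ) ^ 2)⁻¹ + (6 * (n : ℝ)⁻¹ * T (Finset.Iio j) X +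
        (6 * (n : ℝ)⁻¹ * resDim n j * T {j} X + (3 * (T (Finset.Iio j) X * T (Finset.Iio j) X) +
        (6 * resDim n j * (T (Finset.Iio j) X * T {j} X) +
        resDim n j * (resDim n j + 2) * (T {j} X * T {j} X))))) := fun X => by
      rw [moment4, leverage, ← hT1 j X]
      simp only [hT]
      ring
    simp_rw [e1]
    rw [h]
    ring
  -- consequences of the rotational symmetry
  set j₀ : Fin p := ⟨0, hp⟩ with hj₀
  have hswap : ∀ (m : ℕ) (j l : Fin p), ∫ X, φ X * X i j ^ m ∂stdLaw n p =
      ∫ X, φ X * X i l ^ m ∂stdLaw n p := by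
    intro m j l
    by_cases hjl : j = l
    · rw [hjl]
    obtain ⟨R, hR⟩ := exists_isometry_swap hjl
    rw [← integral_comp_isometry hinv R (fun X => X i j ^ m)]
    simp only [hR]
  -- Normalized so that the mixed moment of two coordinates is `κ`. Writing `m` for that moment, the
  -- 45 degree reflection gives `m = (3κ + 3κ)/4 - m/2`.
  set κ := (∫ X, φ X * X i j₀ ^ 4 ∂stdLaw n p) / 3 with hκ
  have h4 : ∀ j, ∫ X, φ X * X i j ^ 4 ∂stdLaw n p = 3 * κ := fun j => by
    rw [hswap 4 j j₀, hκ]; ring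
  have h22 : ∀ j l, j ≠ l → ∫ X, φ X * (X i j ^ 2 * X i l ^ 2) ∂stdLaw n p = κ := by
    intro j l hjl
    obtain ⟨R, hR⟩ := exists_isometry_mul hjl
    have h1 := integral_comp_isometry hinv R (fun X => X i j ^ 2 * X i l ^ 2)
    have h2 : ∀ X : Sample n p, φ X * (R (X i) j ^ 2 * R (X i) l ^ 2) =
        (1 / 4) * (φ X * X i j ^ 4) + (1 / 4) * (φ X * X i l ^ 4) -
          (1 / 2) * (φ X * (X i j ^ 2 * X i l ^ 2)) := by
      intro X
      rw [← mul_pow, hR]; ring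
    simp only [h2] at h1
    rw [integral_sub, integral_add, integral_const_mul, integral_const_mul, integral_const_mul,
      h4, h4] at h1
    · linarith
    · exact (H j j).2.1.1.const_mul _
    · exact (H l l).2.1.1.const_mul _
    · exact ((H j j).2.1.1.const_mul _).add ((H l l).2.1.1.const_mul _)
    · exact ((H j l).2.2 hjl).1.const_mul _
  have hβeq : ∀ j, β j = (∫ X, φ X * X i j₀ ^ 2 ∂stdLaw n p - e / n) / (n - 1) := by
    apply eq_div_of_partial_sums hpn'
    intro j
    have h1 := hswap 2 j j₀
    rw [(H j j).1.2, hE2] at h1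
    rw [← h1, resDim]; ring
  have hβ0 : ∀ j, β j = β j₀ := fun j => by rw [hβeq, ← hβeq j₀]
  have hsum : ∀ j, ∑ k ∈ Finset.Iio j, β k + resDim n j * β j = (n - 1) * β j₀ := by
    intro j
    rw [Finset.sum_congr rfl fun k _ => hβ0 k, hβ0 j, resDim]
    simp
    ring
  -- What remains of the mixed moment after the contributions of degree zero and one in `stdSq`; in
  -- the pure fourth moment each of them is three times as large.
  set M := κ - e / n ^ 2 - 2 * ((n : ℝ) - 1) / n * β j₀ with hM
  have haM := eq_of_quartic_partial_sums (N := n) (M := M) hpn' (a := a)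
    (fun j l => by simp only [ha, mul_comm])
    (by
      intro l j hlj
      have h1 := h22 l j hlj.ne
      rw [((H l j).2.2 hlj.ne).2, hE22, hsum, hsum] at h1
      simp only [resDim] at h1
      rw [hM, ← h1]; ring)
    (by
      intro j
      have h1 := h4 j
      rw [(H j j).2.1.2, hE4, hsum] at h1
      simp only [resDim] at h1
      rw [hM]
      linear_combination h1)
  have hfull : ∫ X, φ X * (∑ k, stdSq X i k) ^ 2 ∂stdLaw n p =
      M / ((n : ℝ) ^ 2 - 1) * (p ^ 2 + 2 * p) := by
    have h1 := hETT Finset.univ Finset.univ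
    simp only [hT, haM] at h1
    rw [sum_diag_const (Finset.subset_univ _)] at h1
    simp only [← sq] at h1
    rw [h1]
    simp only [Finset.card_univ, Fintype.card_fin]
    ring
  have hnorm : ∫ X, φ X * ‖X i‖ ^ 4 ∂stdLaw n p = (p ^ 2 + 2 * p) * κ := by
    have e1 : ∀ X : Sample n p, φ X * ‖X i‖ ^ 4 = ∑ j, ∑ l, φ X * (X i j ^ 2 * X i l ^ 2) := by
      intro X
      simp_rw [norm_pow_four_eq, Finset.mul_sum]
    have hH : ∀ (j l : Fin p), Integrable (fun X => φ X * (X i j ^ 2 * X i l ^ 2)) (stdLaw n p) ∧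
        ∫ X, φ X * (X i j ^ 2 * X i l ^ 2) ∂stdLaw n p =
          κ * (1 + 2 * (if j = l then 1 else 0)) := by
      intro j l
      by_cases h : j = l
      · subst h
        simp only [if_true, ← pow_add]
        exact ⟨(H j j).2.1.1, (h4 j).trans (by ring)⟩
      · simp only [if_neg h]
        exact ⟨((H j l).2.2 h).1, (h22 j l h).trans (by ring)⟩
    simp_rw [e1]
    rw [integral_finsetSum _ fun j _ => integrable_finsetSum _ fun l _ => (hH j l).1]
    rw [Finset.sum_congr rfl fun j _ => integral_finsetSum _ fun l _ => (hH j l).1]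
    simp only [(hH _ _).2]
    rw [sum_diag_const (Finset.subset_univ _)]
    simp only [Finset.card_univ, Fintype.card_fin]
    ring
  have hn2 : (n : ℝ) ^ 2 - 1 ≠ 0 := by nlinarith
  rw [hnorm, hfull, hM]
  field_simp
  ring

lemma integral_norm_pow_four_of_gl_invariant (hpn : p < n) (hp : 0 < p) {φ : Sample n p → ℝ}
    (hφ : IsTest φ) (hinv : IsInvariant (glSet p) φ) :
    ∫ X, φ X * ∑ i, ‖X i‖ ^ 4 ∂stdLaw n p =
      ∫ X, φ X * ((((p : ℝ) ^ 2 + 2 * p) * (2 * n - 1) / n) +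
        ((n : ℝ) ^ 2 - 1) / n ^ 2 * kurtosisStat X) ∂stdLaw n p := by
  have hn : 0 < n := by omega
  have hn' : (n : ℝ) ≠ 0 := by positivity
  have hφm := hφ.measurable
  have hbd : ∀ {G : Sample n p → ℝ}, Measurable G → (∀ X, 0 ≤ G X) → ∀ C, (∀ X, G X ≤ C) →
      Integrable (fun X => φ X * G X) (stdLaw n p) := by
    intro G hG hG0 C hC
    refine integrable_of_bounded (hφm.mul hG) (C := C) fun X => ?_
    rw [abs_of_nonneg (mul_nonneg (hφ.nonneg X) (hG0 X))]
    calc φ X * G X ≤ 1 * G X := by gcongr; exacts [hG0 X, hφ.le_one X]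
      _ ≤ C := by rw [one_mul]; exact hC X
  have hI1 : Integrable φ (stdLaw n p) := by
    have := hbd (G := fun _ => (1 : ℝ)) measurable_const (fun _ => zero_le_one) 1 fun _ => le_rfl
    simpa using this
  have hIc : ∀ i (k : Fin p), Integrable (fun X => φ X * stdSq X i k) (stdLaw n p) := fun i k =>
    hbd (measurable_stdSq hn i k) (fun X => stdSq_nonneg X i k) 1 fun X => stdSq_le_one hn X i k
  have hIS : ∀ i, Integrable (fun X => φ X * (∑ k : Fin p, stdSq X i k) ^ 2) (stdLaw n p) := by
    intro i
    refine hbd ((Finset.measurable_sum _ fun k _ => measurable_stdSq hn i k).pow_const 2)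
      (fun X => by positivity) ((p : ℝ) ^ 2) fun X => ?_
    have h0 : 0 ≤ ∑ k : Fin p, stdSq X i k := Finset.sum_nonneg fun k _ => stdSq_nonneg X i k
    have h1 : ∑ k : Fin p, stdSq X i k ≤ ∑ k : Fin p, 1 :=
      Finset.sum_le_sum fun k _ => stdSq_le_one hn X i k
    simp only [Finset.sum_const, Finset.card_univ, Fintype.card_fin, nsmul_eq_mul, mul_one] at h1
    gcongr
  have hI4 : ∀ i, Integrable (fun X => φ X * ‖X i‖ ^ 4) (stdLaw n p) := by
    intro i
    simp_rw [norm_pow_four_eq, Finset.mul_sum]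
    refine integrable_finsetSum _ fun j _ => integrable_finsetSum _ fun l _ => ?_
    have H := integral_stdLaw_mul hpn hφ (invariant_lt_of_gl hinv) i j l
    by_cases h : j = l
    · subst h
      simp only [← pow_add]
      exact H.2.1.1
    · exact (H.2.2 h).1
  -- The linear term is constant only after summation over the observations.
  have hβ : ∑ i, ∫ X, φ X * stdSq X i ⟨0, hp⟩ ∂stdLaw n p = ∫ X, φ X ∂stdLaw n p := by
    rw [← integral_finsetSum _ fun i _ => hIc i _]
    refine integral_congr_ae ?_
    filter_upwards [ae_regular hpn] with X hX
    have := sum_stdSq_ofRows hn hX ⟨0, hp⟩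
    rw [ofRows_toRows] at this
    rw [← Finset.mul_sum, this, mul_one]
  have hlhs : ∫ X, φ X * ∑ i, ‖X i‖ ^ 4 ∂stdLaw n p =
      ∑ i, ∫ X, φ X * ‖X i‖ ^ 4 ∂stdLaw n p := by
    simp_rw [Finset.mul_sum]
    exact integral_finsetSum _ fun i _ => hI4 i
  have hkurt : ∀ X : Sample n p, φ X * kurtosisStat X =
      n ^ 2 * ∑ i, φ X * (∑ k, stdSq X i k) ^ 2 := by
    intro X
    rw [kurtosisStat_eq hn, ← Finset.mul_sum]; ring
  have hrhs : ∫ X, φ X * ((((p : ℝ) ^ 2 + 2 * p) * (2 * n - 1) / n) +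
        ((n : ℝ) ^ 2 - 1) / n ^ 2 * kurtosisStat X) ∂stdLaw n p =
      (((p : ℝ) ^ 2 + 2 * p) * (2 * n - 1) / n) * ∫ X, φ X ∂stdLaw n p +
      ((n : ℝ) ^ 2 - 1) * ∑ i, ∫ X, φ X * (∑ k, stdSq X i k) ^ 2 ∂stdLaw n p := by
    have e1 : ∀ X : Sample n p, φ X * ((((p : ℝ) ^ 2 + 2 * p) * (2 * n - 1) / n) +
        ((n : ℝ) ^ 2 - 1) / n ^ 2 * kurtosisStat X) =
        (((p : ℝ) ^ 2 + 2 * p) * (2 * n - 1) / n) * φ X +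
        ((n : ℝ) ^ 2 - 1) * ∑ i, φ X * (∑ k, stdSq X i k) ^ 2 := by
      intro X
      rw [mul_add, mul_left_comm (φ X), hkurt]
      field_simp
    simp_rw [e1]
    rw [integral_add (hI1.const_mul _) ((integrable_finsetSum _ fun i _ => hIS i).const_mul _),
      integral_const_mul, integral_const_mul, integral_finsetSum _ fun i _ => hIS i]
  rw [hlhs, hrhs, Finset.sum_congr rfl fun i _ => integral_mul_sum_stdSq hpn hp hφ hinv i,
    Finset.sum_add_distrib, ← Finset.mul_sum, ← Finset.mul_sum, Finset.sum_add_distrib,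
    ← Finset.mul_sum, hβ]
  simp only [Finset.sum_const, Finset.card_univ, Fintype.card_fin, nsmul_eq_mul]
  field_simp
  ring

end GeneralLinear

/-! ### Densities of product measures -/

section ProductDensity

variable {ι α : Type*} [Fintype ι] [MeasurableSpace α]

lemma lintegral_pi_prod (ν : Measure α) [IsProbabilityMeasure ν] {g : ι → α → ENNReal}
    (hg : ∀ i, Measurable (g i)) :
    ∫⁻ x, ∏ i, g i (x i) ∂Measure.pi (fun _ : ι => ν) = ∏ i, ∫⁻ y, g i y ∂ν := by
  have h := lintegral_prod_eq_prod_lintegral_of_indepFun (μ := Measure.pi fun _ : ι => ν)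
    Finset.univ (fun i x => g i (x i)) (iIndepFun_pi fun i => (hg i).aemeasurable)
    (fun i => (hg i).comp (measurable_pi_apply i))
  rw [h]
  refine Finset.prod_congr rfl fun i _ => ?_
  exact (measurePreserving_eval (fun _ : ι => ν) i).lintegral_comp (hg i)

lemma pi_withDensity_eq (ν : Measure α) [IsProbabilityMeasure ν] {g : α → ENNReal}
    (hg : Measurable g) [SigmaFinite (ν.withDensity g)] :
    Measure.pi (fun _ : ι => ν.withDensity g) =
      (Measure.pi fun _ : ι => ν).withDensity fun x => ∏ i, g (x i) := by
  refine Measure.pi_eq fun s hs => ?_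
  rw [withDensity_apply _ (MeasurableSet.univ_pi hs),
    ← lintegral_indicator (MeasurableSet.univ_pi hs)]
  have e : (Set.univ.pi s).indicator (fun x : ι → α => ∏ i, g (x i)) =
      fun x => ∏ i, (s i).indicator g (x i) := by
    funext x
    by_cases hx : x ∈ Set.univ.pi s
    · rw [Set.indicator_of_mem hx]
      exact Finset.prod_congr rfl fun i _ => (Set.indicator_of_mem (hx i trivial) g).symm
    · rw [Set.indicator_of_notMem hx]
      simp only [Set.mem_univ_pi, not_forall] at hx
      obtain ⟨i, hi⟩ := hx
      exact (Finset.prod_eq_zero (Finset.mem_univ i) (Set.indicator_of_notMem hi g)).symm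
  rw [e, lintegral_pi_prod ν fun i => hg.indicator (hs i)]
  exact Finset.prod_congr rfl fun i _ => by
    rw [lintegral_indicator (hs i), withDensity_apply _ (hs i)]

end ProductDensity

/-! ### Shifted moment bounds from the envelope condition -/

section Envelope

variable {n p : ℕ} {f : Vec p → ℝ → ℝ}

lemma IsShapeFamily.zero_eq_stdDensity (hf : IsShapeFamily f) (x : Vec p) :
    f x 0 = stdDensity (Vec p) x := by
  rw [hf.normal, stdDensity, finrank_euclideanSpace, Fintype.card_fin]

lemma IsShapeFamily.zero_pos (hf : IsShapeFamily f) (x : Vec p) : 0 < f x 0 := by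
  rw [hf.zero_eq_stdDensity]; exact stdDensity_pos x

lemma IsShapeFamily.hasDerivWithinAt (hf : IsShapeFamily f) (x : Vec p) {θ : ℝ} (hθ : 0 ≤ θ) :
    HasDerivWithinAt (f x) (dtheta f x θ) (Set.Ici 0) θ :=
  ((hf.contDiffOn x).differentiableOn one_ne_zero θ hθ).hasDerivWithinAt

lemma IsShapeFamily.continuousOn_dtheta (hf : IsShapeFamily f) (x : Vec p) :
    ContinuousOn (dtheta f x) (Set.Ici 0) :=
  (hf.contDiffOn x).continuousOn_derivWithin (uniqueDiffOn_Ici 0) le_rfl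

/-- A pointwise limit of difference quotients with steps to the right, which stay in the half-line
even at `θ = 0`. -/
lemma IsShapeFamily.measurable_dtheta (hf : IsShapeFamily f) {θ : ℝ} (hθ : 0 ≤ θ) :
    Measurable fun x => dtheta f x θ := by
  have hlim : Filter.Tendsto (fun m : ℕ => θ + 1 / ((m : ℝ) + 1)) Filter.atTop
      (nhdsWithin θ (Set.Ici 0 \ {θ})) := by
    refine tendsto_nhdsWithin_iff.2 ⟨?_, Filter.Eventually.of_forall fun m => ?_⟩
    · simpa using tendsto_one_div_add_atTop_nhds_zero_nat.const_add θ
    · have : (0 : ℝ) < 1 / ((m : ℝ) + 1) := by positivity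
      exact ⟨Set.mem_Ici.2 (by linarith), by simp only [Set.mem_singleton_iff]; linarith⟩
  refine measurable_of_tendsto_metrizable
    (f := fun (m : ℕ) x => slope (f x) θ (θ + 1 / ((m : ℝ) + 1))) (fun m => ?_) ?_
  · have h0 : (0 : ℝ) ≤ θ + 1 / ((m : ℝ) + 1) := by positivity
    simp only [slope_def_field]
    exact ((hf.measurable _ h0).sub (hf.measurable _ hθ)).div_const _
  · rw [tendsto_pi_nhds]
    intro x
    exact (hasDerivWithinAt_iff_tendsto_slope.1 (hf.hasDerivWithinAt x hθ)).comp hlim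

/-- The supremum of `|∂f(x; θ)/∂θ| / f(x; 0)` over the rational `θ` in `(0, ε)`. -/
noncomputable def scoreBound (f : Vec p → ℝ → ℝ) (ε : ℝ) (x : Vec p) : ENNReal :=
  ⨆ q : ℚ, ⨆ _ : (q : ℝ) ∈ Set.Ioo 0 ε, ENNReal.ofReal (|dtheta f x q| / f x 0)

lemma measurable_scoreBound (hf : IsShapeFamily f) (ε : ℝ) : Measurable (scoreBound f ε) := by
  refine Measurable.iSup fun q => ?_
  by_cases hq : (q : ℝ) ∈ Set.Ioo 0 ε
  · simp only [hq, iSup_pos]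
    exact ENNReal.measurable_ofReal.comp
      (((hf.measurable_dtheta hq.1.le).abs).div (hf.measurable 0 le_rfl))
  · simp only [hq, not_false_eq_true, iSup_neg]
    exact measurable_const

/-- Rational parameters make `scoreBound` measurable; continuity of the derivative in `θ` and
density of the rationals recover all of `[0, ε]`, endpoints included. -/
lemma le_scoreBound (hf : IsShapeFamily f) {ε : ℝ} (hε : 0 < ε) (x : Vec p) {θ : ℝ}
    (hθ : θ ∈ Set.Icc 0 ε) : ENNReal.ofReal (|dtheta f x θ| / f x 0) ≤ scoreBound f ε x := by
  set s : Set ℝ := Set.Ioo 0 ε ∩ Set.range ((↑) : ℚ → ℝ) with hs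
  have hcl : θ ∈ closure s := by
    have h := Rat.isDenseEmbedding_coe_real.dense.open_subset_closure_inter (isOpen_Ioo (a := 0) (b := ε))
    have h2 := closure_minimal h isClosed_closure
    rw [closure_Ioo hε.ne] at h2
    exact h2 hθ
  have hc : ContinuousWithinAt (fun θ => ENNReal.ofReal (|dtheta f x θ| / f x 0)) s θ := by
    have h1 : ContinuousWithinAt (dtheta f x) s θ :=
      ((hf.continuousOn_dtheta x) θ hθ.1).mono fun t ht => ht.1.1.le
    exact ENNReal.continuous_ofReal.continuousAt.comp_continuousWithinAt (h1.abs.div_const _)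
  refine hc.closure_le hcl continuousWithinAt_const ?_
  rintro _ ⟨hq, q, rfl⟩
  exact le_iSup₂_of_le q hq le_rfl

lemma scoreBound_le_envelope (ε : ℝ) (a : Vec p) {B : Matrix (Fin p) (Fin p) ℝ} {z : Vec p}
    (hz : ‖z‖ ≤ 1) : scoreBound f ε (a + act B z) ≤ envelope f ε a B := by
  refine iSup₂_le fun q hq => ?_
  refine le_iSup₂_of_le z (by simpa using hz) ?_
  exact le_iSup₂_of_le (q : ℝ) ⟨hq.1.le, hq.2.le⟩ le_rfl

/-- At `B = 2I` the vector `B⁻¹ v` has norm at most `1/2`, so by continuity `v` is `B z` with `z` in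
the unit ball for all `B` in an open set of positive measure. -/
lemma eventually_norm_inv_act_lt {v : Vec p} (hv : ‖v‖ ≤ 1) :
    ∀ᶠ b : Fin p → Fin p → ℝ in nhds ((2 : ℝ) • (1 : Matrix (Fin p) (Fin p) ℝ)),
      (Matrix.of b).det ≠ 0 ∧ ‖act (Matrix.of b)⁻¹ v‖ < 1 := by
  set D : Matrix (Fin p) (Fin p) ℝ := (2 : ℝ) • (1 : Matrix (Fin p) (Fin p) ℝ) with hD
  have hdet : D.det ≠ 0 := by simp [hD]
  have hcd : Continuous fun b : Fin p → Fin p → ℝ => (Matrix.of b).det :=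
    Continuous.matrix_det continuous_id
  have hca : Continuous fun b : Fin p → Fin p → ℝ => (Matrix.of b).adjugate :=
    Continuous.matrix_adjugate continuous_id
  have hci : ContinuousAt (fun b : Fin p → Fin p → ℝ => act (Matrix.of b)⁻¹ v) D := by
    simp only [Matrix.inv_def, Ring.inverse_eq_inv', act]
    refine (PiLp.continuous_toLp 2 _).continuousAt.comp ?_
    have h1 : ContinuousAt (fun b : Fin p → Fin p → ℝ =>
        ((Matrix.of b).det)⁻¹ • (Matrix.of b).adjugate) D :=
      (hcd.continuousAt.inv₀ hdet).smul hca.continuousAt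
    exact (Continuous.matrix_mulVec continuous_id continuous_const).continuousAt.comp h1
  have hval : act (Matrix.of D)⁻¹ v = (1 / 2 : ℝ) • v := by
    have : act D ((1 / 2 : ℝ) • v) = v := by
      ext i
      simp [hD, act, Matrix.smul_mulVec]
    conv_lhs => rw [← this]
    exact act_inv_act hdet _
  refine (hcd.continuousAt.eventually_ne hdet).and ?_
  refine hci.norm.eventually_lt continuousAt_const ?_
  rw [hval, norm_smul]
  norm_num
  linarith

/-- For `B` in a neighbourhood `V` of `2I` the envelope at `(a, B)` dominates `scoreBound` at `a +
v`, a quantity free of `B`. Over `V` the double integral is thus at least a product of the wanted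
integral and a positive weight, so the former is finite. -/
lemma lintegral_scoreBound_shift_lt_top (hf : IsShapeFamily f) {ε : ℝ}
    (hint : ∫⁻ b in {b : Fin p → Fin p → ℝ | (Matrix.of b).det ≠ 0}, ∫⁻ a : Vec p,
      envelope f ε a (Matrix.of b) ^ n *
        ENNReal.ofReal (Real.exp (-(n : ℝ) / 2 * ‖a‖ ^ 2
            - (n : ℝ) / 2 * ((Matrix.of b).transpose * Matrix.of b).trace)
          * |(Matrix.of b).det| ^ (n - p - 1)) < ⊤) {v : Vec p} (hv : ‖v‖ ≤ 1) :
    ∫⁻ x, scoreBound f ε x ^ n * ENNReal.ofReal (Real.exp (-(n : ℝ) / 2 * ‖x - v‖ ^ 2)) < ⊤ := by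
  obtain ⟨V, hVU, hVo, hV⟩ := mem_nhds_iff.1 (eventually_norm_inv_act_lt hv)
  have hhm := measurable_scoreBound hf ε
  set K := ∫⁻ x, scoreBound f ε x ^ n * ENNReal.ofReal (Real.exp (-(n : ℝ) / 2 * ‖x - v‖ ^ 2))
    with hK
  have hKa : K = ∫⁻ a, scoreBound f ε (a + v) ^ n *
      ENNReal.ofReal (Real.exp (-(n : ℝ) / 2 * ‖a‖ ^ 2)) := by
    rw [hK, ← lintegral_add_right_eq_self _ v]
    simp
  set W : (Fin p → Fin p → ℝ) → ENNReal := fun b => ENNReal.ofReal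
    (Real.exp (-((n : ℝ) / 2 * ((Matrix.of b).transpose * Matrix.of b).trace)) *
      |(Matrix.of b).det| ^ (n - p - 1)) with hW
  have hcd : Continuous fun b : Fin p → Fin p → ℝ => (Matrix.of b).det :=
    Continuous.matrix_det continuous_id
  have hct : Continuous fun b : Fin p → Fin p → ℝ =>
      ((Matrix.of b).transpose * Matrix.of b).trace :=
    Continuous.matrix_trace ((Continuous.matrix_transpose continuous_id).matrix_mul continuous_id)
  have hWm : Measurable W := by
    have : Continuous fun b : Fin p → Fin p → ℝ =>
        Real.exp (-((n : ℝ) / 2 * ((Matrix.of b).transpose * Matrix.of b).trace)) *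
          |(Matrix.of b).det| ^ (n - p - 1) :=
      (Real.continuous_exp.comp (hct.const_mul _).neg).mul (hcd.abs.pow _)
    exact ENNReal.measurable_ofReal.comp this.measurable
  have hle : K * ∫⁻ b in V, W b < ⊤ := by
    refine lt_of_le_of_lt ?_ hint
    rw [← lintegral_const_mul _ hWm]
    refine le_trans ?_ (lintegral_mono_set fun b hb => (hVU hb).1)
    refine setLIntegral_mono' hVo.measurableSet fun b hb => ?_
    obtain ⟨hb0, hb1⟩ := hVU hb
    have hm : Measurable fun a => scoreBound f ε (a + v) ^ n *
        ENNReal.ofReal (Real.exp (-(n : ℝ) / 2 * ‖a‖ ^ 2)) := by fun_prop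
    rw [hKa, ← lintegral_mul_const _ hm]
    refine lintegral_mono fun a => ?_
    have h1 := scoreBound_le_envelope (f := f) ε a (B := Matrix.of b) hb1.le
    rw [act_act_inv hb0] at h1
    rw [mul_assoc, hW, ← ENNReal.ofReal_mul (Real.exp_pos _).le, ← mul_assoc (Real.exp _),
      ← Real.exp_add, ← sub_eq_add_neg]
    gcongr
  have hWpos : ∫⁻ b in V, W b ≠ 0 := by
    refine (pos_iff_ne_zero.1 ((setLIntegral_pos_iff hWm).2 ?_))
    have : Function.support W ∩ V = V := by
      refine Set.inter_eq_right.2 fun b hb => ?_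
      have hb0 := (hVU hb).1
      rw [Function.mem_support, hW]
      have : 0 < |(Matrix.of b).det| := abs_pos.2 hb0
      simp only [ne_eq, ENNReal.ofReal_eq_zero, not_le]
      positivity
    rw [this]
    exact hVo.measure_pos _ ⟨_, hV⟩
  by_contra hK'
  rw [not_lt, top_le_iff] at hK'
  rw [hK', ENNReal.top_mul hWpos] at hle
  exact lt_irrefl _ hle

end Envelope

/-! ### A Gaussian first moment from shifted moments -/

section ShiftedMoments

variable {n p : ℕ}

lemma integrable_exp_neg_mul_norm {c : ℝ} (hc : 0 < c) :
    Integrable fun x : Vec p => Real.exp (-(c * ‖x‖)) := by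
  have h := integrable_one_add_norm (E := Vec p) (μ := volume) (r := ((p + 1 : ℕ) : ℝ))
    (by simp)
  refine (h.const_mul (Real.exp c * (p + 1).factorial / c ^ (p + 1))).mono' (by fun_prop)
    (ae_of_all _ fun x => ?_)
  have h0 : 0 < 1 + ‖x‖ := by positivity
  have h1 := Real.pow_div_factorial_le_exp (x := c * (1 + ‖x‖)) (by positivity) (p + 1)
  rw [Real.norm_of_nonneg (Real.exp_pos _).le, Real.rpow_neg h0.le, Real.rpow_natCast]
  have h2 : Real.exp (-(c * ‖x‖)) = Real.exp c * (Real.exp (c * (1 + ‖x‖)))⁻¹ := by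
    rw [← Real.exp_neg, ← Real.exp_add]; ring_nf
  have h3 : (Real.exp (c * (1 + ‖x‖)))⁻¹ ≤ ((c * (1 + ‖x‖)) ^ (p + 1) / (p + 1).factorial)⁻¹ :=
    inv_anti₀ (by positivity) h1
  rw [h2]
  calc Real.exp c * (Real.exp (c * (1 + ‖x‖)))⁻¹
      ≤ Real.exp c * ((c * (1 + ‖x‖)) ^ (p + 1) / (p + 1).factorial)⁻¹ := by gcongr
    _ = _ := by rw [mul_pow]; field_simp

/-- Take the coordinate of largest modulus, with its sign. -/
lemma exists_coord_vector (hp : 0 < p) (x : Vec p) :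
    ∃ j : Fin p, ∃ s : Bool, (p : ℝ)⁻¹ * ‖x‖ ≤
      inner ℝ x ((if s then (1 : ℝ) else -1) • EuclideanSpace.single j (1 : ℝ)) := by
  have : Nonempty (Fin p) := ⟨⟨0, hp⟩⟩
  obtain ⟨j, hj⟩ := Finite.exists_max fun j => |x j|
  have hp1 : (1 : ℝ) ≤ p := by exact_mod_cast hp
  have h1 : ‖x‖ ^ 2 ≤ (p * |x j|) ^ 2 := by
    rw [EuclideanSpace.real_norm_sq_eq]
    calc ∑ i, x i ^ 2 ≤ ∑ _i : Fin p, |x j| ^ 2 := Finset.sum_le_sum fun i _ => by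
          rw [← sq_abs (x i)]; exact pow_le_pow_left₀ (abs_nonneg _) (hj i) 2
      _ = p * |x j| ^ 2 := by simp
      _ ≤ _ := by rw [mul_pow]; gcongr; nlinarith
  have h2 : ‖x‖ ≤ p * |x j| := (pow_le_pow_iff_left₀ (norm_nonneg _) (by positivity) two_ne_zero).1 h1
  have h3 : (p : ℝ)⁻¹ * ‖x‖ ≤ |x j| := by
    rw [inv_mul_le_iff₀ (by positivity)]; exact h2
  rcases le_total 0 (x j) with h | h
  · refine ⟨j, true, ?_⟩
    rw [abs_of_nonneg h] at h3
    simpa [inner_smul_right, EuclideanSpace.inner_single_right] using h3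
  · refine ⟨j, false, ?_⟩
    rw [abs_of_nonpos h] at h3
    simpa [inner_smul_right, EuclideanSpace.inner_single_right] using h3

lemma mul_le_pow_add (hn : 0 < n) (u : ENNReal) {t : ENNReal} (ht : t ≤ 1) : u * t ≤ u ^ n + t := by
  rcases le_total u 1 with h | h
  · calc u * t ≤ 1 * t := by gcongr
      _ ≤ _ := by rw [one_mul]; exact le_add_self
  · calc u * t ≤ u * 1 := by gcongr
      _ = u ^ 1 := by rw [mul_one, pow_one]
      _ ≤ u ^ n := pow_le_pow_right₀ h hn
      _ ≤ _ := le_self_add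

/-- For a unit vector `v`, `exp(-‖x‖²/2) = e^{1/2} exp(-‖x - v‖²/2) exp(-⟪x, v⟫)`. Choosing `v`
among the signed unit vectors with `⟪x, v⟫ ≥ ‖x‖/p` makes the last factor integrable. The bound `u t
≤ u^n + t` for `t ≤ 1` separates it from `u = h exp(-‖x - v‖²/2)`, whose `n`-th power is the shifted
integrand. -/
lemma lintegral_stdGaussian_lt_top_of_shifted (hp : 0 < p) (hn : 0 < n) {h : Vec p → ENNReal}
    (hm : Measurable h)
    (hK : ∀ v : Vec p, ‖v‖ ≤ 1 →
      ∫⁻ x, h x ^ n * ENNReal.ofReal (Real.exp (-(n : ℝ) / 2 * ‖x - v‖ ^ 2)) < ⊤) :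
    ∫⁻ x, h x ∂stdGaussian (Vec p) < ⊤ := by
  set c : ℝ := (p : ℝ)⁻¹ with hc
  have hc0 : 0 < c := by positivity
  set V : Fin p × Bool → Vec p := fun js =>
    (if js.2 then (1 : ℝ) else -1) • EuclideanSpace.single js.1 (1 : ℝ) with hV
  have hV1 : ∀ js, ‖V js‖ = 1 := by
    rintro ⟨j, s⟩
    cases s <;> simp [hV]
  set w : Fin p × Bool → Vec p → ENNReal := fun js x =>
    h x ^ n * ENNReal.ofReal (Real.exp (-(n : ℝ) / 2 * ‖x - V js‖ ^ 2)) with hw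
  have hwm : ∀ js, Measurable (w js) := fun js => by fun_prop
  have hpt : ∀ x, h x * ENNReal.ofReal (Real.exp (-‖x‖ ^ 2 / 2)) ≤
      ENNReal.ofReal (Real.exp (1 / 2)) *
        (∑ js, w js x + ENNReal.ofReal (Real.exp (-(c * ‖x‖)))) := by
    intro x
    obtain ⟨j, s, hjs⟩ := exists_coord_vector hp x
    set v := V (j, s) with hv
    have hjs : c * ‖x‖ ≤ inner ℝ x v := hjs
    have hnv : ‖x - v‖ ^ 2 = ‖x‖ ^ 2 - 2 * inner ℝ x v + 1 := by
      rw [norm_sub_sq_real, hV1]; ring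
    have e1 : Real.exp (-‖x‖ ^ 2 / 2) = Real.exp (1 / 2) *
        (Real.exp (-‖x - v‖ ^ 2 / 2) * Real.exp (-inner ℝ x v)) := by
      rw [← Real.exp_add, ← Real.exp_add, hnv]; ring_nf
    have e2 : w (j, s) x = (h x * ENNReal.ofReal (Real.exp (-‖x - v‖ ^ 2 / 2))) ^ n := by
      rw [mul_pow, ← ENNReal.ofReal_pow (Real.exp_pos _).le, ← Real.exp_nat_mul, hw]
      simp only [← hv]
      congr 3
      ring
    rw [e1, ENNReal.ofReal_mul (Real.exp_pos _).le, ENNReal.ofReal_mul (Real.exp_pos _).le,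
      mul_left_comm, ← mul_assoc (h x)]
    gcongr
    have ht : Real.exp (-inner ℝ x v) ≤ 1 := by
      rw [Real.exp_le_one_iff]
      have : 0 ≤ c * ‖x‖ := by positivity
      linarith
    refine (mul_le_pow_add hn _ (ENNReal.ofReal_le_one.2 ht)).trans ?_
    rw [← e2]
    gcongr
    exact Finset.single_le_sum (f := fun js => w js x) (fun _ _ => zero_le) (Finset.mem_univ (j, s))
  have hmain : ∫⁻ x, h x * ENNReal.ofReal (Real.exp (-‖x‖ ^ 2 / 2)) < ⊤ := by
    refine (lintegral_mono hpt).trans_lt ?_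
    rw [lintegral_const_mul _ (by fun_prop), lintegral_add_right _ (by fun_prop),
      lintegral_finsetSum _ fun js _ => hwm js]
    refine ENNReal.mul_lt_top ENNReal.ofReal_lt_top (ENNReal.add_lt_top.2 ⟨?_, ?_⟩)
    · exact ENNReal.sum_lt_top.2 fun js _ => hK _ (hV1 js).le
    · exact (integrable_exp_neg_mul_norm hc0).lintegral_lt_top
  rw [lintegral_stdGaussian hm]
  have e : ∀ x : Vec p, ENNReal.ofReal (stdDensity (Vec p) x) * h x =
      ENNReal.ofReal ((2 * Real.pi) ^ (-(Module.finrank ℝ (Vec p) : ℝ) / 2)) *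
        (h x * ENNReal.ofReal (Real.exp (-‖x‖ ^ 2 / 2))) := by
    intro x
    rw [stdDensity, ENNReal.ofReal_mul (by positivity)]
    ring
  simp_rw [e]
  rw [lintegral_const_mul _ (by fun_prop)]
  exact ENNReal.mul_lt_top ENNReal.ofReal_lt_top hmain

end ShiftedMoments

/-! ### Likelihood ratios against the standard normal sample -/

section Likelihood

variable {n p : ℕ} {f : Vec p → ℝ → ℝ}

/-- The likelihood ratio of a sample from `f(·; θ)` to a standard normal sample. -/
noncomputable def likRatio (f : Vec p → ℝ → ℝ) (θ : ℝ) (X : Sample n p) : ℝ :=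
  ∏ i, f (X i) θ / f (X i) 0

lemma IsShapeFamily.isProbabilityMeasure (hf : IsShapeFamily f) {θ : ℝ} (hθ : 0 ≤ θ) :
    IsProbabilityMeasure (volume.withDensity fun x => ENNReal.ofReal (f x θ)) :=
  ⟨by rw [withDensity_apply _ MeasurableSet.univ, setLIntegral_univ, hf.lintegral_eq_one θ hθ]⟩

lemma withDensity_eq_stdGaussian (hf : IsShapeFamily f) {θ : ℝ} (hθ : 0 ≤ θ) :
    (volume.withDensity fun x => ENNReal.ofReal (f x θ)) =
      (stdGaussian (Vec p)).withDensity fun x => ENNReal.ofReal (f x θ / f x 0) := by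
  have hm := hf.measurable θ hθ
  have hm0 := hf.measurable 0 le_rfl
  rw [stdGaussian_eq_withDensity, ← withDensity_mul _
    (by have := continuous_stdDensity (E := Vec p); fun_prop) (by fun_prop)]
  congr 1
  funext x
  rw [Pi.mul_apply, ← hf.zero_eq_stdDensity, ← ENNReal.ofReal_mul (hf.zero_pos x).le,
    mul_div_cancel₀ _ (hf.zero_pos x).ne']

lemma measurable_likRatio (hf : IsShapeFamily f) {θ : ℝ} (hθ : 0 ≤ θ) :
    Measurable (likRatio (n := n) f θ) := by
  refine Finset.measurable_prod _ fun i _ => ?_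
  exact ((hf.measurable θ hθ).comp (measurable_pi_apply i)).div
    ((hf.measurable 0 le_rfl).comp (measurable_pi_apply i))

lemma likRatio_nonneg (hf : IsShapeFamily f) {θ : ℝ} (hθ : 0 ≤ θ) (X : Sample n p) :
    0 ≤ likRatio f θ X :=
  Finset.prod_nonneg fun _ _ => div_nonneg (hf.nonneg _ _ hθ) (hf.zero_pos _).le

lemma sampleLaw_std_eq (f : Vec p → ℝ → ℝ) (θ : ℝ) : sampleLaw n f 0 1 θ =
    Measure.pi fun _ => volume.withDensity fun x => ENNReal.ofReal (f x θ) := by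
  simp [sampleLaw, density, act_one]

lemma sampleLaw_std_eq_withDensity (hf : IsShapeFamily f) {θ : ℝ} (hθ : 0 ≤ θ) :
    sampleLaw n f 0 1 θ =
      (stdLaw n p).withDensity fun X => ENNReal.ofReal (likRatio f θ X) := by
  have h1 := hf.isProbabilityMeasure hθ
  rw [withDensity_eq_stdGaussian hf hθ] at h1
  have hm := hf.measurable θ hθ
  have hm0 := hf.measurable 0 le_rfl
  rw [sampleLaw_std_eq, withDensity_eq_stdGaussian hf hθ, pi_withDensity_eq _ (by fun_prop), stdLaw]
  congr 1
  funext X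
  rw [likRatio, ENNReal.ofReal_prod_of_nonneg]
  exact fun _ _ => div_nonneg (hf.nonneg _ _ hθ) (hf.zero_pos _).le

lemma likRatio_zero (hf : IsShapeFamily f) (X : Sample n p) : likRatio f 0 X = 1 :=
  Finset.prod_eq_one fun _ _ => div_self (hf.zero_pos _).ne'

lemma sampleLaw_std_zero (hf : IsShapeFamily f) : sampleLaw n f 0 1 0 = stdLaw n p := by
  rw [sampleLaw_std_eq_withDensity hf le_rfl]
  simp [likRatio_zero hf]

lemma integral_sampleLaw_std (hf : IsShapeFamily f) {θ : ℝ} (hθ : 0 ≤ θ) (φ : Sample n p → ℝ) :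
    ∫ X, φ X ∂sampleLaw n f 0 1 θ = ∫ X, likRatio f θ X * φ X ∂stdLaw n p := by
  rw [sampleLaw_std_eq_withDensity hf hθ, integral_withDensity_eq_integral_toReal_smul
    (measurable_likRatio hf hθ).ennreal_ofReal (ae_of_all _ fun _ => ENNReal.ofReal_lt_top)]
  simp only [ENNReal.toReal_ofReal (likRatio_nonneg hf hθ _), smul_eq_mul]

end Likelihood

/-! ### Differentiation under the integral at `θ = 0` -/

section Derivative

/-- Bounds the difference quotient of a product of likelihood ratios by a function free of `θ`, with
each factor `1 + h i` depending on one observation. -/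
lemma abs_prod_sub_one_le {ι : Type*} (s : Finset ι) {u h : ι → ℝ} {θ : ℝ} (hθ0 : 0 ≤ θ)
    (hθ1 : θ ≤ 1) (hh : ∀ i, 0 ≤ h i) (hu : ∀ i, |u i| ≤ θ * h i) :
    |∏ i ∈ s, (1 + u i) - 1| ≤ θ * (∏ i ∈ s, (1 + h i) - 1) := by
  classical
  induction s using Finset.induction_on with
  | empty => simp
  | insert i s hi ih =>
    rw [Finset.prod_insert hi, Finset.prod_insert hi]
    set P := ∏ i ∈ s, (1 + u i)
    set Q := ∏ i ∈ s, (1 + h i) with hQ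
    have hQ1 : 1 ≤ Q := by
      have : ∏ _i ∈ s, (1 : ℝ) ≤ Q :=
        Finset.prod_le_prod (fun _ _ => zero_le_one) fun i _ => by linarith [hh i]
      simpa using this
    have h1 : |1 + u i| ≤ 1 + h i := by
      refine (abs_add_le _ _).trans ?_
      rw [abs_one]
      nlinarith [hu i, hh i]
    calc |(1 + u i) * P - 1| = |(P - 1) * (1 + u i) + u i| := by ring_nf
      _ ≤ |P - 1| * |1 + u i| + |u i| := (abs_add_le _ _).trans (by rw [abs_mul])
      _ ≤ θ * (Q - 1) * (1 + h i) + θ * h i := by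
        refine add_le_add (mul_le_mul ih h1 (abs_nonneg _) ?_) (hu i)
        exact mul_nonneg hθ0 (by linarith)
      _ = _ := by ring

variable {n p : ℕ} {f : Vec p → ℝ → ℝ}

lemma abs_ratio_sub_one_le (hf : IsShapeFamily f) {ε : ℝ} (hε : 0 < ε) {x : Vec p}
    (hx : scoreBound f ε x ≠ ⊤) {θ : ℝ} (hθ : θ ∈ Set.Icc 0 ε) :
    |f x θ / f x 0 - 1| ≤ θ * (scoreBound f ε x).toReal := by
  have hpos := hf.zero_pos x
  have hd : ∀ t ∈ Set.Icc 0 ε, HasDerivWithinAt (fun t => f x t / f x 0)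
      (dtheta f x t / f x 0) (Set.Icc 0 ε) t := fun t ht =>
    ((hf.hasDerivWithinAt x ht.1).mono Set.Icc_subset_Ici_self).div_const _
  have h := (convex_Icc 0 ε).norm_image_sub_le_of_norm_hasDerivWithin_le hd
    (C := (scoreBound f ε x).toReal) (fun t ht => by
      rw [Real.norm_eq_abs, abs_div, abs_of_pos hpos]
      exact (ENNReal.ofReal_le_iff_le_toReal hx).1 (le_scoreBound hf hε x ht))
    (Set.left_mem_Icc.2 hε.le) hθ
  rw [div_self hpos.ne', Real.norm_eq_abs, Real.norm_eq_abs, sub_zero, abs_of_nonneg hθ.1] at h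
  rwa [mul_comm]

lemma tendsto_likRatio_slope (hf : IsShapeFamily f) (X : Sample n p) :
    Filter.Tendsto (fun θ => θ⁻¹ * (likRatio f θ X - 1)) (nhdsWithin 0 (Set.Ioi 0))
      (nhds (∑ i, dtheta f (X i) 0 / f (X i) 0)) := by
  have hd : HasDerivWithinAt (fun θ => likRatio f θ X) (∑ i, dtheta f (X i) 0 / f (X i) 0)
      (Set.Ici 0) 0 := by
    have h := HasDerivWithinAt.fun_finsetProd (u := Finset.univ) (x := (0 : ℝ)) (s := Set.Ici 0)
      (f := fun (i : Fin n) θ => f (X i) θ / f (X i) 0)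
      (fun i _ => (hf.hasDerivWithinAt (X i) le_rfl).div_const (f (X i) 0))
    have e : ∀ i, ∏ j ∈ Finset.univ.erase i, f (X j) 0 / f (X j) 0 = 1 := fun i =>
      Finset.prod_eq_one fun j _ => div_self (hf.zero_pos _).ne'
    simp only [e, one_smul] at h
    exact h
  have h := hasDerivWithinAt_iff_tendsto_slope.1 hd
  rw [Set.Ici_sdiff_left] at h
  refine h.congr fun θ => ?_
  rw [slope_def_field, likRatio_zero hf, sub_zero, div_eq_inv_mul]

/-- Dominated convergence with bound `C (∏ (1 + H(x_i)) - 1)`. By independence of the observations,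
a finite first moment of `H` suffices for its integrability. -/
lemma tendsto_slope_integral_sampleLaw (hf : IsShapeFamily f) {ε : ℝ} (hε : 0 < ε)
    (hfin : ∫⁻ x, scoreBound f ε x ∂stdGaussian (Vec p) < ⊤) {φ : Sample n p → ℝ}
    (hφm : Measurable φ) {C : ℝ} (hC : ∀ X, |φ X| ≤ C) :
    Filter.Tendsto (fun θ => θ⁻¹ * (∫ X, φ X ∂sampleLaw n f 0 1 θ - ∫ X, φ X ∂stdLaw n p))
      (nhdsWithin 0 (Set.Ioi 0))
      (nhds (∫ X, φ X * ∑ i, dtheta f (X i) 0 / f (X i) 0 ∂stdLaw n p)) := by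
  have hhm := measurable_scoreBound hf ε
  have hIφ : Integrable φ (stdLaw n p) := integrable_of_bounded hφm hC
  set H : Vec p → ℝ := fun x => (scoreBound f ε x).toReal with hH
  have hH0 : ∀ x, 0 ≤ H x := fun x => ENNReal.toReal_nonneg
  have hHI : Integrable H (stdGaussian (Vec p)) :=
    integrable_toReal_of_lintegral_ne_top hhm.aemeasurable hfin.ne
  have hprod : Integrable (fun X : Sample n p => ∏ i, (1 + H (X i))) (stdLaw n p) :=
    Integrable.fintype_prod (f := fun _ x => 1 + H x) fun _ => (integrable_const _).add hHI
  have hae : ∀ᵐ X ∂stdLaw n p, ∀ i, scoreBound f ε (X i) ≠ ⊤ := by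
    rw [ae_all_iff]
    intro i
    exact (measurePreserving_eval (fun _ : Fin n => stdGaussian (Vec p)) i).quasiMeasurePreserving.ae
      ((ae_lt_top hhm hfin.ne).mono fun x hx => hx.ne)
  have hev : ∀ᶠ θ : ℝ in nhdsWithin 0 (Set.Ioi 0), 0 < θ ∧ θ ≤ ε ∧ θ ≤ 1 := by
    filter_upwards [self_mem_nhdsWithin, nhdsWithin_le_nhds (Iic_mem_nhds hε),
      nhdsWithin_le_nhds (Iic_mem_nhds (zero_lt_one (α := ℝ)))] with θ h1 h2 h3
    exact ⟨h1, h2, h3⟩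
  have hbound : ∀ θ : ℝ, 0 < θ → θ ≤ ε → θ ≤ 1 → ∀ᵐ X ∂stdLaw n p,
      |likRatio f θ X - 1| ≤ θ * (∏ i, (1 + H (X i)) - 1) := by
    intro θ h0 h1 h2
    filter_upwards [hae] with X hX
    have := abs_prod_sub_one_le Finset.univ (u := fun i => f (X i) θ / f (X i) 0 - 1)
      (h := fun i => H (X i)) h0.le h2 (fun i => hH0 _)
      (fun i => abs_ratio_sub_one_le hf hε (hX i) ⟨h0.le, h1⟩)
    simpa only [add_sub_cancel, likRatio] using this
  have hlim := tendsto_integral_filter_of_dominated_convergence (μ := stdLaw n p)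
    (l := nhdsWithin (0 : ℝ) (Set.Ioi 0))
    (F := fun θ X => φ X * (θ⁻¹ * (likRatio f θ X - 1)))
    (f := fun X => φ X * ∑ i, dtheta f (X i) 0 / f (X i) 0)
    (fun X => C * (∏ i, (1 + H (X i)) - 1)) ?_ ?_ ((hprod.sub (integrable_const _)).const_mul _) ?_
  · refine hlim.congr' ?_
    filter_upwards [hev] with θ hθ
    have hL : Integrable (fun X => likRatio f θ X * φ X) (stdLaw n p) := by
      have h1 : Integrable (fun X : Sample n p => likRatio f θ X - 1) (stdLaw n p) := by
        refine ((hprod.sub (integrable_const (1 : ℝ))).const_mul θ).mono'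
          ((measurable_likRatio hf hθ.1.le).sub_const 1).aestronglyMeasurable ?_
        exact (hbound θ hθ.1 hθ.2.1 hθ.2.2)
      have h2 : Integrable (fun X : Sample n p => likRatio f θ X) (stdLaw n p) := by
        have h3 := h1.add (integrable_const (1 : ℝ))
        refine h3.congr (ae_of_all _ fun X => ?_)
        simp
      exact h2.mul_bdd (c := C) hφm.aestronglyMeasurable (ae_of_all _ hC)
    rw [integral_sampleLaw_std hf hθ.1.le, ← integral_sub hL hIφ, ← integral_const_mul]
    refine integral_congr_ae (ae_of_all _ fun X => ?_)
    simp only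
    ring
  · filter_upwards [hev] with θ hθ
    exact (hφm.mul (((measurable_likRatio hf hθ.1.le).sub_const 1).const_mul _)).aestronglyMeasurable
  · filter_upwards [hev] with θ hθ
    filter_upwards [hbound θ hθ.1 hθ.2.1 hθ.2.2] with X hX
    rw [Real.norm_eq_abs, abs_mul, abs_mul, abs_inv, abs_of_pos hθ.1]
    have hC0 : 0 ≤ C := (abs_nonneg _).trans (hC X)
    refine mul_le_mul (hC X) ?_ (mul_nonneg (inv_nonneg.2 hθ.1.le) (abs_nonneg _)) hC0
    · rw [inv_mul_le_iff₀ hθ.1]; exact hX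
  · exact ae_of_all _ fun X => (tendsto_likRatio_slope hf X).const_mul _

lemma QuarticScoreCondition.exists_scoreBound_lt_top {p₀ p₁ p₂ : ℝ} (hf : IsShapeFamily f)
    (hs : QuarticScoreCondition n f p₀ p₁ p₂) (hp : 0 < p) (hn : 0 < n) :
    ∃ ε > 0, ∫⁻ x, scoreBound f ε x ∂stdGaussian (Vec p) < ⊤ := by
  obtain ⟨ε, hε, hint⟩ := hs.integrable
  exact ⟨ε, hε, lintegral_stdGaussian_lt_top_of_shifted hp hn (measurable_scoreBound hf ε)
    fun v hv => lintegral_scoreBound_shift_lt_top hf hint hv⟩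

end Derivative

/-! ### Reduction of the parameter `(a, B)` to a rotation -/

section Reduction

variable {n p : ℕ} {f : Vec p → ℝ → ℝ}

lemma map_act_volume {B : Matrix (Fin p) (Fin p) ℝ} (hB : B ∈ glSet p) :
    (volume : Measure (Vec p)).map (act B) = ENNReal.ofReal |B.det|⁻¹ • volume := by
  have hdet : LinearMap.det (Matrix.toEuclideanLin B) = B.det := by
    rw [Matrix.toEuclideanLin_eq_toLin_orthonormal, LinearMap.det_toLin]
  have h := Measure.map_linearMap_addHaar_eq_smul_addHaar (volume : Measure (Vec p))
    (f := Matrix.toEuclideanLin B) (by rw [hdet]; exact hB)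
  rw [hdet, abs_inv] at h
  exact h

lemma measurable_act (B : Matrix (Fin p) (Fin p) ℝ) : Measurable (act B) :=
  (LinearMap.continuous_of_finiteDimensional (Matrix.toEuclideanLin B)).measurable

lemma withDensity_density (hf : IsShapeFamily f) (a : Vec p) {B : Matrix (Fin p) (Fin p) ℝ}
    (hB : B ∈ glSet p) {θ : ℝ} (hθ : 0 ≤ θ) :
    (volume.withDensity fun x => ENNReal.ofReal (density f a B θ x)) =
      (volume.withDensity fun x => ENNReal.ofReal (f x θ)).map fun x => a + act B x := by
  have hm := hf.measurable θ hθ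
  have hB' := measurable_act B
  have hBi := measurable_act B⁻¹
  have hg : Measurable fun x => a + act B x := hB'.const_add a
  ext s hs
  rw [Measure.map_apply hg hs, withDensity_apply _ hs, withDensity_apply _ (hg hs),
    ← lintegral_indicator (hg hs), ← lintegral_indicator hs]
  set F : Vec p → ENNReal := s.indicator fun y => ENNReal.ofReal (f (act B⁻¹ (y - a)) θ) with hF
  have hFm : Measurable F := Measurable.indicator (by fun_prop) hs
  have e1 : ((fun x => a + act B x) ⁻¹' s).indicator (fun x => ENNReal.ofReal (f x θ)) =
      fun x => F (a + act B x) := by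
    funext x
    by_cases hx : a + act B x ∈ s
    · rw [Set.indicator_of_mem (show x ∈ _ from hx), hF, Set.indicator_of_mem hx,
        add_sub_cancel_left, act_inv_act hB]
    · rw [Set.indicator_of_notMem (show x ∉ _ from hx), hF, Set.indicator_of_notMem hx]
  have e2 : (s.indicator fun x => ENNReal.ofReal (density f a B θ x)) =
      fun x => ENNReal.ofReal |B.det|⁻¹ * F x := by
    funext x
    by_cases hx : x ∈ s
    · rw [Set.indicator_of_mem hx, hF, Set.indicator_of_mem hx, density,
        ENNReal.ofReal_mul (by positivity)]
    · rw [Set.indicator_of_notMem hx, hF, Set.indicator_of_notMem hx, mul_zero]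
  rw [e1, e2, lintegral_const_mul _ hFm, ← lintegral_map (f := fun y => F (a + y))
    (hFm.comp (measurable_const_add a)) hB', map_act_volume hB, lintegral_smul_measure,
    lintegral_add_left_eq_self F a, smul_eq_mul]

lemma sampleLaw_eq_map (hf : IsShapeFamily f) (a : Vec p) {B : Matrix (Fin p) (Fin p) ℝ}
    (hB : B ∈ glSet p) {θ : ℝ} (hθ : 0 ≤ θ) :
    sampleLaw n f a B θ = (sampleLaw n f 0 1 θ).map fun X i => a + act B (X i) := by
  have h1 := hf.isProbabilityMeasure hθ
  have hg : Measurable fun x => a + act B x := (measurable_act B).const_add a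
  have h2 : IsProbabilityMeasure
      ((volume.withDensity fun x => ENNReal.ofReal (f x θ)).map fun x => a + act B x) :=
    Measure.isProbabilityMeasure_map hg.aemeasurable
  rw [sampleLaw_std_eq, Measure.pi_map_pi (fun _ => hg.aemeasurable), sampleLaw,
    withDensity_density hf a hB hθ]

/-- Write `B = LO`: the affine part `(a, L)` is absorbed by the invariance of `φ`, leaving the
orthogonal factor `O = L⁻¹ B`. It depends on `B` only, not on the test or on `θ`. -/
lemma exists_isometry_power_eq (hf : IsShapeFamily f) (a : Vec p) {B : Matrix (Fin p) (Fin p) ℝ}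
    (hB : B ∈ glSet p) :
    ∃ R : Vec p ≃ₗᵢ[ℝ] Vec p, ∀ φ : Sample n p → ℝ, Measurable φ → IsInvariant (ltSet p) φ →
      ∀ θ, 0 ≤ θ → power f φ a B θ = ∫ X, φ (fun i => R (X i)) ∂sampleLaw n f 0 1 θ := by
  obtain ⟨L, hL, hLB⟩ := exists_ltSet_mul_transpose_eq hB
  have hLg : IsUnit L.det := isUnit_iff_ne_zero.2 (ltSet_subset_glSet hL)
  have hLt : IsUnit L.transpose.det := by rwa [Matrix.det_transpose]
  have hO : (L⁻¹ * B) * (L⁻¹ * B).transpose = 1 := by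
    rw [Matrix.transpose_mul, Matrix.mul_assoc, ← Matrix.mul_assoc B, ← hLB, Matrix.mul_assoc L,
      Matrix.transpose_nonsing_inv, Matrix.mul_nonsing_inv _ hLt, Matrix.mul_one,
      Matrix.nonsing_inv_mul _ hLg]
  obtain ⟨R, hR⟩ := exists_isometry_of_matrix hO
  refine ⟨R, fun φ hφ hinv θ hθ => ?_⟩
  have hg : Measurable fun (X : Sample n p) i => a + act B (X i) :=
    measurable_pi_iff.2 fun i => ((measurable_act B).comp (measurable_pi_apply i)).const_add a
  rw [power, sampleLaw_eq_map hf a hB hθ, integral_map hg.aemeasurable hφ.aestronglyMeasurable]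
  refine integral_congr_ae (ae_of_all _ fun X => ?_)
  simp only
  rw [← hinv a L hL fun i => R (X i)]
  simp only [hR, ← act_mul, ← Matrix.mul_assoc, Matrix.mul_nonsing_inv _ hLg, Matrix.one_mul]

lemma integral_comp_isometry_stdLaw (R : Vec p ≃ₗᵢ[ℝ] Vec p) (F : Sample n p → ℝ) :
    ∫ X, F (fun i => R (X i)) ∂stdLaw n p = ∫ X, F X ∂stdLaw n p :=
  (measurePreserving_isometry R).integral_comp
    (MeasurableEquiv.piCongrRight fun _ : Fin n => R.toMeasurableEquiv).measurableEmbedding F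

lemma power_zero_eq (hf : IsShapeFamily f) {φ : Sample n p → ℝ} (hφ : Measurable φ)
    (hinv : IsInvariant (ltSet p) φ) (a : Vec p) {B : Matrix (Fin p) (Fin p) ℝ}
    (hB : B ∈ glSet p) : power f φ a B 0 = ∫ X, φ X ∂stdLaw n p := by
  obtain ⟨R, hR⟩ := exists_isometry_power_eq (n := n) hf a hB
  rw [hR φ hφ hinv 0 le_rfl, sampleLaw_std_zero hf, integral_comp_isometry_stdLaw]

lemma power_congr_ae (hf : IsShapeFamily f) {φ ψ : Sample n p → ℝ} (hφ : Measurable φ)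
    (hφi : IsInvariant (ltSet p) φ) (hψ : Measurable ψ) (hψi : IsInvariant (ltSet p) ψ)
    (h : φ =ᵐ[stdLaw n p] ψ) (a : Vec p) {B : Matrix (Fin p) (Fin p) ℝ} (hB : B ∈ glSet p)
    {θ : ℝ} (hθ : 0 ≤ θ) : power f φ a B θ = power f ψ a B θ := by
  obtain ⟨R, hR⟩ := exists_isometry_power_eq (n := n) hf a hB
  rw [hR φ hφ hφi θ hθ, hR ψ hψ hψi θ hθ]
  refine integral_congr_ae ?_
  rw [sampleLaw_std_eq_withDensity hf hθ]
  exact (withDensity_absolutelyContinuous _ _).ae_le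
    ((measurePreserving_isometry R).quasiMeasurePreserving.ae h)

/-- The remaining rotation disappears in the limit because the normal law and the score are both
radial; hence one slope serves every `(a, B)`. -/
lemma tendsto_power_slope {p₀ p₁ p₂ : ℝ} (hf : IsShapeFamily f)
    (hs : QuarticScoreCondition n f p₀ p₁ p₂) (hp : 0 < p) (hn : 0 < n) {φ : Sample n p → ℝ}
    (hφ : IsTest φ) (hinv : IsInvariant (ltSet p) φ) (a : Vec p)
    {B : Matrix (Fin p) (Fin p) ℝ} (hB : B ∈ glSet p) :
    Filter.Tendsto (fun θ => θ⁻¹ * (power f φ a B θ - ∫ X, φ X ∂stdLaw n p))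
      (nhdsWithin 0 (Set.Ioi 0))
      (nhds (∫ X, φ X * ∑ i, (p₀ * ‖X i‖ ^ 4 + p₁ * ‖X i‖ ^ 2 + p₂) ∂stdLaw n p)) := by
  obtain ⟨ε, hε, hfin⟩ := hs.exists_scoreBound_lt_top hf hp hn
  obtain ⟨R, hR⟩ := exists_isometry_power_eq (n := n) hf a hB
  have hm : Measurable fun X : Sample n p => φ fun i => R (X i) :=
    hφ.measurable.comp (measurePreserving_isometry R).measurable
  have h := tendsto_slope_integral_sampleLaw hf hε hfin hm (C := 1) fun X => by
    rw [abs_of_nonneg (hφ.nonneg _)]; exact hφ.le_one _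
  rw [integral_comp_isometry_stdLaw R φ] at h
  simp only [hs.score] at h
  have e := integral_comp_isometry_stdLaw R
    fun X : Sample n p => φ X * ∑ i, (p₀ * ‖X i‖ ^ 4 + p₁ * ‖X i‖ ^ 2 + p₂)
  simp only [LinearIsometryEquiv.norm_map] at e
  rw [e] at h
  refine h.congr' ?_
  filter_upwards [self_mem_nhdsWithin] with θ hθ
  rw [hR φ hφ.measurable hinv θ (Set.mem_Ioi.1 hθ).le]

/-- The normal density is positive everywhere, so dividing by it recovers Lebesgue measure. This
turns statements almost everywhere under the null law into Lebesgue ones. -/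
lemma volume_absolutelyContinuous_stdLaw : (volume : Measure (Sample n p)) ≪ stdLaw n p := by
  have hc := continuous_stdDensity (E := Vec p)
  have hvol : (volume : Measure (Vec p)) =
      (stdGaussian (Vec p)).withDensity fun x => (ENNReal.ofReal (stdDensity (Vec p) x))⁻¹ := by
    rw [stdGaussian_eq_withDensity]
    refine (withDensity_inv_same (by fun_prop) (ae_of_all _ fun x => ?_)
      (ae_of_all _ fun x => ENNReal.ofReal_ne_top)).symm
    exact (ENNReal.ofReal_pos.2 (stdDensity_pos x)).ne'
  have hsf : SigmaFinite ((stdGaussian (Vec p)).withDensity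
      fun x => (ENNReal.ofReal (stdDensity (Vec p) x))⁻¹) := by
    rw [← hvol]; infer_instance
  rw [volume_pi, hvol, pi_withDensity_eq _ (by fun_prop), stdLaw]
  exact withDensity_absolutelyContinuous _ _

end Reduction

/-! ### Neyman–Pearson lemma -/

section NeymanPearson

variable {Ω : Type*} [MeasurableSpace Ω] {μ : Measure Ω} [IsProbabilityMeasure μ]

lemma exists_randomized_level {T : Ω → ℝ} (hT : Measurable T) {C : ℝ} (hC : ∀ ω, |T ω| ≤ C) {α : ℝ}
    (h0 : 0 ≤ α) (h1 : α ≤ 1) :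
    ∃ k γ : ℝ, 0 ≤ γ ∧ γ ≤ 1 ∧ μ.real {ω | k < T ω} + γ * μ.real {ω | T ω = k} = α := by
  -- For `α = 1` every threshold belongs to the set `A` below, which is then unbounded below; a
  -- threshold under the range of `T` is used instead.
  rcases h1.eq_or_lt with rfl | h1
  · refine ⟨-C - 1, 0, le_rfl, zero_le_one, ?_⟩
    have : {ω | -C - 1 < T ω} = Set.univ := Set.eq_univ_of_forall fun ω => by
      have := (abs_le.1 (hC ω)).1
      simp only [Set.mem_ofPred_eq]; linarith
    rw [this]; simp
  set A : Set ℝ := {t | μ.real {ω | t < T ω} ≤ α} with hA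
  have hAC : C ∈ A := by
    have : {ω | C < T ω} = ∅ := Set.eq_empty_of_forall_notMem fun ω h =>
      absurd ((abs_le.1 (hC ω)).2) (not_le.2 h)
    simp [hA, this, h0]
  have hAb : BddBelow A := by
    refine ⟨-C, fun t ht => ?_⟩
    by_contra hlt
    have : {ω | t < T ω} = Set.univ := Set.eq_univ_of_forall fun ω => by
      have := (abs_le.1 (hC ω)).1
      simp only [Set.mem_ofPred_eq]; linarith
    rw [hA, Set.mem_ofPred_eq, this, probReal_univ] at ht
    linarith
  set k := sInf A with hk
  have hgt : ∀ t, k < t → μ.real {ω | t < T ω} ≤ α := by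
    intro t ht
    obtain ⟨s, hs, hst⟩ := exists_lt_of_csInf_lt ⟨C, hAC⟩ ht
    exact (measureReal_mono fun ω (hω : t < T ω) => hst.trans hω).trans hs
  have hlt : ∀ t, t < k → α ≤ μ.real {ω | t < T ω} := by
    intro t ht
    by_contra h
    exact notMem_of_lt_csInf ht hAb (not_le.1 h).le
  have hup : μ.real {ω | k < T ω} ≤ α := by
    have e : {ω | k < T ω} = ⋃ m : ℕ, {ω | k + 1 / ((m : ℝ) + 1) < T ω} := by
      ext ω
      simp only [Set.mem_ofPred_eq, Set.mem_iUnion]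
      constructor
      · intro h
        obtain ⟨m, hm⟩ := exists_nat_one_div_lt (sub_pos.2 h)
        exact ⟨m, by linarith⟩
      · rintro ⟨m, hm⟩
        have : (0 : ℝ) < 1 / ((m : ℝ) + 1) := by positivity
        linarith
    have hmono : Monotone fun m : ℕ => {ω | k + 1 / ((m : ℝ) + 1) < T ω} := by
      intro a b hab ω hω
      have : 1 / ((b : ℝ) + 1) ≤ 1 / ((a : ℝ) + 1) := Nat.one_div_le_one_div hab
      simp only [Set.mem_ofPred_eq] at hω ⊢
      linarith
    rw [e, measureReal_def, hmono.measure_iUnion]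
    refine ENNReal.toReal_le_of_le_ofReal h0 (iSup_le fun m => ?_)
    rw [← ofReal_measureReal]
    refine ENNReal.ofReal_le_ofReal (hgt _ ?_)
    have : (0 : ℝ) < 1 / ((m : ℝ) + 1) := by positivity
    linarith
  have hlow : α ≤ μ.real {ω | k ≤ T ω} := by
    have e : {ω | k ≤ T ω} = ⋂ m : ℕ, {ω | k - 1 / ((m : ℝ) + 1) < T ω} := by
      ext ω
      simp only [Set.mem_ofPred_eq, Set.mem_iInter]
      constructor
      · intro h m
        have : (0 : ℝ) < 1 / ((m : ℝ) + 1) := by positivity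
        linarith
      · intro h
        by_contra hc
        obtain ⟨m, hm⟩ := exists_nat_one_div_lt (sub_pos.2 (not_le.1 hc))
        linarith [h m]
    have hanti : Antitone fun m : ℕ => {ω | k - 1 / ((m : ℝ) + 1) < T ω} := by
      intro a b hab ω hω
      have : 1 / ((b : ℝ) + 1) ≤ 1 / ((a : ℝ) + 1) := Nat.one_div_le_one_div hab
      simp only [Set.mem_ofPred_eq] at hω ⊢
      linarith
    rw [e, measureReal_def, hanti.measure_iInter
      (fun m => (measurableSet_lt measurable_const hT).nullMeasurableSet) ⟨0, measure_ne_top _ _⟩]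
    refine (ENNReal.ofReal_le_iff_le_toReal ?_).1 (le_iInf fun m => ?_)
    · exact ne_top_of_le_ne_top (measure_ne_top μ _) (iInf_le _ 0)
    · rw [← ofReal_measureReal]
      refine ENNReal.ofReal_le_ofReal (hlt _ ?_)
      have : (0 : ℝ) < 1 / ((m : ℝ) + 1) := by positivity
      linarith
  have hsplit : μ.real {ω | k ≤ T ω} = μ.real {ω | k < T ω} + μ.real {ω | T ω = k} := by
    have hm : MeasurableSet {ω | T ω = k} := hT (measurableSet_singleton k)
    have hd : Disjoint {ω | k < T ω} {ω | T ω = k} :=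
      Set.disjoint_left.2 fun ω h1 h2 => (ne_of_gt (show k < T ω from h1)) h2
    rw [← measureReal_union hd hm]
    congr 1
    ext ω
    simp only [Set.mem_ofPred_eq, Set.mem_union]
    rw [le_iff_lt_or_eq, eq_comm (a := k)]
  rcases (measureReal_nonneg (μ := μ) (s := {ω | T ω = k})).eq_or_lt with h | h
  · exact ⟨k, 0, le_rfl, zero_le_one, by linarith⟩
  · refine ⟨k, (α - μ.real {ω | k < T ω}) / μ.real {ω | T ω = k}, ?_, ?_, ?_⟩
    · exact div_nonneg (by linarith) h.le
    · rw [div_le_one h]; linarith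
    · rw [div_mul_cancel₀ _ h.ne']; ring

omit [IsProbabilityMeasure μ] in
/-- Uniqueness part of the Neyman–Pearson lemma. -/
lemma ae_eq_one_zero_of_integral_le {T φ ψ : Ω → ℝ} {k : ℝ} (hψ0 : ∀ ω, 0 ≤ ψ ω)
    (hψ1 : ∀ ω, ψ ω ≤ 1) (hφ1 : ∀ ω, k < T ω → φ ω = 1) (hφ0 : ∀ ω, T ω < k → φ ω = 0)
    (hφ : Integrable φ μ) (hψ : Integrable ψ μ) (hφT : Integrable (fun ω => φ ω * T ω) μ)
    (hψT : Integrable (fun ω => ψ ω * T ω) μ) (heq : ∫ ω, ψ ω ∂μ = ∫ ω, φ ω ∂μ)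
    (hle : ∫ ω, φ ω * T ω ∂μ ≤ ∫ ω, ψ ω * T ω ∂μ) :
    ∀ᵐ ω ∂μ, (k < T ω → ψ ω = 1) ∧ (T ω < k → ψ ω = 0) := by
  -- The expression is `(φ - ψ)(T - k)`, nonnegative by the form of `φ`. Its integral is at most `0`
  -- by assumption, so it vanishes almost everywhere.
  have hnn : ∀ ω, 0 ≤ (φ ω * T ω - ψ ω * T ω) - k * (φ ω - ψ ω) := by
    intro ω
    have e : (φ ω * T ω - ψ ω * T ω) - k * (φ ω - ψ ω) = (φ ω - ψ ω) * (T ω - k) := by ring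
    rw [e]
    rcases lt_trichotomy k (T ω) with h | h | h
    · rw [hφ1 ω h]; exact mul_nonneg (by linarith [hψ1 ω]) (by linarith)
    · rw [h]; simp
    · rw [hφ0 ω h]; exact mul_nonneg_of_nonpos_of_nonpos (by linarith [hψ0 ω]) (by linarith)
  have hI1 : Integrable (fun ω => φ ω * T ω - ψ ω * T ω) μ := hφT.sub hψT
  have hI2 : Integrable (fun ω => k * (φ ω - ψ ω)) μ := (hφ.sub hψ).const_mul k
  have hI : Integrable (fun ω => (φ ω * T ω - ψ ω * T ω) - k * (φ ω - ψ ω)) μ := hI1.sub hI2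
  have hint : ∫ ω, (φ ω * T ω - ψ ω * T ω) - k * (φ ω - ψ ω) ∂μ = 0 := by
    refine le_antisymm ?_ (integral_nonneg hnn)
    rw [integral_sub hI1 hI2, integral_sub hφT hψT,
      integral_const_mul, integral_sub hφ hψ, heq]
    linarith
  filter_upwards [(integral_eq_zero_iff_of_nonneg hnn hI).1 hint] with ω hω
  have e : (φ ω - ψ ω) * (T ω - k) = 0 := by
    have : (φ ω * T ω - ψ ω * T ω) - k * (φ ω - ψ ω) = 0 := hω
    linarith
  constructor
  · intro h
    rcases mul_eq_zero.1 e with h2 | h2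
    · rw [hφ1 ω h] at h2; linarith
    · linarith
  · intro h
    rcases mul_eq_zero.1 e with h2 | h2
    · rw [hφ0 ω h] at h2; linarith
    · linarith

end NeymanPearson

/-! ### From the slope of the power to locally best tests -/

section LocallyBest

variable {n p : ℕ} {f : Vec p → ℝ → ℝ} {G : Set (Matrix (Fin p) (Fin p) ℝ)} {T : Sample n p → ℝ}

lemma IsTest.integrable {φ : Sample n p → ℝ} (hφ : IsTest φ) : Integrable φ (stdLaw n p) :=
  integrable_of_bounded hφ.measurable (C := 1) fun X => by
    rw [abs_of_nonneg (hφ.nonneg X)]; exact hφ.le_one X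

lemma IsTest.integrable_mul {φ : Sample n p → ℝ} (hφ : IsTest φ) (hT : Measurable T) {C : ℝ}
    (hC : ∀ X, |T X| ≤ C) : Integrable (fun X => φ X * T X) (stdLaw n p) :=
  integrable_of_bounded (hφ.measurable.mul hT) (C := C) fun X => by
    rw [abs_mul, abs_of_nonneg (hφ.nonneg X)]
    exact (mul_le_of_le_one_left (abs_nonneg _) (hφ.le_one X)).trans (hC X)

lemma isTest_indicator (hT : Measurable T) (k : ℝ) :
    IsTest ({X | k < T X}.indicator fun _ => (1 : ℝ)) where
  measurable := measurable_const.indicator (measurableSet_lt measurable_const hT)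
  nonneg X := Set.indicator_nonneg (fun _ _ => zero_le_one) X
  le_one X := Set.indicator_le_self' (fun _ _ => zero_le_one) X

lemma isInvariant_indicator (hT : IsInvariant G T) (k : ℝ) :
    IsInvariant G ({X | k < T X}.indicator fun _ => (1 : ℝ)) := by
  intro a B hB X
  simp only [Set.indicator, Set.mem_ofPred_eq, hT a B hB X]

lemma eventually_power_lt {f : Vec p → ℝ → ℝ} {φ ψ : Sample n p → ℝ} {a : Vec p}
    {B : Matrix (Fin p) (Fin p) ℝ} {e d d' : ℝ}
    (hφ : Filter.Tendsto (fun θ => θ⁻¹ * (power f φ a B θ - e)) (nhdsWithin 0 (Set.Ioi 0)) (nhds d))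
    (hψ : Filter.Tendsto (fun θ => θ⁻¹ * (power f ψ a B θ - e)) (nhdsWithin 0 (Set.Ioi 0)) (nhds d'))
    (h : d' < d) : ∀ᶠ θ in nhdsWithin 0 (Set.Ioi 0), power f ψ a B θ < power f φ a B θ := by
  filter_upwards [hψ.eventually_lt hφ h, self_mem_nhdsWithin] with θ h1 h2
  have h2 : 0 < θ⁻¹ := inv_pos.2 h2
  have := lt_of_mul_lt_mul_left h1 h2.le
  linarith

lemma tendsto_power {f : Vec p → ℝ → ℝ} {φ : Sample n p → ℝ} {a : Vec p}
    {B : Matrix (Fin p) (Fin p) ℝ} {e d : ℝ}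
    (hφ : Filter.Tendsto (fun θ => θ⁻¹ * (power f φ a B θ - e)) (nhdsWithin 0 (Set.Ioi 0)) (nhds d)) :
    Filter.Tendsto (fun θ => power f φ a B θ) (nhdsWithin 0 (Set.Ioi 0)) (nhds e) := by
  have h0 : Filter.Tendsto (fun θ : ℝ => θ) (nhdsWithin 0 (Set.Ioi 0)) (nhds 0) :=
    Filter.tendsto_id.mono_left nhdsWithin_le_nhds
  have h := (h0.mul hφ).const_add e
  rw [zero_mul, add_zero] at h
  refine h.congr' ?_
  filter_upwards [self_mem_nhdsWithin] with θ hθ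
  rw [mul_inv_cancel_left₀ (Set.mem_Ioi.1 hθ).ne']
  ring

lemma exists_forall_Ioo_of_eventually {P : ℝ → Prop}
    (h : ∀ᶠ θ in nhdsWithin (0 : ℝ) (Set.Ioi 0), P θ) : ∃ ε > (0 : ℝ), ∀ θ ∈ Set.Ioo 0 ε, P θ := by
  obtain ⟨ε, hε, h⟩ := mem_nhdsGT_iff_exists_Ioo_subset.1 h
  exact ⟨ε, hε, fun θ hθ => h hθ⟩

/-- At fixed size the slope is an increasing affine function of `∫ φ T`, so the local comparison is
a Neyman–Pearson problem for `T`. Ties in both size and slope cause no trouble: against the region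
`{T > k}` they force equality almost everywhere, hence equal power at every `θ`. -/
theorem lbiRejectsForLarge_of_integral_score {p₀ p₁ p₂ : ℝ} (hf : IsShapeFamily f)
    (hs : QuarticScoreCondition n f p₀ p₁ p₂) (hp : 0 < p) (hn : 0 < n) (hG : ltSet p ⊆ G)
    (hTm : Measurable T) {C : ℝ} (hTC : ∀ X, |T X| ≤ C) (hTi : IsInvariant G T) {c₀ c₁ : ℝ}
    (hc₁ : 0 < c₁)
    (hkey : ∀ φ : Sample n p → ℝ, IsTest φ → IsInvariant G φ →
      ∫ X, φ X * ∑ i, (p₀ * ‖X i‖ ^ 4 + p₁ * ‖X i‖ ^ 2 + p₂) ∂stdLaw n p =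
        ∫ X, φ X * (c₀ + c₁ * T X) ∂stdLaw n p) :
    LBIRejectsForLarge f G T := by
  have hlt : ∀ {φ : Sample n p → ℝ}, IsInvariant G φ → IsInvariant (ltSet p) φ :=
    fun h a L hL X => h a L (hG hL) X
  have h1gl : (1 : Matrix (Fin p) (Fin p) ℝ) ∈ glSet p := by simp [glSet]
  set D : (Sample n p → ℝ) → ℝ := fun φ =>
    c₀ * ∫ X, φ X ∂stdLaw n p + c₁ * ∫ X, φ X * T X ∂stdLaw n p with hD
  have hslope : ∀ φ : Sample n p → ℝ, IsTest φ → IsInvariant G φ → ∀ a, ∀ B ∈ glSet p,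
      Filter.Tendsto (fun θ => θ⁻¹ * (power f φ a B θ - ∫ X, φ X ∂stdLaw n p))
        (nhdsWithin 0 (Set.Ioi 0)) (nhds (D φ)) := by
    intro φ hφ hinv a B hB
    have h := tendsto_power_slope hf hs hp hn hφ (hlt hinv) a hB
    rw [hkey φ hφ hinv] at h
    have e : ∫ X, φ X * (c₀ + c₁ * T X) ∂stdLaw n p = D φ := by
      rw [hD]
      simp only
      rw [← integral_const_mul, ← integral_const_mul, ← integral_add (hφ.integrable.const_mul _)
        ((hφ.integrable_mul hTm hTC).const_mul _)]
      refine integral_congr_ae (ae_of_all _ fun X => ?_)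
      simp only
      ring
    rwa [e] at h
  have hpow0 : ∀ φ : Sample n p → ℝ, IsTest φ → IsInvariant G φ → ∀ a, ∀ B ∈ glSet p,
      power f φ a B 0 = ∫ X, φ X ∂stdLaw n p := fun φ hφ hinv a B hB =>
    power_zero_eq hf hφ.measurable (hlt hinv) a hB
  -- an LBI test has the largest derivative among the invariant tests of the same size
  have hLBI : ∀ {α : ℝ} {φ ψ : Sample n p → ℝ}, IsLBI f G α φ → IsTest ψ → IsInvariant G ψ →
      ∫ X, ψ X ∂stdLaw n p = α →
        ∫ X, φ X ∂stdLaw n p = α ∧ ∫ X, ψ X * T X ∂stdLaw n p ≤ ∫ X, φ X * T X ∂stdLaw n p := by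
    intro α φ ψ hφ hψ hψi hα
    have hφα : ∫ X, φ X ∂stdLaw n p = α := by
      rw [← hpow0 φ hφ.isTest hφ.invariant 0 1 h1gl, hφ.size 0 1 h1gl]
    refine ⟨hφα, ?_⟩
    by_contra! hcon
    have hDlt : D φ < D ψ := by
      simp only [hD, hφα, hα]
      have := mul_lt_mul_of_pos_left hcon hc₁
      linarith
    have hsφ := hslope φ hφ.isTest hφ.invariant 0 1 h1gl
    have hsψ := hslope ψ hψ hψi 0 1 h1gl
    rw [hφα, ← hα] at hsφ
    have hev := eventually_power_lt hsψ hsφ hDlt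
    obtain ⟨ε, hε, hle⟩ := hφ.locally_best ψ hψ hψi
      (fun a B hB => by rw [hpow0 ψ hψ hψi a B hB, hα]) 0 1 h1gl
    obtain ⟨θ, h1, h2⟩ := (hev.and (Ioo_mem_nhdsGT hε)).exists
    exact absurd (hle θ h2) (not_le.2 h1)
  refine ⟨fun k => ?_, fun α φ hφ => ?_⟩
  · set R : Sample n p → ℝ := {X | k < T X}.indicator fun _ => (1 : ℝ) with hR
    have hRt : IsTest R := isTest_indicator hTm k
    have hRi : IsInvariant G R := isInvariant_indicator hTi k
    have hR1 : ∀ X, k < T X → R X = 1 := fun X h => Set.indicator_of_mem (show X ∈ {X | k < T X} from h) _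
    have hR0' : ∀ X, T X ≤ k → R X = 0 := fun X h =>
      Set.indicator_of_notMem (show X ∉ {X | k < T X} from not_lt.2 h) _
    have hR0 : ∀ X, T X < k → R X = 0 := fun X h => hR0' X h.le
    -- Neyman–Pearson leaves `ψ` free on `{T = k}`; there `R = 0 ≤ ψ`, so `ψ - R` is nonnegative
    -- with integral `0`.
    have huniq : ∀ ψ : Sample n p → ℝ, IsTest ψ →
        ∫ X, ψ X ∂stdLaw n p = ∫ X, R X ∂stdLaw n p →
        ∫ X, R X * T X ∂stdLaw n p ≤ ∫ X, ψ X * T X ∂stdLaw n p → ψ =ᵐ[stdLaw n p] R := by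
      intro ψ hψ heq hle
      have h := ae_eq_one_zero_of_integral_le hψ.nonneg hψ.le_one hR1 hR0 hRt.integrable
        hψ.integrable (hRt.integrable_mul hTm hTC) (hψ.integrable_mul hTm hTC) heq hle
      have hnn : 0 ≤ᵐ[stdLaw n p] fun X => ψ X - R X := by
        filter_upwards [h] with X hX
        rcases lt_or_ge k (T X) with h1 | h1
        · simp [hX.1 h1, hR1 X h1]
        · simp [hR0' X h1, hψ.nonneg X]
      have h0 : ∫ X, ψ X - R X ∂stdLaw n p = 0 := by
        rw [integral_sub hψ.integrable hRt.integrable, heq, sub_self]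
      filter_upwards [(integral_eq_zero_iff_of_nonneg_ae hnn
        (hψ.integrable.sub hRt.integrable)).1 h0] with X hX
      exact sub_eq_zero.1 hX
    refine ⟨∫ X, R X ∂stdLaw n p, ⟨hRt, hRi, hpow0 R hRt hRi, ?_⟩, ?_⟩
    · intro ψ hψ hψi hlev a B hB
      have hle : ∫ X, ψ X ∂stdLaw n p ≤ ∫ X, R X ∂stdLaw n p := by
        rw [← hpow0 ψ hψ hψi 0 1 h1gl]; exact hlev 0 1 h1gl
      have hsR := hslope R hRt hRi a B hB
      have hsψ := hslope ψ hψ hψi a B hB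
      -- A competitor of smaller size loses by continuity of the power at `θ = 0`; one of equal size
      -- loses by its slope, unless it equals `R` almost everywhere.
      rcases hle.lt_or_eq with hlt' | heq
      · refine exists_forall_Ioo_of_eventually ?_
        filter_upwards [(tendsto_power hsψ).eventually_lt (tendsto_power hsR) hlt'] with θ hθ
        exact hθ.le
      · by_cases hT : ∫ X, R X * T X ∂stdLaw n p ≤ ∫ X, ψ X * T X ∂stdLaw n p
        · refine ⟨1, one_pos, fun θ hθ => ?_⟩
          exact (power_congr_ae hf hψ.measurable (hlt hψi) hRt.measurable (hlt hRi)
            (huniq ψ hψ heq hT) a hB hθ.1.le).le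
        · refine exists_forall_Ioo_of_eventually ?_
          rw [heq] at hsψ
          have hDlt : D ψ < D R := by
            simp only [hD, heq]
            have := mul_lt_mul_of_pos_left (not_le.1 hT) hc₁
            linarith
          filter_upwards [eventually_power_lt hsR hsψ hDlt] with θ hθ
          exact hθ.le
    · intro ψ hψ
      obtain ⟨h1, h2⟩ := hLBI hψ hRt hRi rfl
      exact volume_absolutelyContinuous_stdLaw.ae_le (huniq ψ hψ.isTest h1 h2)
  · have hα : ∫ X, φ X ∂stdLaw n p = α := (hLBI (ψ := φ) hφ hφ.isTest hφ.invariant (by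
      rw [← hpow0 φ hφ.isTest hφ.invariant 0 1 h1gl, hφ.size 0 1 h1gl])).1
    have hα0 : 0 ≤ α := hα ▸ integral_nonneg hφ.isTest.nonneg
    have hα1 : α ≤ 1 := by
      rw [← hα]
      refine (integral_mono hφ.isTest.integrable (integrable_const 1) hφ.isTest.le_one).trans ?_
      simp
    obtain ⟨k, γ, hγ0, hγ1, hkγ⟩ := exists_randomized_level (μ := stdLaw n p) hTm hTC hα0 hα1
    -- The given test need not have the size of any region `{T > k}`. It is compared with a test of
    -- exactly its size, randomized on `{T = k}`, which is invariant because `T` is.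
    set ψ : Sample n p → ℝ := fun X => {X | k < T X}.indicator (fun _ => (1 : ℝ)) X +
      γ * {X | T X = k}.indicator (fun _ => (1 : ℝ)) X with hψ
    have hmk : MeasurableSet {X | T X = k} := hTm (measurableSet_singleton k)
    have hmk' : MeasurableSet {X | k < T X} := measurableSet_lt measurable_const hTm
    have hgt : ∀ X, k < T X → ψ X = 1 := fun X h => by
      simp [hψ, h, h.ne']
    have hlt0 : ∀ X, T X < k → ψ X = 0 := fun X h => by
      simp [hψ, h.not_gt, h.ne]
    have hmid : ∀ X, T X = k → ψ X = γ := fun X h => by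
      simp [hψ, h]
    have hψt : IsTest ψ := by
      refine ⟨(measurable_const.indicator hmk').add
        ((measurable_const.indicator hmk).const_mul γ), fun X => ?_, fun X => ?_⟩
      all_goals
        rcases lt_trichotomy (T X) k with h | h | h
        · simp [hlt0 X h]
        · rw [hmid X h]; assumption
        · simp [hgt X h]
    have hψi : IsInvariant G ψ := by
      intro a B hB X
      simp only [hψ, Set.indicator, Set.mem_ofPred_eq, hTi a B hB X]
    have hψα : ∫ X, ψ X ∂stdLaw n p = α := by
      rw [hψ, integral_add ((integrable_const _).indicator hmk')
        (((integrable_const _).indicator hmk).const_mul γ), integral_const_mul,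
        integral_indicator_const _ hmk', integral_indicator_const _ hmk]
      simpa using hkγ
    obtain ⟨-, h2⟩ := hLBI hφ hψt hψi hψα
    have h := ae_eq_one_zero_of_integral_le hφ.isTest.nonneg hφ.isTest.le_one hgt hlt0
      hψt.integrable hφ.isTest.integrable (hψt.integrable_mul hTm hTC)
      (hφ.isTest.integrable_mul hTm hTC) (hα.trans hψα.symm) h2
    exact ⟨k, volume_absolutelyContinuous_stdLaw.ae_le h⟩

end LocallyBest

/-! ### The two statistics -/

section Main

variable {n p : ℕ}

/-- The quadratic and constant parts of the score contribute multiples of `∫ φ`, so only the quartic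
part, through `h4`, decides the statistic. -/
lemma integral_mul_score (hpn : p < n) {φ : Sample n p → ℝ} (hφ : IsTest φ)
    (hinv : IsInvariant (ltSet p) φ) {T : Sample n p → ℝ} (hTm : Measurable T) {C : ℝ}
    (hTC : ∀ X, |T X| ≤ C) {b₀ b₁ : ℝ}
    (h4 : ∫ X, φ X * ∑ i, ‖X i‖ ^ 4 ∂stdLaw n p = ∫ X, φ X * (b₀ + b₁ * T X) ∂stdLaw n p)
    (p₀ p₁ p₂ : ℝ) :
    ∫ X, φ X * ∑ i, (p₀ * ‖X i‖ ^ 4 + p₁ * ‖X i‖ ^ 2 + p₂) ∂stdLaw n p =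
      ∫ X, φ X * ((p₀ * b₀ + p₁ * (p + traceConst n p) + n * p₂) + p₀ * b₁ * T X) ∂stdLaw n p := by
  obtain ⟨⟨hI2, h2⟩, hI4, -⟩ := integral_norm_pow_of_lt_invariant hpn hφ hinv
  have hI := hφ.integrable
  have hIT := hφ.integrable_mul hTm hTC
  have e1 : ∀ X : Sample n p, φ X * ∑ i, (p₀ * ‖X i‖ ^ 4 + p₁ * ‖X i‖ ^ 2 + p₂) =
      (p₀ * (φ X * ∑ i, ‖X i‖ ^ 4) + p₁ * (φ X * ∑ i, ‖X i‖ ^ 2)) + n * p₂ * φ X := by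
    intro X
    simp only [Finset.sum_add_distrib, ← Finset.mul_sum, Finset.sum_const, Finset.card_univ,
      Fintype.card_fin, nsmul_eq_mul]
    ring
  have hlin : ∀ c d : ℝ, ∫ X, φ X * (c + d * T X) ∂stdLaw n p =
      c * ∫ X, φ X ∂stdLaw n p + d * ∫ X, φ X * T X ∂stdLaw n p := by
    intro c d
    rw [← integral_const_mul, ← integral_const_mul,
      ← integral_add (hI.const_mul _) (hIT.const_mul _)]
    refine integral_congr_ae (ae_of_all _ fun X => ?_)
    simp only
    ring
  have hI42 : Integrable (fun X => p₀ * (φ X * ∑ i, ‖X i‖ ^ 4) + p₁ * (φ X * ∑ i, ‖X i‖ ^ 2))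
      (stdLaw n p) := (hI4.const_mul _).add (hI2.const_mul _)
  simp_rw [e1]
  rw [integral_add hI42 (hI.const_mul _),
    integral_add (hI4.const_mul _) (hI2.const_mul _), integral_const_mul, integral_const_mul,
    integral_const_mul, h4, h2, hlin, hlin]
  ring

lemma measurable_kurtosisStat (hn : 0 < n) : Measurable (kurtosisStat : Sample n p → ℝ) :=
  Finset.measurable_sum _ fun i _ => (measurable_standardized hn i).norm.pow_const 4

lemma continuous_sum_triangularForm : Continuous fun v : Fin n → Fin p → ℝ =>
    (n : ℝ) ^ 2 * ∑ i, triangularForm n (v i) := by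
  unfold triangularForm; fun_prop

lemma measurable_triangularStat (hn : 0 < n) : Measurable (triangularStat : Sample n p → ℝ) := by
  rw [funext fun X => triangularStat_eq hn X]
  exact continuous_sum_triangularForm.measurable.comp (g := fun v : Fin n → Fin p → ℝ =>
    (n : ℝ) ^ 2 * ∑ i, triangularForm n (v i)) (f := fun X i j => stdSq X i j)
    (measurable_pi_iff.2 fun i => measurable_pi_iff.2 fun j => measurable_stdSq hn i j)

lemma abs_kurtosisStat_le (hn : 0 < n) (X : Sample n p) :
    |kurtosisStat X| ≤ n ^ 2 * ∑ _i : Fin n, (p : ℝ) ^ 2 := by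
  have hs : ∀ i, ∑ j, stdSq X i j ≤ p := fun i => by
    calc ∑ j, stdSq X i j ≤ ∑ _j : Fin p, (1 : ℝ) :=
          Finset.sum_le_sum fun j _ => stdSq_le_one hn X i j
      _ = p := by simp
  have h0 : ∀ i, 0 ≤ ∑ j, stdSq X i j := fun i => Finset.sum_nonneg fun j _ => stdSq_nonneg X i j
  rw [kurtosisStat_eq hn, abs_of_nonneg (by positivity)]
  gcongr with i
  · exact h0 i
  · exact hs i

lemma exists_abs_triangularStat_le (hn : 0 < n) : ∃ C, ∀ X : Sample n p, |triangularStat X| ≤ C := by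
  obtain ⟨C, hC⟩ := (isCompact_Icc (a := (0 : Fin n → Fin p → ℝ)) (b := 1)).exists_bound_of_continuousOn
    continuous_sum_triangularForm.continuousOn
  refine ⟨C, fun X => ?_⟩
  rw [triangularStat_eq hn, ← Real.norm_eq_abs]
  exact hC (fun i => stdSq X i) ⟨fun i j => stdSq_nonneg X i j, fun i j => stdSq_le_one hn X i j⟩

lemma isInvariant_kurtosisStat (hn : 0 < n) :
    IsInvariant (glSet p) (kurtosisStat : Sample n p → ℝ) := by
  intro a B hB X
  simp only [kurtosisStat, norm_standardized_affine hn a hB X]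

lemma isInvariant_triangularStat (hn : 0 < n) :
    IsInvariant (ltSet p) (triangularStat : Sample n p → ℝ) := by
  intro a L hL X
  simp only [triangularStat, standardized_affine hn a hL X]

end Main

end MultiNormalityTest

theorem theorem3 (n p : ℕ) (hp : 0 < p) (hn : p < n)
    (f : MultiNormalityTest.Vec p → ℝ → ℝ) (hf : MultiNormalityTest.IsShapeFamily f)
    (p₀ p₁ p₂ : ℝ) (hscore : MultiNormalityTest.QuarticScoreCondition n f p₀ p₁ p₂) :
    MultiNormalityTest.LBIRejectsForLarge f (MultiNormalityTest.glSet p)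
        (MultiNormalityTest.kurtosisStat (n := n)) ∧
      MultiNormalityTest.LBIRejectsForLarge f (MultiNormalityTest.ltSet p)
        (MultiNormalityTest.triangularStat (n := n)) := by
  have hn0 : 0 < n := hp.trans hn
  -- `n ≥ 2` makes the factor `n² - 1` of the kurtosis statistic positive, hence also the slope
  -- coefficient `c₁`.
  have hn1 : (1 : ℝ) < n := by exact_mod_cast (show 1 < n by omega)
  have h0 := hscore.pos
  have hn2 : (0 : ℝ) < n ^ 2 - 1 := by nlinarith
  obtain ⟨C, hC⟩ := MultiNormalityTest.exists_abs_triangularStat_le (p := p) hn0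
  exact ⟨MultiNormalityTest.lbiRejectsForLarge_of_integral_score hf hscore hp hn0
      MultiNormalityTest.ltSet_subset_glSet (MultiNormalityTest.measurable_kurtosisStat hn0)
      (MultiNormalityTest.abs_kurtosisStat_le hn0)
      (MultiNormalityTest.isInvariant_kurtosisStat hn0)
      (c₁ := p₀ * (((n : ℝ) ^ 2 - 1) / n ^ 2)) (by positivity) fun φ hφ hinv =>
        MultiNormalityTest.integral_mul_score hn hφ
          (MultiNormalityTest.invariant_lt_of_gl hinv)
          (MultiNormalityTest.measurable_kurtosisStat hn0)
          (MultiNormalityTest.abs_kurtosisStat_le hn0)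
          (MultiNormalityTest.integral_norm_pow_four_of_gl_invariant hn hp hφ hinv) p₀ p₁ p₂,
    MultiNormalityTest.lbiRejectsForLarge_of_integral_score hf hscore hp hn0
      subset_rfl (MultiNormalityTest.measurable_triangularStat hn0) hC
      (MultiNormalityTest.isInvariant_triangularStat hn0)
      (c₁ := p₀ * ((n : ℝ) ^ 2)⁻¹) (by positivity) fun φ hφ hinv =>
        MultiNormalityTest.integral_mul_score hn hφ hinv
          (MultiNormalityTest.measurable_triangularStat hn0) hC
          (MultiNormalityTest.integral_norm_pow_of_lt_invariant hn hφ hinv).2.2 p₀ p₁ p₂⟩
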